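/- **Setting.** Fix $p\ge 1$, a set $\Theta\subset\mathbb R^p$ and estimating functions $\psi_z(y,x;\theta)\in\mathbb R^p$, $z\in\{0,1\}$, $(x,y)\in\mathcal X\times\mathcal Y$. Consider a sequence of finite populations whose sizes $N$ tend to infinity; in the population of size $N$, unit $i$ has fixed potential outcomes $Y_i(1),Y_i(0)\in\mathcal Y$ and covariates $X_i\in\mathcal X$ (all depending on the population). In a completely randomized experiment, $n_1$ units are assigned to treatment ($Z_i=1$) and $n_0=N-n_1$ to control ($Z_i=0$), all such assignments being equally likely; $Y_i=Y_i(Z_i)$ is observed, and this randomization is the only source of randomness. Write $r_z=n_z/N$, $E_N$ for the population average, $\mathrm{Cov}_N$ for the population covariance matrix (divisor $N-1$), $\mathrm{Cov}^z_N$ for the sample covariance matrix over the units with $Z_i=z$ (divisor $n_z-1$), $\psi_{zi}(\theta)=\psi_z(Y_i(z),X_i;\theta)$, a dot for the derivative in $\theta$, $o_{\rm pr}(1)$ for convergence to $0$ in probability, $$\hat\Psi_N(\theta)=E_N\{\psi_{Z_i}(Y_i,X_i;\theta)\},\qquad \Psi_N(\theta)=r_1E_N\{\psi_{1i}(\theta)\}+r_0E_N\{\psi_{0i}(\theta)\},$$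 and $\Delta(f,\theta_N,\delta)=\sup_{\theta\in\Theta,\ \|\theta-\theta_N\|\le\delta}\|f(\theta)-f(\theta_N)\|$. Suppose: 1. $\theta_N\in\Theta$, $\Psi_N(\theta_N)=0$, and for some $\varepsilon_0>0$ the ball $\{\theta:\|\theta-\theta_N\|<\varepsilon_0\}$ is contained in $\Theta$ for all $N$. 2. Each $\psi_z(y,x;\cdot)$ is continuously differentiable on $\Theta$, and for $z=0,1$, as $\delta\downarrow0$, $\sup_NE_N\{\Delta(\dot\psi_{zi},\theta_N,\delta)\}\to0$ and $\sup_NE_N\{\Delta^2(\psi_{zi},\theta_N,\delta)\}\to0$. 3. $r_1,r_0$ are bounded away from $0$ and $1$. For $z=0,1$: the largest singular value of $\mathrm{Cov}_N\{\psi_{zi}(\theta_N)\}$ is bounded over $N$; the singular values of $\dot\Psi_N(\theta_N)$ lie in $[c_1,c_2]$ for all $N$, for some constants $0<c_1<c_2$; and $N^{-1}\max_{1\le j\le N}\|\psi_{zj}(\theta_N)-E_N\{\psi_{zi}(\theta_N)\}\|^2\to0$. 4. $\hat\theta_N\in\Theta$ is a root of $\hat\Psi_N$ (for every assignment), $\hat\theta_N-\theta_N=o_{\rm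 pr}(1)$, and for some $\rho>0$, $\sup_{\theta\in\Theta,\ \|\theta-\theta_N\|\le\rho}\|\dot{\hat\Psi}_N(\theta)-\dot\Psi_N(\theta)\|=o_{\rm pr}(1)$. Let $$\hat\Sigma_N=\{\dot{\hat\Psi}_N(\hat\theta_N)\}^{-1}\big[r_0\mathrm{Cov}^1_N\{\psi_{1i}(\hat\theta_N)\}+r_1\mathrm{Cov}^0_N\{\psi_{0i}(\hat\theta_N)\}\big]\{\dot{\hat\Psi}_N(\hat\theta_N)^\top\}^{-1},$$ $$\tilde\Sigma_N=r_1r_0\{\dot\Psi_N(\theta_N)\}^{-1}\big[r_1^{-1}\mathrm{Cov}_N\{\psi_{1i}(\theta_N)\}+r_0^{-1}\mathrm{Cov}_N\{\psi_{0i}(\theta_N)\}\big]\{\dot\Psi_N(\theta_N)^\top\}^{-1}.$$ **Corollary.** Assume further that the smallest singular value of $\tilde\Sigma_N$ is bounded away from zero uniformly in $N$. Then for every $v\in\mathbb R^{p\times m}$ of full column rank and every $\alpha\in(0,1)$, the matrices $\dot{\hat\Psi}_N(\hat\theta_N)$ and $v^\top\hat\Sigma_Nv$ are invertible with probability tending to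 one, and $$\liminf_{N\to\infty}\mathrm{pr}\Big\{N(v^\top\hat\theta_N-v^\top\theta_N)^\top(v^\top\hat\Sigma_Nv)^{-1}(v^\top\hat\theta_N-v^\top\theta_N)\le\chi^2_{m,1-\alpha}\Big\}\ge1-\alpha,$$ where $\chi^2_{m,1-\alpha}$ is the $1-\alpha$ quantile of the chi-squared distribution with $m$ degrees of freedom. That is, $\{\omega\in\mathbb R^m: N(v^\top\hat\theta_N-\omega)^\top(v^\top\hat\Sigma_Nv)^{-1}(v^\top\hat\theta_N-\omega)\le\chi^2_{m,1-\alpha}\}$ is an asymptotic $1-\alpha$ confidence set for $v^\top\theta_N$. -/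

import Mathlib

open Filter Topology MeasureTheory ProbabilityTheory
open scoped ENNReal Matrix

noncomputable section

/-- A finite population together with the size of its treatment arm: `N` units, `n₁` of which are
to be treated, the fixed potential outcomes `Y z i` (`z = true` is treatment, `z = false` is
control) and the fixed covariates `X i`. Outcomes and covariates take values in arbitrary types,
their supports. -/
structure FinitePopulation (𝒴 𝒳 : Type*) where
  N : ℕ
  n₁ : ℕ
  n₁_le : n₁ ≤ N
  Y : Bool → Fin N → 𝒴
  X : Fin N → 𝒳

namespace FinitePopulation

variable {𝒴 𝒳 : Type*} (P : FinitePopulation 𝒴 𝒳)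

/-- The number of units in arm `z`. -/
def armSize (z : Bool) : ℕ := if z then P.n₁ else P.N - P.n₁

/-- The proportion of units in arm `z`. -/
def r (z : Bool) : ℝ := (P.armSize z : ℝ) / (P.N : ℝ)

/-- A treatment assignment: `Z i = true` if unit `i` is treated. -/
abbrev Assignment : Type := Fin P.N → Bool

/-- The assignments of the completely randomized experiment: exactly `n₁` units are treated. -/
def design : Finset P.Assignment :=
  Finset.univ.filter fun Z => (Finset.univ.filter fun i => Z i = true).card = P.n₁

open Classical in
/-- The probability of an event under the completely randomized experiment, in which all
assignments with exactly `n₁` treated units are equally likely. -/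
def pr (A : P.Assignment → Prop) : ℝ :=
  ((P.design.filter A).card : ℝ) / (P.design.card : ℝ)

/-- The observed outcome of unit `i`. -/
def observed (Z : P.Assignment) (i : Fin P.N) : 𝒴 := P.Y (Z i) i

variable {p : ℕ}

/-- Finite population average. -/
def mean {E : Type*} [AddCommGroup E] [Module ℝ E] (a : Fin P.N → E) : E :=
  (P.N : ℝ)⁻¹ • ∑ i, a i

/-- Finite population average of quantities in `[0, ∞]`. -/
def emean (a : Fin P.N → ℝ≥0∞) : ℝ≥0∞ := (P.N : ℝ≥0∞)⁻¹ * ∑ i, a i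

/-- Finite population covariance matrix, with divisor `N - 1`. -/
def cov (a : Fin P.N → EuclideanSpace ℝ (Fin p)) : Matrix (Fin p) (Fin p) ℝ :=
  Matrix.of fun k l =>
    ((P.N : ℝ) - 1)⁻¹ * ∑ i, (a i k - P.mean a k) * (a i l - P.mean a l)

/-- Sample average in arm `z`. -/
def sampleMean (Z : P.Assignment) (z : Bool) (a : Fin P.N → EuclideanSpace ℝ (Fin p)) :
    EuclideanSpace ℝ (Fin p) :=
  (P.armSize z : ℝ)⁻¹ • ∑ i with Z i = z, a i

/-- Sample covariance matrix in arm `z`, with divisor `n_z - 1`. -/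
def sampleCov (Z : P.Assignment) (z : Bool) (a : Fin P.N → EuclideanSpace ℝ (Fin p)) :
    Matrix (Fin p) (Fin p) ℝ :=
  Matrix.of fun k l => ((P.armSize z : ℝ) - 1)⁻¹ *
    ∑ i with Z i = z, (a i k - P.sampleMean Z z a k) * (a i l - P.sampleMean Z z a l)

end FinitePopulation

/-- An estimating function `ψ_z(y, x; θ)`, one for each arm `z`, with values in `ℝᵖ`. -/
abbrev EstimatingFunction (𝒴 𝒳 : Type*) (p : ℕ) : Type _ :=
  Bool → 𝒴 → 𝒳 → EuclideanSpace ℝ (Fin p) → EuclideanSpace ℝ (Fin p)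

/-- The Jacobian matrix of a linear map of `ℝᵖ` in the standard basis. -/
def jacobianMatrix {p : ℕ} (L : EuclideanSpace ℝ (Fin p) →L[ℝ] EuclideanSpace ℝ (Fin p)) :
    Matrix (Fin p) (Fin p) ℝ :=
  Matrix.of fun i j => L (EuclideanSpace.single j 1) i

/-- Largest singular value of a `p × p` matrix. -/
def sigmaMax {p : ℕ} (A : Matrix (Fin p) (Fin p) ℝ) : ℝ :=
  (Matrix.toEuclideanLin A).singularValues 0

/-- Smallest singular value of a `p × p` matrix (singular values are listed in descending order,
starting from index `0`). -/
def sigmaMin {p : ℕ} (A : Matrix (Fin p) (Fin p) ℝ) : ℝ :=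
  (Matrix.toEuclideanLin A).singularValues (p - 1)

/-- `sup {‖f θ - f θ₀‖ : θ ∈ Θ, ‖θ - θ₀‖ ≤ δ}`, as an element of `[0, ∞]`. -/
def localModulus {p : ℕ} {F : Type*} [NormedAddCommGroup F] (Θ : Set (EuclideanSpace ℝ (Fin p)))
    (f : EuclideanSpace ℝ (Fin p) → F) (θ₀ : EuclideanSpace ℝ (Fin p)) (δ : ℝ) : ℝ≥0∞ :=
  ⨆ θ ∈ {θ | θ ∈ Θ ∧ ‖θ - θ₀‖ ≤ δ}, ‖f θ - f θ₀‖ₑ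

namespace FinitePopulation

variable {𝒴 𝒳 : Type*} (P : FinitePopulation 𝒴 𝒳) {p : ℕ} (ψ : EstimatingFunction 𝒴 𝒳 p)
  (Θ : Set (EuclideanSpace ℝ (Fin p)))

/-- `ψ_{zi}(θ) = ψ_z(Y_i(z), X_i; θ)`. -/
def unitPsi (z : Bool) (i : Fin P.N) (θ : EuclideanSpace ℝ (Fin p)) : EuclideanSpace ℝ (Fin p) :=
  ψ z (P.Y z i) (P.X i) θ

/-- The empirical estimating equation, computed from the observed data. -/
def PsiHat (Z : P.Assignment) (θ : EuclideanSpace ℝ (Fin p)) : EuclideanSpace ℝ (Fin p) :=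
  P.mean fun i => ψ (Z i) (P.observed Z i) (P.X i) θ

/-- The finite population estimating equation. -/
def Psi (θ : EuclideanSpace ℝ (Fin p)) : EuclideanSpace ℝ (Fin p) :=
  P.r true • P.mean (fun i => P.unitPsi ψ true i θ) +
    P.r false • P.mean (fun i => P.unitPsi ψ false i θ)

/-- Derivative in `θ ∈ Θ` of the empirical estimating equation. -/
def PsiHatDeriv (Z : P.Assignment) (θ : EuclideanSpace ℝ (Fin p)) :
    EuclideanSpace ℝ (Fin p) →L[ℝ] EuclideanSpace ℝ (Fin p) :=
  fderivWithin ℝ (P.PsiHat ψ Z) Θ θ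

/-- Derivative in `θ ∈ Θ` of the finite population estimating equation. -/
def PsiDeriv (θ : EuclideanSpace ℝ (Fin p)) :
    EuclideanSpace ℝ (Fin p) →L[ℝ] EuclideanSpace ℝ (Fin p) :=
  fderivWithin ℝ (P.Psi ψ) Θ θ

/-- The sandwich covariance estimator evaluated at the parameter value `θ`. -/
def sigmaHat (Z : P.Assignment) (θ : EuclideanSpace ℝ (Fin p)) : Matrix (Fin p) (Fin p) ℝ :=
  (jacobianMatrix (P.PsiHatDeriv ψ Θ Z θ))⁻¹ *
    (P.r false • P.sampleCov Z true (fun i => P.unitPsi ψ true i θ) +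
      P.r true • P.sampleCov Z false (fun i => P.unitPsi ψ false i θ)) *
    ((jacobianMatrix (P.PsiHatDeriv ψ Θ Z θ))ᵀ)⁻¹

/-- The matrix that the sandwich estimator targets:
`r₁ r₀ Γ⁻¹ (r₁⁻¹ Cov{ψ₁ᵢ(θ)} + r₀⁻¹ Cov{ψ₀ᵢ(θ)}) (Γᵀ)⁻¹`, where `Γ` is the derivative of the
finite population estimating equation at `θ`. -/
def sigmaTilde (θ : EuclideanSpace ℝ (Fin p)) : Matrix (Fin p) (Fin p) ℝ :=
  (P.r true * P.r false) •
    ((jacobianMatrix (P.PsiDeriv ψ Θ θ))⁻¹ *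
      ((P.r true)⁻¹ • P.cov (fun i => P.unitPsi ψ true i θ) +
        (P.r false)⁻¹ • P.cov (fun i => P.unitPsi ψ false i θ)) *
      ((jacobianMatrix (P.PsiDeriv ψ Θ θ))ᵀ)⁻¹)

end FinitePopulation

section Conditions

variable {𝒴 𝒳 : Type*} {p : ℕ} (P : ℕ → FinitePopulation 𝒴 𝒳) (ψ : EstimatingFunction 𝒴 𝒳 p)
  (Θ : Set (EuclideanSpace ℝ (Fin p))) (θ₀ : ℕ → EuclideanSpace ℝ (Fin p))

/-- `θ₀ k ∈ Θ` is a root of the `k`-th finite population estimating equation, and is interior to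
`Θ`, uniformly in `k`. -/
structure InteriorRoot : Prop where
  mem : ∀ k, θ₀ k ∈ Θ
  root : ∀ k, (P k).Psi ψ (θ₀ k) = 0
  ball_subset : ∃ ε₀ > 0, ∀ k, Metric.ball (θ₀ k) ε₀ ⊆ Θ

/-- Smoothness of the estimating functions. -/
structure Smoothness : Prop where
  contDiff : ∀ z y x, ContDiffOn ℝ 1 (ψ z y x) Θ
  deriv_oscillation : ∀ z, Tendsto
    (fun δ : ℝ => ⨆ k, (P k).emean fun i =>
      localModulus Θ (fderivWithin ℝ ((P k).unitPsi ψ z i) Θ) (θ₀ k) δ) (𝓝[>] 0) (𝓝 0)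
  oscillation_sq : ∀ z, Tendsto
    (fun δ : ℝ => ⨆ k, (P k).emean fun i =>
      localModulus Θ ((P k).unitPsi ψ z i) (θ₀ k) δ ^ 2) (𝓝[>] 0) (𝓝 0)

/-- Boundedness of finite population quantities. -/
structure Boundedness : Prop where
  proportions : ∃ c > 0, ∀ k z, c ≤ (P k).r z ∧ (P k).r z ≤ 1 - c
  cov_le : ∀ z, ∃ c₀ > 0, ∀ k, sigmaMax ((P k).cov fun i => (P k).unitPsi ψ z i (θ₀ k)) ≤ c₀
  deriv_bounds : ∃ c₁ > 0, ∃ c₂ > c₁, ∀ k,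
    c₁ ≤ sigmaMin (jacobianMatrix ((P k).PsiDeriv ψ Θ (θ₀ k))) ∧
      sigmaMax (jacobianMatrix ((P k).PsiDeriv ψ Θ (θ₀ k))) ≤ c₂
  max_deviation : ∀ z, Tendsto
    (fun k => ((P k).N : ℝ)⁻¹ * ⨆ j : Fin (P k).N,
      ‖(P k).unitPsi ψ z j (θ₀ k) - (P k).mean fun i => (P k).unitPsi ψ z i (θ₀ k)‖ ^ 2)
    atTop (𝓝 0)

/-- The Z-estimator `θHat` is a root of the empirical estimating equation under every possible
assignment, it is consistent, and the derivative of the empirical estimating equation converges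
in probability, uniformly near `θ₀`. -/
structure Consistency
    (θHat : (k : ℕ) → (P k).Assignment → EuclideanSpace ℝ (Fin p)) : Prop where
  mem : ∀ k, ∀ Z ∈ (P k).design, θHat k Z ∈ Θ
  root : ∀ k, ∀ Z ∈ (P k).design, (P k).PsiHat ψ Z (θHat k Z) = 0
  consistent : ∀ ε > 0,
    Tendsto (fun k => (P k).pr fun Z => ε < ‖θHat k Z - θ₀ k‖) atTop (𝓝 0)
  deriv_uniform : ∃ ρ > 0, ∀ ε > 0,
    Tendsto (fun k => (P k).pr fun Z =>
      ENNReal.ofReal ε < ⨆ θ ∈ {θ | θ ∈ Θ ∧ ‖θ - θ₀ k‖ ≤ ρ},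
        ‖(P k).PsiHatDeriv ψ Θ Z θ - (P k).PsiDeriv ψ Θ θ‖ₑ) atTop (𝓝 0)

end Conditions

/-- The chi-squared distribution with `m` degrees of freedom: the law of the squared norm of a
standard Gaussian vector of `ℝᵐ`. -/
def chiSquared (m : ℕ) : Measure ℝ :=
  (stdGaussian (EuclideanSpace ℝ (Fin m))).map fun x => ‖x‖ ^ 2

/-- The `q`-quantile of a probability distribution on `ℝ`. -/
def quantile (μ : Measure ℝ) (q : ℝ) : ℝ := sInf {x : ℝ | q ≤ cdf μ x}

/-- The Wald-type set for `vᵀθ`, from the sample size `N`, the estimate `θ`, the covariance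
estimate `S` and the critical value `c`. -/
def waldSet {p m : ℕ} (N : ℕ) (v : Matrix (Fin p) (Fin m) ℝ) (θ : EuclideanSpace ℝ (Fin p))
    (S : Matrix (Fin p) (Fin p) ℝ) (c : ℝ) : Set (Fin m → ℝ) :=
  {ω | (N : ℝ) * ((vᵀ *ᵥ θ.ofLp - ω) ⬝ᵥ ((vᵀ * S * v)⁻¹ *ᵥ (vᵀ *ᵥ θ.ofLp - ω))) ≤ c}

end

/-!
Write `Γ` for the population derivative at `θ₀`, `U = √N Ψ̂(θ₀)` for the scaled empirical
estimating equation and `X = √N (θ̂ - θ₀)`. Three facts combine.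

* **Linearization.** By consistency and the mean value inequality, `U + Γ X` is negligible relative
  to `X`. A rank-one correction of `Γ` turns this into an exact equation `D X = -U` with a random
  slope `D` such that `D - Γ → 0` in probability (`exists_slope`), so no separate tightness argument
  for `X` is needed. The two factors of the sandwich estimator are consistent as well: the outer one
  by `tendsto_PsiHatDeriv_sub`, the middle one by a law of large numbers for sampling without
  replacement (`tendsto_sampleCov_sub`). There the estimating functions have to be centred, since
  their population means at `θ₀` may be unbounded.

* **Central limit theorem.** `U` is a scaled total over the treated units of a centred population.
  Exchanging a treated and a control unit gives an exchangeable pair, and Stein's identity for it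
  (`stein_identity`), applied to exponentials, shows that the characteristic function of `U` in a
  given direction almost solves the differential equation of the Gaussian one
  (`norm_expect_exp_treatedSum_sub_le`). The same identity bounds the variance of a sample total,
  which is all that the laws of large numbers need.

* **Conservativeness.** The limit of the middle factor of the sandwich estimator exceeds the
  covariance matrix of `U`, essentially by the covariance matrix of `r₀ ψ₁ + r₁ ψ₀`
  (`dotProduct_scoreCov_le_meatCov`). Hence the limiting Wald statistic is stochastically dominated
  by a chi-squared variable (`le_multivariateGaussian_wald`).

The covariance matrices need not converge, so the conclusion is reached along subsequences of
populations along which they do (`exists_subseq_tendsto`). Convergence in probability is treated as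
convergence along a filter, `whp`, and enters through a form of Slutsky's theorem
(`eventually_lt_pr_of_tendsto`).
-/

noncomputable section

/-! ### Probabilities and expectations under complete randomization -/

namespace FinitePopulation

variable {𝒴 𝒳 : Type*} (P : FinitePopulation 𝒴 𝒳)

lemma mem_design {Z : P.Assignment} :
    Z ∈ P.design ↔ (Finset.univ.filter fun i => Z i = true).card = P.n₁ := by
  simp [design]

lemma design_nonempty : P.design.Nonempty := by
  obtain ⟨t, -, ht⟩ := Finset.exists_subset_card_eq
    (s := (Finset.univ : Finset (Fin P.N))) (n := P.n₁) (by simpa using P.n₁_le)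
  exact ⟨fun i => decide (i ∈ t), by simp [design, ht]⟩

lemma card_design_pos : (0 : ℝ) < P.design.card := by
  exact_mod_cast P.design_nonempty.card_pos

lemma card_arm {Z : P.Assignment} (hZ : Z ∈ P.design) (z : Bool) :
    (Finset.univ.filter fun i => Z i = z).card = P.armSize z := by
  rw [mem_design] at hZ
  cases z
  · have h := Finset.card_filter_add_card_filter_not (s := (Finset.univ : Finset (Fin P.N)))
      (fun i => Z i = true)
    simp only [Bool.not_eq_true, hZ, Finset.card_univ, Fintype.card_fin] at h
    simp only [armSize, Bool.false_eq_true, if_false]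
    omega
  · simpa [armSize] using hZ

lemma armSize_add : P.armSize true + P.armSize false = P.N := by
  have := P.n₁_le
  simp [armSize]
  omega

/-- Expectation over the randomization of the treatment assignment. -/
def expect {E : Type*} [AddCommGroup E] [Module ℝ E] (f : P.Assignment → E) : E :=
  (P.design.card : ℝ)⁻¹ • ∑ Z ∈ P.design, f Z

section expect

variable {E : Type*} [AddCommGroup E] [Module ℝ E]

lemma expect_add (f g : P.Assignment → E) :
    P.expect (fun Z => f Z + g Z) = P.expect f + P.expect g := by
  simp [expect, Finset.sum_add_distrib]

lemma expect_sub (f g : P.Assignment → E) :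
    P.expect (fun Z => f Z - g Z) = P.expect f - P.expect g := by
  simp [expect, Finset.sum_sub_distrib, smul_sub]

lemma expect_const (c : E) : P.expect (fun _ => c) = c := by
  rw [expect, Finset.sum_const, ← Nat.cast_smul_eq_nsmul ℝ, smul_smul,
    inv_mul_cancel₀ P.card_design_pos.ne', one_smul]

lemma expect_const_mul {𝕜 : Type*} [Ring 𝕜] [Algebra ℝ 𝕜] (c : 𝕜) (f : P.Assignment → 𝕜) :
    P.expect (fun Z => c * f Z) = c * P.expect f := by
  simp [expect, ← Finset.mul_sum]

lemma expect_congr {f g : P.Assignment → E} (h : ∀ Z ∈ P.design, f Z = g Z) :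
    P.expect f = P.expect g := by
  rw [expect, expect, Finset.sum_congr rfl h]

lemma expect_mono {f g : P.Assignment → ℝ} (h : ∀ Z ∈ P.design, f Z ≤ g Z) :
    P.expect f ≤ P.expect g := by
  rw [expect, expect]
  exact smul_le_smul_of_nonneg_left (Finset.sum_le_sum h) (by positivity)

lemma expect_nonneg {f : P.Assignment → ℝ} (h : ∀ Z ∈ P.design, 0 ≤ f Z) : 0 ≤ P.expect f := by
  simpa [P.expect_const (0 : ℝ)] using P.expect_mono (f := fun _ => 0) h

lemma norm_expect_le {F : Type*} [NormedAddCommGroup F] [NormedSpace ℝ F]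
    (f : P.Assignment → F) : ‖P.expect f‖ ≤ P.expect fun Z => ‖f Z‖ := by
  rw [expect, expect, norm_smul, Real.norm_of_nonneg (by positivity), smul_eq_mul]
  exact mul_le_mul_of_nonneg_left (norm_sum_le _ _) (by positivity)

/-- The Cauchy–Schwarz inequality against the constant `1`. -/
lemma expect_le_sqrt (f : P.Assignment → ℝ) :
    P.expect f ≤ √(P.expect fun Z => f Z ^ 2) := by
  apply Real.le_sqrt_of_sq_le
  have h0 : 0 ≤ P.expect fun Z => (f Z - P.expect f) ^ 2 :=
    P.expect_nonneg fun Z _ => sq_nonneg _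
  have h1 : (P.expect fun Z => (f Z - P.expect f) ^ 2) =
      (P.expect fun Z => f Z ^ 2) - P.expect f ^ 2 := by
    have : (fun Z => (f Z - P.expect f) ^ 2) =
        fun Z => (f Z ^ 2 - (2 * P.expect f) * f Z) + P.expect f ^ 2 := by ext; ring
    rw [this, expect_add, expect_sub, expect_const_mul, expect_const]
    ring
  linarith

end expect

open Classical in
lemma pr_eq_expect (A : P.Assignment → Prop) :
    P.pr A = P.expect fun Z => if A Z then 1 else 0 := by
  rw [pr, expect, Finset.sum_boole, smul_eq_mul, div_eq_inv_mul]

lemma pr_nonneg (A : P.Assignment → Prop) : 0 ≤ P.pr A := by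
  rw [pr]; positivity

lemma pr_mono {A B : P.Assignment → Prop} (h : ∀ Z ∈ P.design, A Z → B Z) : P.pr A ≤ P.pr B := by
  classical
  rw [pr_eq_expect, pr_eq_expect]
  refine P.expect_mono fun Z hZ => ?_
  by_cases hA : A Z
  · simp [hA, h Z hZ hA]
  · simp only [hA, if_false]; split_ifs <;> norm_num

lemma pr_eq_one {A : P.Assignment → Prop} (h : ∀ Z ∈ P.design, A Z) : P.pr A = 1 := by
  classical
  rw [pr_eq_expect, P.expect_congr (g := fun _ => 1) fun Z hZ => by simp [h Z hZ], expect_const]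

lemma pr_le_one (A : P.Assignment → Prop) : P.pr A ≤ 1 := by
  rw [← P.pr_eq_one (A := fun _ => True) fun _ _ => trivial]
  exact P.pr_mono fun _ _ _ => trivial

lemma pr_not (A : P.Assignment → Prop) : P.pr (fun Z => ¬ A Z) = 1 - P.pr A := by
  classical
  rw [pr_eq_expect, pr_eq_expect, ← P.expect_const (1 : ℝ), ← expect_sub, expect_const]
  refine P.expect_congr fun Z _ => ?_
  by_cases h : A Z <;> simp [h]

lemma pr_add_pr_le (A B : P.Assignment → Prop) :
    P.pr A + P.pr B ≤ 1 + P.pr fun Z => A Z ∧ B Z := by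
  classical
  rw [pr_eq_expect, pr_eq_expect, pr_eq_expect, ← P.expect_const (1 : ℝ), ← expect_add,
    ← expect_add, expect_const]
  refine P.expect_mono fun Z _ => ?_
  by_cases h : A Z <;> by_cases h' : B Z <;> simp [h, h']

/-- Markov's inequality. -/
lemma pr_lt_le_div {f : P.Assignment → ℝ} (hf : ∀ Z ∈ P.design, 0 ≤ f Z) {ε : ℝ} (hε : 0 < ε) :
    P.pr (fun Z => ε < f Z) ≤ P.expect f / ε := by
  classical
  rw [pr_eq_expect, div_eq_inv_mul, ← expect_const_mul]
  refine P.expect_mono fun Z hZ => ?_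
  split_ifs with h
  · rw [inv_mul_eq_div, one_le_div hε]; exact h.le
  · have := hf Z hZ; positivity

end FinitePopulation

/-! ### Convergence in probability as convergence along a filter -/

section whp

open FinitePopulation

variable {𝒴 𝒳 : Type*} (P : ℕ → FinitePopulation 𝒴 𝒳)

/-- The filter of the families of events that hold with probability tending to one along `l`.
A family of random variables, one for each population, is encoded as a function on
`Σ k, (P k).Assignment`; its convergence in probability to a constant `y` is `Tendsto` along this
filter to `𝓝 y`. -/
def whp (l : Filter ℕ) : Filter (Σ k, (P k).Assignment) where
  sets := {A | Tendsto (fun k => (P k).pr fun Z => ⟨k, Z⟩ ∈ A) l (𝓝 1)}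
  univ_sets := by
    simp only [Set.mem_univ, Set.mem_ofPred_eq]
    exact tendsto_const_nhds.congr fun k => ((P k).pr_eq_one fun _ _ => trivial).symm
  sets_of_superset {A B} hA hAB :=
    tendsto_of_tendsto_of_tendsto_of_le_of_le hA tendsto_const_nhds
      (fun k => (P k).pr_mono fun _ _ h => hAB h) (fun k => (P k).pr_le_one _)
  inter_sets {A B} hA hB := by
    have h := (hA.add hB).sub_const 1
    rw [show (1 : ℝ) + 1 - 1 = 1 by norm_num] at h
    refine tendsto_of_tendsto_of_tendsto_of_le_of_le h tendsto_const_nhds (fun k => ?_)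
      (fun k => (P k).pr_le_one _)
    have := (P k).pr_add_pr_le (fun Z => ⟨k, Z⟩ ∈ A) (fun Z => ⟨k, Z⟩ ∈ B)
    simp only [Set.mem_inter_iff]
    linarith

variable {P} {l : Filter ℕ}

lemma eventually_whp {A : (Σ k, (P k).Assignment) → Prop} :
    (∀ᶠ ω in whp P l, A ω) ↔ Tendsto (fun k => (P k).pr fun Z => A ⟨k, Z⟩) l (𝓝 1) := Iff.rfl

lemma eventually_whp_of_pr_not {A : (Σ k, (P k).Assignment) → Prop}
    (h : Tendsto (fun k => (P k).pr fun Z => ¬ A ⟨k, Z⟩) l (𝓝 0)) : ∀ᶠ ω in whp P l, A ω := by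
  rw [eventually_whp]
  have := h.const_sub 1
  simp only [pr_not, sub_sub_cancel, sub_zero] at this
  exact this

lemma whp_mono {l l' : Filter ℕ} (h : l ≤ l') : whp P l ≤ whp P l' :=
  fun _ hA => Tendsto.mono_left hA h

lemma eventually_whp_mem_design : ∀ᶠ ω in whp P l, ω.2 ∈ (P ω.1).design := by
  rw [eventually_whp]
  exact tendsto_const_nhds.congr fun k => ((P k).pr_eq_one fun _ h => h).symm

lemma tendsto_fst_whp : Tendsto Sigma.fst (whp P l) l := by
  intro s hs
  change Tendsto _ _ _
  refine tendsto_const_nhds.congr' ?_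
  filter_upwards [hs] with k hk
  exact ((P k).pr_eq_one fun _ _ => hk).symm

/-- Convergence in mean implies convergence in probability. -/
lemma tendsto_whp_of_expect {E : Type*} [SeminormedAddCommGroup E]
    {X : (Σ k, (P k).Assignment) → E}
    (h : Tendsto (fun k => (P k).expect fun Z => ‖X ⟨k, Z⟩‖) l (𝓝 0)) :
    Tendsto X (whp P l) (𝓝 0) := by
  rw [tendsto_zero_iff_norm_tendsto_zero, Metric.nhds_basis_closedBall.tendsto_right_iff]
  intro ε hε
  apply eventually_whp_of_pr_not
  have h2 := h.div_const ε
  rw [zero_div] at h2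
  refine squeeze_zero (fun k => (P k).pr_nonneg _) (fun k => ?_) h2
  refine le_trans ((P k).pr_mono fun Z _ hZ => ?_)
    ((P k).pr_lt_le_div (f := fun Z => ‖X ⟨k, Z⟩‖) (fun _ _ => norm_nonneg _) hε)
  simpa using hZ

end whp

/-! ### Exchangeable pairs and the characteristic function of a sample total -/

namespace FinitePopulation

variable {𝒴 𝒳 : Type*} (P : FinitePopulation 𝒴 𝒳)

lemma comp_swap_mem_design {Z : P.Assignment} (i j : Fin P.N) :
    Z ∘ Equiv.swap i j ∈ P.design ↔ Z ∈ P.design := by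
  rw [mem_design, mem_design]
  have : (Finset.univ.filter fun k => Z k = true) =
      (Finset.univ.filter fun k => (Z ∘ Equiv.swap i j) k = true).map
        (Equiv.swap i j).toEmbedding := by
    ext k
    simp only [Finset.mem_filter, Finset.mem_univ, true_and, Finset.mem_map_equiv,
      Equiv.symm_swap, Function.comp_apply, Equiv.swap_apply_self]
  rw [this, Finset.card_map]

/-- Exchanging a treated unit `i` with a control unit `j` preserves the distribution of the
triple (assignment, treated unit, control unit) up to exchanging the roles of `i` and `j`. -/
lemma sum_comp_swap {E : Type*} [AddCommMonoid E] (F : P.Assignment → Fin P.N → Fin P.N → E) :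
    ∑ Z ∈ P.design, ∑ i with Z i = true, ∑ j with Z j = false, F Z i j =
      ∑ Z ∈ P.design, ∑ i with Z i = true, ∑ j with Z j = false,
        F (Z ∘ Equiv.swap i j) j i := by
  have key : ∀ G : P.Assignment → Fin P.N → Fin P.N → E,
      ∑ Z ∈ P.design, ∑ i with Z i = true, ∑ j with Z j = false, G Z i j =
      ∑ i, ∑ j, ∑ Z ∈ P.design, if Z i = true ∧ Z j = false then G Z i j else 0 := by
    intro G
    simp_rw [Finset.sum_filter, ite_and]
    rw [Finset.sum_comm]
    refine Finset.sum_congr rfl fun i _ => ?_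
    rw [Finset.sum_comm]
    refine Finset.sum_congr rfl fun Z _ => ?_
    split_ifs <;> simp
  rw [key, key, Finset.sum_comm]
  refine Finset.sum_congr rfl fun j _ => Finset.sum_congr rfl fun i _ => ?_
  refine Finset.sum_nbij' (fun Z => Z ∘ Equiv.swap i j) (fun Z => Z ∘ Equiv.swap i j)
    (fun Z hZ => (P.comp_swap_mem_design i j).2 hZ)
    (fun Z hZ => (P.comp_swap_mem_design i j).2 hZ) (fun Z _ => ?_) (fun Z _ => ?_) (fun Z _ => ?_)
  · ext k; simp
  · ext k; simp
  · have : (Z ∘ Equiv.swap i j) ∘ Equiv.swap j i = Z := by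
      ext k; simp [Equiv.swap_comm j i]
    simp [this, Function.comp]

/-- The total of `a` over the treated units. -/
def treatedSum {E : Type*} [AddCommMonoid E] (a : Fin P.N → E) (Z : P.Assignment) : E :=
  ∑ i with Z i = true, a i

variable {P} in
lemma sum_treated_add_sum_control {E : Type*} [AddCommMonoid E] (a : Fin P.N → E)
    (Z : P.Assignment) :
    ∑ i with Z i = true, a i + ∑ i with Z i = false, a i = ∑ i, a i := by
  rw [← Finset.sum_filter_add_sum_filter_not Finset.univ (fun i => Z i = true)]
  simp

lemma treatedSum_comp_swap (a : Fin P.N → ℝ) {Z : P.Assignment} {i j : Fin P.N}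
    (hi : Z i = true) (hj : Z j = false) :
    P.treatedSum a (Z ∘ Equiv.swap i j) = P.treatedSum a Z - (a i - a j) := by
  have hij : i ≠ j := by rintro rfl; simp [hi] at hj
  have hT : (Finset.univ.filter fun k => (Z ∘ Equiv.swap i j) k = true) =
      insert j ((Finset.univ.filter fun k => Z k = true).erase i) := by
    ext k
    simp only [Finset.mem_filter, Finset.mem_univ, true_and, Function.comp_apply,
      Finset.mem_insert, Finset.mem_erase]
    rcases eq_or_ne k i with rfl | hki
    · simp [hj, hij]
    · rcases eq_or_ne k j with rfl | hkj
      · simp [hi]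
      · simp [Equiv.swap_apply_of_ne_of_ne hki hkj, hki, hkj]
  rw [treatedSum, treatedSum, hT, Finset.sum_insert (by simp [hj]),
    ← Finset.add_sum_erase (Finset.univ.filter fun k => Z k = true) a (a := i) (by simp [hi])]
  ring

variable {P}

/-- Summing a function of the treated and of the control unit over all pairs. -/
lemma sum_pairs {𝕜 : Type*} [CommRing 𝕜] {Z : P.Assignment} (hZ : Z ∈ P.design)
    (f g : Fin P.N → 𝕜) :
    ∑ i with Z i = true, ∑ j with Z j = false, (f i + g j) =
      P.armSize false * ∑ i with Z i = true, f i + P.armSize true * ∑ j with Z j = false, g j := by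
  simp [Finset.sum_add_distrib, P.card_arm hZ, Finset.mul_sum]

lemma cast_armSize_add {𝕜 : Type*} [CommRing 𝕜] :
    (P.armSize true : 𝕜) + P.armSize false = P.N := by
  rw [← P.armSize_add]; push_cast; ring

/-- Stein's identity for the exchangeable pair obtained by exchanging a random treated unit with
a random control unit. -/
lemma stein_identity {a : Fin P.N → ℝ} (ha : ∑ i, a i = 0) (F : P.Assignment → ℂ) :
    P.N * ∑ Z ∈ P.design, ((P.treatedSum a Z : ℝ) : ℂ) * F Z =
      (1 / 2 : ℂ) * ∑ Z ∈ P.design, ∑ i with Z i = true, ∑ j with Z j = false,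
        ((a i - a j : ℝ) : ℂ) * (F Z - F (Z ∘ Equiv.swap i j)) := by
  have h1 : ∀ Z ∈ P.design, ∑ i with Z i = true, ∑ j with Z j = false,
      ((a i - a j : ℝ) : ℂ) * F Z = P.N * (((P.treatedSum a Z : ℝ) : ℂ) * F Z) := by
    intro Z hZ
    have hC : ∑ i with Z i = false, a i = - P.treatedSum a Z := by
      have := sum_treated_add_sum_control a Z
      rw [ha] at this
      rw [treatedSum]; linarith
    have h := sum_pairs hZ a (fun j => - a j)
    simp only [← sub_eq_add_neg, Finset.sum_neg_distrib, hC] at h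
    simp_rw [← Finset.sum_mul]
    rw [← mul_assoc]
    congr 1
    have h2 : ∑ i with Z i = true, ∑ j with Z j = false, (a i - a j) =
        P.N * P.treatedSum a Z := by
      rw [h, ← cast_armSize_add, ← treatedSum]; ring
    exact_mod_cast congrArg (fun x : ℝ => (x : ℂ)) h2
  have h2 := P.sum_comp_swap (fun Z i j => ((a i - a j : ℝ) : ℂ) * F Z)
  simp only [mul_sub, Finset.sum_sub_distrib]
  have h3 : ∑ Z ∈ P.design, ∑ i with Z i = true, ∑ j with Z j = false,
      ((a i - a j : ℝ) : ℂ) * F (Z ∘ Equiv.swap i j) =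
      - ∑ Z ∈ P.design, ∑ i with Z i = true, ∑ j with Z j = false,
      ((a i - a j : ℝ) : ℂ) * F Z := by
    rw [h2]
    simp_rw [← Finset.sum_neg_distrib]
    refine Finset.sum_congr rfl fun Z _ => Finset.sum_congr rfl fun i _ =>
      Finset.sum_congr rfl fun j _ => ?_
    push_cast; ring
  rw [h3, Finset.sum_congr rfl h1, ← Finset.mul_sum]
  ring

/-- The total of squared differences between treated and control units is at most `2 N Σ a²`. -/
lemma sum_pairs_sq_le {Z : P.Assignment} (hZ : Z ∈ P.design) (a : Fin P.N → ℝ) :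
    ∑ i with Z i = true, ∑ j with Z j = false, (a i - a j) ^ 2 ≤
      2 * P.N * ∑ i, a i ^ 2 := by
  have h1 : ∑ i with Z i = true, ∑ j with Z j = false, (a i - a j) ^ 2 ≤
      ∑ i with Z i = true, ∑ j with Z j = false, (2 * a i ^ 2 + 2 * a j ^ 2) :=
    Finset.sum_le_sum fun i _ => Finset.sum_le_sum fun j _ => by
      nlinarith [sq_nonneg (a i + a j)]
  rw [sum_pairs hZ, ← Finset.mul_sum, ← Finset.mul_sum] at h1
  have h2 := sum_treated_add_sum_control (fun i => a i ^ 2) Z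
  have h3 : (P.armSize true : ℝ) + P.armSize false = P.N := cast_armSize_add
  have h4 : 0 ≤ ∑ i with Z i = true, a i ^ 2 := Finset.sum_nonneg fun _ _ => sq_nonneg _
  have h5 : 0 ≤ ∑ i with Z i = false, a i ^ 2 := Finset.sum_nonneg fun _ _ => sq_nonneg _
  rw [← h2, ← h3]
  have h6 : (0 : ℝ) ≤ P.armSize true := by positivity
  have h7 : (0 : ℝ) ≤ P.armSize false := by positivity
  nlinarith [mul_nonneg h6 h4, mul_nonneg h7 h5]

/-- A variance bound for the total of a centred population over the treated units. -/
lemma expect_treatedSum_sq_le {a : Fin P.N → ℝ} (ha : ∑ i, a i = 0) :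
    P.expect (fun Z => P.treatedSum a Z ^ 2) ≤ ∑ i, a i ^ 2 := by
  rcases Nat.eq_zero_or_pos P.N with hN | hN
  · have : IsEmpty (Fin P.N) := by rw [hN]; infer_instance
    simp [treatedSum, P.expect_const]
  have h1 := stein_identity ha (fun Z => ((P.treatedSum a Z : ℝ) : ℂ))
  have h2 : (P.N : ℝ) * ∑ Z ∈ P.design, P.treatedSum a Z ^ 2 = (1 / 2) * ∑ Z ∈ P.design,
      ∑ i with Z i = true, ∑ j with Z j = false, (a i - a j) ^ 2 := by
    have h3 : ∀ Z ∈ P.design, ∑ i with Z i = true, ∑ j with Z j = false,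
        ((a i - a j : ℝ) : ℂ) * (((P.treatedSum a Z : ℝ) : ℂ) -
          ((P.treatedSum a (Z ∘ Equiv.swap i j) : ℝ) : ℂ)) =
        ((∑ i with Z i = true, ∑ j with Z j = false, (a i - a j) ^ 2 : ℝ) : ℂ) := by
      intro Z _
      push_cast
      refine Finset.sum_congr rfl fun i hi => Finset.sum_congr rfl fun j hj => ?_
      rw [P.treatedSum_comp_swap a (by simpa using hi) (by simpa using hj)]
      push_cast; ring
    rw [Finset.sum_congr rfl h3] at h1
    simp only [← pow_two] at h1
    apply Complex.ofReal_injective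
    push_cast at h1 ⊢
    exact h1
  have h4 := Finset.sum_le_sum fun Z hZ => sum_pairs_sq_le (Z := Z) (P := P) hZ a
  rw [Finset.sum_const, nsmul_eq_mul] at h4
  have hN' : (0 : ℝ) < P.N := by exact_mod_cast hN
  have hc := P.card_design_pos
  rw [expect, smul_eq_mul, inv_mul_le_iff₀ hc]
  refine le_of_mul_le_mul_left ?_ hN'
  rw [h2]
  linarith

/-- The total of squared differences between treated and control units is close to its mean. -/
lemma sum_pairs_sq_eq {Z : P.Assignment} (hZ : Z ∈ P.design) {a : Fin P.N → ℝ}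
    (ha : ∑ i, a i = 0) (hN : 0 < P.N) :
    ∑ i with Z i = true, ∑ j with Z j = false, (a i - a j) ^ 2 =
      2 * P.armSize true * P.armSize false / P.N * ∑ i, a i ^ 2 +
      (P.armSize false - P.armSize true) *
        P.treatedSum (fun i => a i ^ 2 - (∑ i, a i ^ 2) / P.N) Z +
      2 * P.treatedSum a Z ^ 2 := by
  have hN' : (P.N : ℝ) ≠ 0 := by exact_mod_cast hN.ne'
  have hC : ∑ i with Z i = false, a i = - P.treatedSum a Z := by
    have := sum_treated_add_sum_control a Z
    rw [ha] at this
    rw [treatedSum]; linarith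
  have h0 : ∑ i with Z i = true, ∑ j with Z j = false, (a i - a j) ^ 2 =
      ∑ i with Z i = true, ∑ j with Z j = false, (a i ^ 2 + a j ^ 2) -
        2 * (P.treatedSum a Z * ∑ i with Z i = false, a i) := by
    rw [treatedSum, Finset.sum_mul_sum, Finset.mul_sum, ← Finset.sum_sub_distrib]
    refine Finset.sum_congr rfl fun i _ => ?_
    rw [Finset.mul_sum, ← Finset.sum_sub_distrib]
    exact Finset.sum_congr rfl fun j _ => by ring
  have h2 := sum_treated_add_sum_control (fun i => a i ^ 2) Z
  have h3 : (P.armSize true : ℝ) + P.armSize false = P.N := cast_armSize_add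
  have h4 : P.treatedSum (fun i => a i ^ 2 - (∑ i, a i ^ 2) / P.N) Z =
      ∑ i with Z i = true, a i ^ 2 - P.armSize true * ((∑ i, a i ^ 2) / P.N) := by
    rw [treatedSum, Finset.sum_sub_distrib, Finset.sum_const, P.card_arm hZ, nsmul_eq_mul]
  rw [h4, h0, hC, sum_pairs hZ, ← h2, ← h3]
  rw [← h3] at hN'
  field_simp
  ring

end FinitePopulation

lemma norm_one_sub_exp_neg_I_mul_sub_le (x : ℝ) :
    ‖1 - Complex.exp (-(Complex.I * x)) - Complex.I * x‖ ≤ 2 * x ^ 2 := by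
  have hn : ‖Complex.I * (x : ℂ)‖ = |x| := by simp
  rcases le_total |x| 1 with hx | hx
  · have h := Complex.norm_exp_sub_one_sub_id_le (x := -(Complex.I * x))
      (by rw [norm_neg, hn]; exact hx)
    rw [norm_neg, hn, sq_abs] at h
    rw [← norm_neg]
    calc _ = ‖Complex.exp (-(Complex.I * x)) - 1 - -(Complex.I * x)‖ := by congr 1; ring
      _ ≤ x ^ 2 := h
      _ ≤ _ := by nlinarith [sq_nonneg x]
  · have h := Real.norm_exp_I_mul_ofReal_sub_one_le (x := -x)
    rw [Real.norm_eq_abs, abs_neg] at h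
    calc _ ≤ ‖1 - Complex.exp (-(Complex.I * x))‖ + ‖Complex.I * (x : ℂ)‖ := norm_sub_le _ _
      _ ≤ |x| + |x| := by
        rw [hn, norm_sub_rev]
        gcongr
        simpa using h
      _ ≤ 2 * x ^ 2 := by
        rw [← sq_abs]; nlinarith

/-- A function `φ` on `[0, 1]` with `φ(0) = 1` that almost satisfies `φ'(t) = -s t φ(t)` is close
to `exp(-s t² / 2)` at `t = 1`. -/
lemma norm_sub_exp_le_of_approx_ode {φ φ' : ℝ → ℂ} {s η : ℝ} (hs : 0 ≤ s)
    (hφ : ∀ t, HasDerivAt φ (φ' t) t) (h0 : φ 0 = 1)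
    (h : ∀ t ∈ Set.Icc (0 : ℝ) 1, ‖φ' t + t * s * φ t‖ ≤ η) :
    ‖φ 1 - Real.exp (-(s / 2))‖ ≤ η := by
  set g : ℝ → ℂ := fun t => (Real.exp (s * t ^ 2 / 2) : ℂ) * φ t with hg
  have hg' : ∀ t, HasDerivAt g ((Real.exp (s * t ^ 2 / 2) : ℂ) * (φ' t + t * s * φ t)) t := by
    intro t
    have h1 : HasDerivAt (fun t : ℝ => Real.exp (s * t ^ 2 / 2))
        (Real.exp (s * t ^ 2 / 2) * (s * t)) t := by
      have := ((hasDerivAt_pow 2 t).const_mul s).div_const 2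
      exact (this.congr_deriv (by push_cast; ring)).exp
    have h2 := h1.ofReal_comp.mul (hφ t)
    refine h2.congr_deriv ?_
    push_cast; ring
  have hη : 0 ≤ η := (norm_nonneg _).trans (h 0 (by simp))
  have hb : ∀ t ∈ Set.Ico (0 : ℝ) 1,
      ‖(Real.exp (s * t ^ 2 / 2) : ℂ) * (φ' t + t * s * φ t)‖ ≤ Real.exp (s / 2) * η := by
    intro t ht
    rw [norm_mul, Complex.norm_real, Real.norm_of_nonneg (Real.exp_pos _).le]
    have ht2 : t ^ 2 ≤ 1 := by nlinarith [ht.1, ht.2]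
    gcongr
    · nlinarith
    · exact h t ⟨ht.1, ht.2.le⟩
  have h1 := norm_image_sub_le_of_norm_deriv_le_segment' (f := g)
    (fun t _ => (hg' t).hasDerivWithinAt) hb 1 (by simp)
  have e0 : g 0 = 1 := by simp [hg, h0]
  have e1 : g 1 = Real.exp (s / 2) * φ 1 := by simp [hg]
  rw [e0, e1, sub_zero, mul_one] at h1
  have h2 : φ 1 - Real.exp (-(s / 2)) =
      (Real.exp (-(s / 2)) : ℂ) * (Real.exp (s / 2) * φ 1 - 1) := by
    rw [mul_sub, ← mul_assoc, ← Complex.ofReal_mul, ← Real.exp_add]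
    simp
  rw [h2, norm_mul, Complex.norm_real, Real.norm_of_nonneg (Real.exp_pos _).le]
  calc _ ≤ Real.exp (-(s / 2)) * (Real.exp (s / 2) * η) := by gcongr
    _ = η := by rw [← mul_assoc, ← Real.exp_add]; simp

namespace FinitePopulation

variable {𝒴 𝒳 : Type*} {P : FinitePopulation 𝒴 𝒳}

lemma norm_exp_I_mul_mul (s x : ℝ) : ‖Complex.exp (Complex.I * s * x)‖ = 1 := by
  rw [mul_assoc, ← Complex.ofReal_mul, mul_comm, Complex.norm_exp_ofReal_mul_I]

/-- Stein's identity applied to `x ↦ exp(i s x)`, with an explicit error: the swap changes the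
exponential by approximately `i s (a i - a j)` times itself. -/
lemma norm_expect_mul_exp_sub_le {a : Fin P.N → ℝ} (ha : ∑ i, a i = 0) {M : ℝ}
    (hM : ∀ i, |a i| ≤ M) (s : ℝ) :
    ‖P.N * P.expect (fun Z => ((P.treatedSum a Z : ℝ) : ℂ) *
        Complex.exp (Complex.I * s * (P.treatedSum a Z : ℝ))) -
      (1 / 2 : ℂ) * P.expect (fun Z => Complex.I * s *
        ((∑ i with Z i = true, ∑ j with Z j = false, (a i - a j) ^ 2 : ℝ) : ℂ) *
        Complex.exp (Complex.I * s * (P.treatedSum a Z : ℝ)))‖ ≤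
      4 * s ^ 2 * M * P.N * ∑ i, a i ^ 2 := by
  set F : P.Assignment → ℂ := fun Z => Complex.exp (Complex.I * s * (P.treatedSum a Z : ℝ)) with hF
  have hst := stein_identity ha F
  have hconv : ∀ G : P.Assignment → ℂ,
      P.expect G = (P.design.card : ℂ)⁻¹ * ∑ Z ∈ P.design, G Z := by
    intro G
    rw [expect, Complex.real_smul]
    push_cast; rfl
  have hterm : ∀ Z ∈ P.design, ‖(∑ i with Z i = true, ∑ j with Z j = false,
      ((a i - a j : ℝ) : ℂ) * (F Z - F (Z ∘ Equiv.swap i j))) - Complex.I * s *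
        ((∑ i with Z i = true, ∑ j with Z j = false, (a i - a j) ^ 2 : ℝ) : ℂ) * F Z‖ ≤
      8 * s ^ 2 * M * P.N * ∑ i, a i ^ 2 := by
    intro Z hZ
    have e1 : (∑ i with Z i = true, ∑ j with Z j = false,
      ((a i - a j : ℝ) : ℂ) * (F Z - F (Z ∘ Equiv.swap i j))) - Complex.I * s *
        ((∑ i with Z i = true, ∑ j with Z j = false, (a i - a j) ^ 2 : ℝ) : ℂ) * F Z =
        ∑ i with Z i = true, ∑ j with Z j = false, ((a i - a j : ℝ) : ℂ) * (F Z *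
          (1 - Complex.exp (-(Complex.I * (s * (a i - a j) : ℝ))) -
            Complex.I * (s * (a i - a j) : ℝ))) := by
      push_cast
      rw [Finset.mul_sum, Finset.sum_mul, ← Finset.sum_sub_distrib]
      refine Finset.sum_congr rfl fun i hi => ?_
      rw [Finset.mul_sum, Finset.sum_mul, ← Finset.sum_sub_distrib]
      refine Finset.sum_congr rfl fun j hj => ?_
      have e2 : F (Z ∘ Equiv.swap i j) =
          F Z * Complex.exp (-(Complex.I * (s * ((a i : ℂ) - a j)))) := by
        rw [hF]
        simp only
        rw [P.treatedSum_comp_swap a (by simpa using hi) (by simpa using hj), ← Complex.exp_add]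
        congr 1
        push_cast; ring
      rw [e2]; ring
    have hMi : ∀ i j, |a i - a j| ≤ 2 * M := fun i j =>
      (abs_sub _ _).trans (by linarith [hM i, hM j])
    rw [e1]
    calc _ ≤ ∑ i with Z i = true, ∑ j with Z j = false, 4 * s ^ 2 * M * (a i - a j) ^ 2 := by
          refine norm_sum_le_of_le _ fun i _ => norm_sum_le_of_le _ fun j _ => ?_
          rw [norm_mul, norm_mul, Complex.norm_real, Real.norm_eq_abs, hF]
          simp only [norm_exp_I_mul_mul, one_mul]
          calc _ ≤ (2 * M) * (2 * (s * (a i - a j)) ^ 2) :=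
                mul_le_mul (hMi i j) (norm_one_sub_exp_neg_I_mul_sub_le _) (norm_nonneg _)
                  ((abs_nonneg _).trans (hMi i j))
            _ = _ := by ring
      _ = 4 * s ^ 2 * M * ∑ i with Z i = true, ∑ j with Z j = false, (a i - a j) ^ 2 := by
          simp_rw [Finset.mul_sum]
      _ ≤ 4 * s ^ 2 * M * (2 * P.N * ∑ i, a i ^ 2) := by
          rcases isEmpty_or_nonempty (Fin P.N) with hE | ⟨⟨i⟩⟩
          · simp
          · have : 0 ≤ M := (abs_nonneg _).trans (hM i)
            exact mul_le_mul_of_nonneg_left (sum_pairs_sq_le hZ a) (by positivity)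
      _ = _ := by ring
  have h2 : (P.N : ℂ) * P.expect (fun Z => ((P.treatedSum a Z : ℝ) : ℂ) * F Z) -
      (1 / 2 : ℂ) * P.expect (fun Z => Complex.I * s *
        ((∑ i with Z i = true, ∑ j with Z j = false, (a i - a j) ^ 2 : ℝ) : ℂ) * F Z) =
      (1 / 2 : ℂ) * P.expect fun Z => (∑ i with Z i = true, ∑ j with Z j = false,
      ((a i - a j : ℝ) : ℂ) * (F Z - F (Z ∘ Equiv.swap i j))) - Complex.I * s *
        ((∑ i with Z i = true, ∑ j with Z j = false, (a i - a j) ^ 2 : ℝ) : ℂ) * F Z := by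
    rw [expect_sub, mul_sub, hconv, hconv (fun Z => ∑ i with Z i = true, _), mul_left_comm, hst]
    ring
  rw [h2, norm_mul]
  have h3 := (P.norm_expect_le _).trans (P.expect_mono hterm)
  rw [expect_const] at h3
  have : ‖(1 / 2 : ℂ)‖ = 1 / 2 := by norm_num
  rw [this]
  calc _ ≤ 1 / 2 * (8 * s ^ 2 * M * P.N * ∑ i, a i ^ 2) := by gcongr
    _ = _ := by ring

lemma sum_sub_mean_sq_le {n : ℕ} (x : Fin n → ℝ) :
    ∑ i, (x i - (∑ i, x i) / n) ^ 2 ≤ ∑ i, x i ^ 2 := by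
  rcases Nat.eq_zero_or_pos n with rfl | hn
  · simp
  have hn' : (n : ℝ) ≠ 0 := by exact_mod_cast hn.ne'
  have : ∑ i, (x i - (∑ i, x i) / n) ^ 2 = ∑ i, x i ^ 2 - (∑ i, x i) ^ 2 / n := by
    simp_rw [sub_sq, Finset.sum_add_distrib, Finset.sum_sub_distrib, ← Finset.sum_mul,
      ← Finset.mul_sum]
    simp
    field_simp
    ring
  rw [this]
  have : 0 ≤ (∑ i, x i) ^ 2 / n := by positivity
  linarith

lemma sum_sub_mean {n : ℕ} (x : Fin n → ℝ) : ∑ i, (x i - (∑ i, x i) / n) = 0 := by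
  rcases Nat.eq_zero_or_pos n with rfl | hn
  · simp
  have hn' : (n : ℝ) ≠ 0 := by exact_mod_cast hn.ne'
  rw [Finset.sum_sub_distrib]
  simp
  field_simp
  ring

/-- The total of squared differences between treated and control units concentrates around its
mean. -/
lemma expect_abs_sum_pairs_sq_sub_le (hN : 0 < P.N) {a : Fin P.N → ℝ} (ha : ∑ i, a i = 0) {M : ℝ}
    (hM : ∀ i, |a i| ≤ M) :
    P.expect (fun Z => |∑ i with Z i = true, ∑ j with Z j = false, (a i - a j) ^ 2 -
      2 * P.armSize true * P.armSize false / P.N * ∑ i, a i ^ 2|) ≤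
      P.N * (M * √(∑ i, a i ^ 2)) + 2 * ∑ i, a i ^ 2 := by
  have hM0 : 0 ≤ M := (abs_nonneg _).trans (hM ⟨0, hN⟩)
  set b : Fin P.N → ℝ := fun i => a i ^ 2 - (∑ i, a i ^ 2) / P.N with hb
  have hb0 : ∑ i, b i = 0 := sum_sub_mean _
  have hb2 : ∑ i, b i ^ 2 ≤ M ^ 2 * ∑ i, a i ^ 2 := by
    refine (sum_sub_mean_sq_le _).trans ?_
    rw [Finset.mul_sum]
    refine Finset.sum_le_sum fun i _ => ?_
    have : a i ^ 2 ≤ M ^ 2 := sq_le_sq' (abs_le.1 (hM i)).1 (abs_le.1 (hM i)).2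
    nlinarith [sq_nonneg (a i)]
  have h1 : P.expect (fun Z => |P.treatedSum b Z|) ≤ M * √(∑ i, a i ^ 2) := by
    refine (P.expect_le_sqrt _).trans ?_
    simp only [sq_abs]
    rw [Real.sqrt_le_left (by positivity), mul_pow,
      Real.sq_sqrt (Finset.sum_nonneg fun _ _ => sq_nonneg _)]
    exact (expect_treatedSum_sq_le hb0).trans hb2
  have h2 := expect_treatedSum_sq_le ha
  calc _ ≤ P.expect (fun Z => P.N * |P.treatedSum b Z| + 2 * P.treatedSum a Z ^ 2) := by
        refine P.expect_mono fun Z hZ => ?_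
        rw [sum_pairs_sq_eq hZ ha hN]
        have h3 : (P.armSize true : ℝ) + P.armSize false = P.N := cast_armSize_add
        have h4 : |(P.armSize false : ℝ) - P.armSize true| ≤ P.N := by
          rw [abs_le, ← h3]
          have h6 : (0 : ℝ) ≤ P.armSize true := by positivity
          have h7 : (0 : ℝ) ≤ P.armSize false := by positivity
          constructor <;> linarith
        rw [add_assoc, add_sub_cancel_left]
        refine (abs_add_le _ _).trans ?_
        rw [abs_mul, abs_of_nonneg (by positivity : 0 ≤ 2 * P.treatedSum a Z ^ 2)]
        gcongr
    _ ≤ _ := by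
        rw [expect_add, expect_const_mul, expect_const_mul]
        gcongr

lemma hasDerivAt_expect_exp (X : P.Assignment → ℝ) (c t : ℝ) :
    HasDerivAt (fun t : ℝ => P.expect fun Z => Complex.exp (Complex.I * (t * c : ℝ) * (X Z : ℝ)))
      (P.expect fun Z => Complex.I * c * ((X Z : ℂ) *
        Complex.exp (Complex.I * (t * c : ℝ) * (X Z : ℝ)))) t := by
  unfold expect
  apply HasDerivAt.const_smul
  apply HasDerivAt.fun_sum
  intro Z _
  have h : HasDerivAt (fun t : ℝ => Complex.I * ((t * c : ℝ) : ℂ) * (X Z : ℝ))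
      (Complex.I * c * X Z) t := by
    have h1 : HasDerivAt (fun t : ℝ => ((t * c : ℝ) : ℂ)) ((1 * c : ℝ) : ℂ) t :=
      ((hasDerivAt_id t).mul_const c).ofReal_comp
    simpa using (h1.const_mul Complex.I).mul_const (X Z : ℂ)
  refine h.cexp.congr_deriv ?_
  ring

/-- A quantitative central limit theorem for simple random sampling without replacement: the
characteristic function at `1` of the scaled total of a centred population over the treated units
is close to that of a Gaussian variable. -/
theorem norm_expect_exp_treatedSum_sub_le (hN : 0 < P.N) {a : Fin P.N → ℝ} (ha : ∑ i, a i = 0)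
    {κ K : ℝ} (hκ : ∀ i, |a i| ≤ κ * √P.N) (hK : ∑ i, a i ^ 2 ≤ K * P.N) :
    ‖P.expect (fun Z => Complex.exp (Complex.I * ((√P.N)⁻¹ : ℝ) * (P.treatedSum a Z : ℝ))) -
      Real.exp (-(P.r true * P.r false * (∑ i, a i ^ 2) / P.N / 2))‖ ≤
      4 * κ * K + κ * √K + K / P.N := by
  have hN' : (0 : ℝ) < P.N := by exact_mod_cast hN
  have hsN : 0 < √(P.N : ℝ) := Real.sqrt_pos.2 hN'
  have hsq : √(P.N : ℝ) ^ 2 = P.N := Real.sq_sqrt hN'.le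
  have hκ0 : 0 ≤ κ := by
    have := (abs_nonneg _).trans (hκ ⟨0, hN⟩)
    exact nonneg_of_mul_nonneg_left this hsN
  set A := ∑ i, a i ^ 2 with hA
  have hA0 : 0 ≤ A := Finset.sum_nonneg fun _ _ => sq_nonneg _
  have hK0 : 0 ≤ K := nonneg_of_mul_nonneg_left (hA0.trans hK) hN'
  have hode := norm_sub_exp_le_of_approx_ode (s := P.r true * P.r false * A / P.N)
    (η := 4 * κ * K + κ * √K + K / P.N) (by unfold r; positivity)
    (fun t => hasDerivAt_expect_exp (P := P) (P.treatedSum a) (√P.N)⁻¹ t)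
    (by simp [expect_const]) ?_
  · simpa using hode
  intro t ht
  set s : ℝ := t * (√P.N)⁻¹ with hs
  set F : P.Assignment → ℂ := fun Z => Complex.exp (Complex.I * s * (P.treatedSum a Z : ℝ)) with hF
  set D : P.Assignment → ℝ :=
    fun Z => ∑ i with Z i = true, ∑ j with Z j = false, (a i - a j) ^ 2 with hD
  set D₀ : ℝ := 2 * P.armSize true * P.armSize false / P.N * A with hD₀
  have h1 := norm_expect_mul_exp_sub_le ha hκ s
  have h2 := expect_abs_sum_pairs_sq_sub_le hN ha hκ
  have hs0 : 0 ≤ s := mul_nonneg ht.1 (by positivity)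
  -- Replace the random total of squared differences by its mean.
  have h3 : ‖(1 / 2 : ℂ) * P.expect (fun Z => Complex.I * s * ((D Z : ℝ) : ℂ) * F Z) -
      (1 / 2 : ℂ) * (Complex.I * s * D₀ * P.expect F)‖ ≤
      s / 2 * (P.N * (κ * √P.N * √A) + 2 * A) := by
    rw [← mul_sub, ← P.expect_const_mul (Complex.I * s * D₀), ← expect_sub, norm_mul]
    have : ‖(1 / 2 : ℂ)‖ = 1 / 2 := by norm_num
    rw [this]
    have h4 : P.expect (fun Z => ‖Complex.I * s * ((D Z : ℝ) : ℂ) * F Z -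
        Complex.I * s * D₀ * F Z‖) = s * P.expect (fun Z => |D Z - D₀|) := by
      rw [← expect_const_mul]
      refine P.expect_congr fun Z _ => ?_
      rw [← sub_mul, ← mul_sub, norm_mul, hF]
      simp only [norm_exp_I_mul_mul, mul_one, norm_mul, Complex.norm_I, one_mul,
        ← Complex.ofReal_sub, Complex.norm_real, Real.norm_eq_abs, abs_of_nonneg hs0]
    calc _ ≤ 1 / 2 * (s * P.expect (fun Z => |D Z - D₀|)) := by
          rw [← h4]; gcongr; exact P.norm_expect_le _
      _ ≤ 1 / 2 * (s * (P.N * (κ * √P.N * √A) + 2 * A)) := by gcongr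
      _ = _ := by ring
  have h5 := (norm_add_le _ _).trans (add_le_add h1 h3)
  rw [sub_add_sub_cancel] at h5
  -- The quantity to be bounded is `i N⁻¹ N^(-1/2)` times the one bounded in `h5`.
  have h6 : (P.expect fun Z => Complex.I * ((√P.N)⁻¹ : ℝ) * (((P.treatedSum a Z : ℝ) : ℂ) *
        Complex.exp (Complex.I * s * (P.treatedSum a Z : ℝ)))) +
      t * ((P.r true * P.r false * A / P.N : ℝ) : ℂ) * P.expect F =
      (Complex.I * (((√P.N)⁻¹ * (P.N : ℝ)⁻¹ : ℝ) : ℂ)) *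
      (P.N * P.expect (fun Z => ((P.treatedSum a Z : ℝ) : ℂ) *
        Complex.exp (Complex.I * s * (P.treatedSum a Z : ℝ))) -
        (1 / 2 : ℂ) * (Complex.I * s * D₀ * P.expect F)) := by
    rw [expect_const_mul]
    generalize P.expect (fun Z => ((P.treatedSum a Z : ℝ) : ℂ) *
      Complex.exp (Complex.I * s * (P.treatedSum a Z : ℝ))) = E₁
    generalize P.expect F = E₀
    have hNc : (P.N : ℂ) ≠ 0 := by exact_mod_cast hN.ne'
    have hsc : ((√(P.N : ℝ) : ℝ) : ℂ) ≠ 0 := by exact_mod_cast hsN.ne'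
    have hsqc : ((√(P.N : ℝ) : ℝ) : ℂ) ^ 2 = P.N := by
      rw [← Complex.ofReal_pow, hsq, Complex.ofReal_natCast]
    simp only [hs, hD₀, r]
    push_cast
    rw [← hsqc]
    rw [← hsqc] at hNc
    field_simp
    linear_combination ((t : ℂ) * P.armSize true * P.armSize false * A * E₀) * Complex.I_sq
  have h7 : √A ≤ √K * √P.N := by
    rw [← Real.sqrt_mul hK0]; exact Real.sqrt_le_sqrt hK
  rw [h6, norm_mul, norm_mul, Complex.norm_I, one_mul, Complex.norm_real,
    Real.norm_of_nonneg (by positivity)]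
  have ht2 : t ^ 2 ≤ 1 := by nlinarith [ht.1, ht.2]
  calc _ ≤ (√P.N)⁻¹ * (P.N : ℝ)⁻¹ * (4 * s ^ 2 * (κ * √P.N) * P.N * A +
        s / 2 * (P.N * (κ * √P.N * √A) + 2 * A)) := by gcongr
    _ ≤ (√P.N)⁻¹ * (P.N : ℝ)⁻¹ * (4 * s ^ 2 * (κ * √P.N) * P.N * (K * P.N) +
        s / 2 * (P.N * (κ * √P.N * (√K * √P.N)) + 2 * (K * P.N))) := by gcongr
    _ = t ^ 2 * (4 * κ * K) + t / 2 * (κ * √K) + t * (K / P.N) := by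
        rw [hs]
        generalize √(P.N : ℝ) = w at *
        rw [← hsq]
        field_simp
        ring
    _ ≤ 1 * (4 * κ * K) + 1 * (κ * √K) + 1 * (K / P.N) := by
        have := ht.2
        have := ht.1
        gcongr
        linarith
    _ = _ := by ring

end FinitePopulation

/-! ### Gaussian measures and quantiles of the chi-squared distribution -/

lemma le_cdf_quantile (μ : Measure ℝ) [IsProbabilityMeasure μ] {q : ℝ} (h1 : q < 1) :
    q ≤ cdf μ (quantile μ q) := by
  have hne : {x : ℝ | q ≤ cdf μ x}.Nonempty := by
    obtain ⟨x, hx⟩ := ((tendsto_cdf_atTop μ).eventually_const_le h1).exists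
    exact ⟨x, hx⟩
  rw [← (cdf μ).iInf_Ioi_eq]
  refine le_ciInf fun ⟨x, hx⟩ => ?_
  obtain ⟨y, hy, hyx⟩ := exists_lt_of_csInf_lt hne hx
  exact le_trans hy (monotone_cdf μ hyx.le)

lemma measurable_norm_sq {m : ℕ} : Measurable fun x : EuclideanSpace ℝ (Fin m) => ‖x‖ ^ 2 := by
  fun_prop

instance (m : ℕ) : IsProbabilityMeasure (chiSquared m) :=
  Measure.isProbabilityMeasure_map measurable_norm_sq.aemeasurable

lemma quantile_chiSquared_nonneg (m : ℕ) {q : ℝ} (hq : 0 < q) : 0 ≤ quantile (chiSquared m) q := by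
  refine Real.sInf_nonneg fun x hx => ?_
  by_contra! h
  have : cdf (chiSquared m) x = 0 := by
    rw [cdf_eq_real, Measure.real, chiSquared,
      Measure.map_apply measurable_norm_sq measurableSet_Iic]
    have : (fun x : EuclideanSpace ℝ (Fin m) => ‖x‖ ^ 2) ⁻¹' Set.Iic x = ∅ := by
      ext y
      simp only [Set.mem_preimage, Set.mem_Iic, Set.mem_empty_iff_false, iff_false, not_le]
      exact h.trans_le (sq_nonneg _)
    simp [this]
  rw [Set.mem_ofPred_eq, this] at hx
  linarith

lemma pi_gaussianReal_sphere {m : ℕ} (hm : 0 < m) (q : ℝ) :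
    Measure.pi (fun _ : Fin m => gaussianReal 0 1) {x | ∑ i, x i ^ 2 = q} = 0 := by
  obtain ⟨n, rfl⟩ := Nat.exists_eq_succ_of_ne_zero hm.ne'
  have := nullSingletonClass_gaussianReal (μ := 0) (v := 1) one_ne_zero
  have hs : MeasurableSet {z : ℝ × (Fin n → ℝ) | z.1 ^ 2 + ∑ i, z.2 i ^ 2 = q} :=
    measurableSet_eq_fun (by fun_prop) (by fun_prop)
  have hp := measurePreserving_piFinSuccAbove (fun _ : Fin (n + 1) => gaussianReal 0 1) 0
  have h1 : {x : Fin (n + 1) → ℝ | ∑ i, x i ^ 2 = q} =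
      MeasurableEquiv.piFinSuccAbove (fun _ => ℝ) 0 ⁻¹'
        {z : ℝ × (Fin n → ℝ) | z.1 ^ 2 + ∑ i, z.2 i ^ 2 = q} := by
    ext x
    simp [Fin.sum_univ_succ, MeasurableEquiv.piFinSuccAbove, Fin.tail]
  rw [Nat.succ_eq_add_one, h1, hp.measure_preimage hs.nullMeasurableSet, Measure.prod_apply_symm hs]
  refine (lintegral_congr fun y => ?_).trans lintegral_zero
  refine Set.Finite.measure_zero (Set.Finite.subset
    (Set.toFinite {√(q - ∑ i, y i ^ 2), -√(q - ∑ i, y i ^ 2)}) fun x hx => ?_) _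
  have hx' : x ^ 2 = q - ∑ i, y i ^ 2 := by
    have : x ^ 2 + ∑ i, y i ^ 2 = q := hx
    linarith
  rw [← hx', Real.sqrt_sq_eq_abs]
  rcases abs_choice x with h | h <;> simp [h]

lemma le_stdGaussian_norm_sq_lt_quantile {m : ℕ} (hm : 0 < m) {q : ℝ} (h1 : q < 1) :
    ENNReal.ofReal q ≤ stdGaussian (EuclideanSpace ℝ (Fin m))
      {x | ‖x‖ ^ 2 < quantile (chiSquared m) q} := by
  set c := quantile (chiSquared m) q with hc
  have h2 := le_cdf_quantile (chiSquared m) h1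
  rw [cdf_eq_real, Measure.real, ← hc] at h2
  have h3 := ENNReal.ofReal_le_of_le_toReal h2
  rw [chiSquared, Measure.map_apply measurable_norm_sq measurableSet_Iic] at h3
  refine h3.trans ?_
  have h4 : (fun x : EuclideanSpace ℝ (Fin m) => ‖x‖ ^ 2) ⁻¹' Set.Iic c ⊆
      {x | ‖x‖ ^ 2 < c} ∪ {x | ‖x‖ ^ 2 = c} := fun x hx =>
    (lt_or_eq_of_le (show ‖x‖ ^ 2 ≤ c from hx))
  refine (measure_mono h4).trans ((measure_union_le _ _).trans ?_)
  have h5 : stdGaussian (EuclideanSpace ℝ (Fin m)) {x | ‖x‖ ^ 2 = c} = 0 := by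
    rw [← map_pi_eq_stdGaussian, Measure.map_apply (by fun_prop)
      (measurableSet_eq_fun measurable_norm_sq measurable_const)]
    simpa [EuclideanSpace.real_norm_sq_eq] using pi_gaussianReal_sphere hm c
  rw [h5, add_zero]

/-- A centred Gaussian vector whose covariance matrix is at most the identity is more concentrated
around `0` than a standard Gaussian vector. -/
lemma stdGaussian_le_multivariateGaussian {m : ℕ} {H : Matrix (Fin m) (Fin m) ℝ}
    (hH : H.PosSemidef) (h1 : ∀ x : Fin m → ℝ, x ⬝ᵥ H *ᵥ x ≤ x ⬝ᵥ x) (q : ℝ) :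
    stdGaussian (EuclideanSpace ℝ (Fin m)) {x | ‖x‖ ^ 2 < q} ≤
      multivariateGaussian 0 H {x | ‖x‖ ^ 2 < q} := by
  rw [multivariateGaussian, Measure.map_apply (by fun_prop)
    (measurableSet_lt measurable_norm_sq measurable_const)]
  refine measure_mono fun x hx => ?_
  simp only [Set.mem_preimage, Set.mem_ofPred_eq, zero_add] at hx ⊢
  refine lt_of_le_of_lt ?_ hx
  open scoped MatrixOrder in
  have hsa : IsSelfAdjoint (Matrix.toEuclideanCLM (𝕜 := ℝ) (CFC.sqrt H)) :=
    (CFC.sqrt_nonneg H).isSelfAdjoint.map _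
  have h2 : ‖Matrix.toEuclideanCLM (𝕜 := ℝ) (CFC.sqrt H) x‖ ^ 2 = x.ofLp ⬝ᵥ H *ᵥ x.ofLp := by
    rw [← Matrix.inner_toEuclideanCLM, ← real_inner_self_eq_norm_sq,
      ← ContinuousLinearMap.adjoint_inner_right, hsa.adjoint_eq,
      ← mul_apply_eq_comp, ← map_mul]
    open scoped MatrixOrder in
    rw [CFC.sqrt_mul_sqrt_self _ hH.nonneg]
  rw [h2, EuclideanSpace.real_norm_sq_eq]
  refine (h1 _).trans_eq ?_
  simp [dotProduct, pow_two]

lemma multivariateGaussian_map_mulVec {p m : ℕ} {V : Matrix (Fin p) (Fin p) ℝ} (hV : V.PosSemidef)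
    (R : Matrix (Fin m) (Fin p) ℝ) :
    (multivariateGaussian 0 V).map (fun x => WithLp.toLp 2 (R *ᵥ x.ofLp)) =
      multivariateGaussian 0 (R * V * Rᵀ) := by
  have hH : (R * V * Rᵀ).PosSemidef := by
    simpa using hV.mul_mul_conjTranspose_same R
  have hmeas : Measurable fun x : EuclideanSpace ℝ (Fin p) =>
      (WithLp.toLp 2 (R *ᵥ x.ofLp) : EuclideanSpace ℝ (Fin m)) := by
    fun_prop
  have := Measure.isProbabilityMeasure_map (μ := multivariateGaussian 0 V) hmeas.aemeasurable
  apply Measure.ext_of_charFun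
  ext t
  rw [charFun_multivariateGaussian hH, charFun_apply,
    integral_map hmeas.aemeasurable (Measurable.aestronglyMeasurable (by fun_prop))]
  have h := charFun_multivariateGaussian (μ := 0) hV (WithLp.toLp 2 (Rᵀ *ᵥ t.ofLp))
  rw [charFun_apply] at h
  have h2 : ∀ x : EuclideanSpace ℝ (Fin p),
      inner ℝ (WithLp.toLp 2 (R *ᵥ x.ofLp) : EuclideanSpace ℝ (Fin m)) t =
      inner ℝ x (WithLp.toLp 2 (Rᵀ *ᵥ t.ofLp)) := by
    intro x
    simp only [EuclideanSpace.inner_eq_star_dotProduct, star_trivial]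
    rw [Matrix.mulVec_transpose, Matrix.dotProduct_mulVec]
  simp_rw [h2]
  rw [h]
  simp only [inner_zero_right]
  congr 4
  rw [Matrix.dotProduct_mulVec, Matrix.vecMul_mulVec, ← Matrix.dotProduct_mulVec]
  simp [Matrix.mulVec_mulVec, Matrix.mul_assoc]

/-! ### Singular values and Jacobian matrices -/

section SingularValues

variable {p : ℕ} (A : Matrix (Fin p) (Fin p) ℝ)

lemma norm_sq_toEuclideanLin_eq_sum (x : EuclideanSpace ℝ (Fin p)) :
    ∃ b : OrthonormalBasis (Fin p) ℝ (EuclideanSpace ℝ (Fin p)),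
      ‖Matrix.toEuclideanLin A x‖ ^ 2 =
        ∑ i : Fin p, (Matrix.toEuclideanLin A).singularValues i ^ 2 * inner ℝ (b i) x ^ 2 := by
  set T := Matrix.toEuclideanLin A
  have hn : Module.finrank ℝ (EuclideanSpace ℝ (Fin p)) = p := by simp
  have hT := T.isSymmetric_adjoint_comp_self
  refine ⟨hT.eigenvectorBasis hn, ?_⟩
  rw [← real_inner_self_eq_norm_sq, ← LinearMap.adjoint_inner_right,
    ← (hT.eigenvectorBasis hn).sum_inner_mul_inner]
  refine Finset.sum_congr rfl fun i _ => ?_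
  rw [T.sq_singularValues_fin hn, ← LinearMap.comp_apply, ← hT, hT.apply_eigenvectorBasis,
    real_inner_smul_left, real_inner_comm x]
  simp
  ring

lemma sigmaMin_mul_norm_le (x : EuclideanSpace ℝ (Fin p)) :
    sigmaMin A * ‖x‖ ≤ ‖Matrix.toEuclideanLin A x‖ := by
  obtain ⟨b, hb⟩ := norm_sq_toEuclideanLin_eq_sum A x
  refine le_of_sq_le_sq ?_ (norm_nonneg _)
  rw [hb, mul_pow, ← b.sum_sq_inner_right, Finset.mul_sum]
  refine Finset.sum_le_sum fun i _ => ?_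
  have h1 : sigmaMin A ≤ (Matrix.toEuclideanLin A).singularValues i :=
    (Matrix.toEuclideanLin A).singularValues_antitone (Nat.le_sub_one_of_lt i.2)
  have h2 : 0 ≤ sigmaMin A := LinearMap.singularValues_nonneg _ _
  gcongr

lemma norm_toEuclideanLin_le (x : EuclideanSpace ℝ (Fin p)) :
    ‖Matrix.toEuclideanLin A x‖ ≤ sigmaMax A * ‖x‖ := by
  obtain ⟨b, hb⟩ := norm_sq_toEuclideanLin_eq_sum A x
  have h2 : 0 ≤ sigmaMax A := LinearMap.singularValues_nonneg _ _
  refine le_of_sq_le_sq ?_ (by positivity)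
  rw [hb, mul_pow, ← b.sum_sq_inner_right, Finset.mul_sum]
  refine Finset.sum_le_sum fun i _ => ?_
  have h1 : (Matrix.toEuclideanLin A).singularValues i ≤ sigmaMax A :=
    (Matrix.toEuclideanLin A).singularValues_antitone (Nat.zero_le _)
  have h3 : 0 ≤ (Matrix.toEuclideanLin A).singularValues i := LinearMap.singularValues_nonneg _ _
  gcongr

lemma abs_apply_le_sigmaMax (i j : Fin p) : |A i j| ≤ sigmaMax A := by
  have h := norm_toEuclideanLin_le A (EuclideanSpace.single j 1)
  have h2 := PiLp.norm_apply_le (Matrix.toEuclideanLin A (EuclideanSpace.single j 1)) i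
  simp only [PiLp.norm_single, norm_one, mul_one] at h
  refine le_trans (le_of_eq ?_) (h2.trans h)
  simp [Matrix.toLpLin_apply]

/-- A limit of matrices whose smallest singular values are bounded away from zero is invertible. -/
lemma isUnit_of_tendsto_of_le_sigmaMin {u : ℕ → Matrix (Fin p) (Fin p) ℝ} {c : ℝ} (hc : 0 < c)
    (hu : ∀ k, c ≤ sigmaMin (u k)) (hA : Tendsto u atTop (𝓝 A)) : IsUnit A := by
  rw [← Matrix.mulVec_injective_iff_isUnit]
  refine (injective_iff_map_eq_zero (Matrix.mulVecLin A)).2 fun x hx => ?_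
  have h1 : ∀ k, c * ‖(WithLp.toLp 2 x : EuclideanSpace ℝ (Fin p))‖ ≤
      ‖(WithLp.toLp 2 (u k *ᵥ x) : EuclideanSpace ℝ (Fin p))‖ := fun k =>
    (mul_le_mul_of_nonneg_right (hu k) (norm_nonneg _)).trans
      (by simpa [Matrix.toLpLin_apply] using sigmaMin_mul_norm_le (u k) (WithLp.toLp 2 x))
  have h2 : Tendsto (fun k => ‖(WithLp.toLp 2 (u k *ᵥ x) : EuclideanSpace ℝ (Fin p))‖) atTop
      (𝓝 ‖(WithLp.toLp 2 (A *ᵥ x) : EuclideanSpace ℝ (Fin p))‖) := by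
    have hcont : Continuous fun B : Matrix (Fin p) (Fin p) ℝ =>
        ‖(WithLp.toLp 2 (B *ᵥ x) : EuclideanSpace ℝ (Fin p))‖ := by
      fun_prop
    exact (hcont.tendsto A).comp hA
  have h3 := ge_of_tendsto' h2 h1
  have h4 : A *ᵥ x = 0 := hx
  rw [h4, WithLp.toLp_zero, norm_zero] at h3
  have h5 : ‖(WithLp.toLp 2 x : EuclideanSpace ℝ (Fin p))‖ = 0 :=
    le_antisymm (nonpos_of_mul_nonpos_right h3 hc) (norm_nonneg _)
  rw [norm_eq_zero] at h5
  simpa using h5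

end SingularValues

lemma jacobianMatrix_mulVec {p : ℕ}
    (L : EuclideanSpace ℝ (Fin p) →L[ℝ] EuclideanSpace ℝ (Fin p)) (x : EuclideanSpace ℝ (Fin p)) :
    jacobianMatrix L *ᵥ x.ofLp = (L x).ofLp := by
  have hx : x = ∑ j, x j • EuclideanSpace.single j (1 : ℝ) := by
    ext i
    simp [Finset.sum_apply, Pi.single_apply]
  ext i
  conv_rhs => rw [hx]
  simp [jacobianMatrix, Matrix.mulVec, dotProduct, mul_comm]

lemma continuous_jacobianMatrix {p : ℕ} : Continuous (jacobianMatrix (p := p)) := by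
  refine continuous_matrix fun i j => ?_
  simp only [jacobianMatrix, Matrix.of_apply]
  fun_prop

lemma jacobianMatrix_sub {p : ℕ}
    (L M : EuclideanSpace ℝ (Fin p) →L[ℝ] EuclideanSpace ℝ (Fin p)) :
    jacobianMatrix (L - M) = jacobianMatrix L - jacobianMatrix M := by
  ext i j
  simp [jacobianMatrix]

lemma tendsto_jacobianMatrix_sub {p : ℕ} {Ω : Type*} {l : Filter Ω}
    {L M : Ω → EuclideanSpace ℝ (Fin p) →L[ℝ] EuclideanSpace ℝ (Fin p)}
    (h : Tendsto (fun ω => L ω - M ω) l (𝓝 0)) :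
    Tendsto (fun ω => jacobianMatrix (L ω) - jacobianMatrix (M ω)) l (𝓝 0) := by
  simp_rw [← jacobianMatrix_sub]
  have := (continuous_jacobianMatrix.tendsto (0 : EuclideanSpace ℝ (Fin p) →L[ℝ] _)).comp h
  have h0 : jacobianMatrix (0 : EuclideanSpace ℝ (Fin p) →L[ℝ] EuclideanSpace ℝ (Fin p)) = 0 := by
    ext; simp [jacobianMatrix]
  rwa [h0] at this

/-! ### Linearization of the estimating equation -/

section Linearization

open FinitePopulation

variable {𝒴 𝒳 : Type*} {p : ℕ} {P : ℕ → FinitePopulation 𝒴 𝒳} {ψ : EstimatingFunction 𝒴 𝒳 p}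
  {Θ : Set (EuclideanSpace ℝ (Fin p))} {θ₀ : ℕ → EuclideanSpace ℝ (Fin p)}
  {θHat : (k : ℕ) → (P k).Assignment → EuclideanSpace ℝ (Fin p)}

lemma Boundedness.N_pos (hb : Boundedness P ψ Θ θ₀) (k : ℕ) : 0 < (P k).N := by
  obtain ⟨c, hc, h⟩ := hb.proportions
  by_contra! h0
  have := (h k true).1
  rw [r, Nat.le_zero.1 h0] at this
  simp at this
  linarith

lemma FinitePopulation.r_nonneg (Q : FinitePopulation 𝒴 𝒳) (z : Bool) : 0 ≤ Q.r z := by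
  rw [r]; positivity

lemma FinitePopulation.r_add {Q : FinitePopulation 𝒴 𝒳} (h : 0 < Q.N) :
    Q.r true + Q.r false = 1 := by
  have h3 : (Q.armSize true : ℝ) + Q.armSize false = Q.N := cast_armSize_add
  have : (Q.N : ℝ) ≠ 0 := by exact_mod_cast h.ne'
  rw [r, r, ← add_div, h3, div_self this]

lemma FinitePopulation.enorm_mean_le {E : Type*} [NormedAddCommGroup E] [NormedSpace ℝ E]
    {Q : FinitePopulation 𝒴 𝒳} (h : 0 < Q.N) (a : Fin Q.N → E) :
    ‖Q.mean a‖ₑ ≤ Q.emean fun i => ‖a i‖ₑ := by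
  have : (0 : ℝ) < Q.N := by exact_mod_cast h
  rw [mean, emean, enorm_smul]
  gcongr
  · rw [Real.enorm_of_nonneg (by positivity), ENNReal.ofReal_inv_of_pos this,
      ENNReal.ofReal_natCast]
  · exact enorm_sum_le _ _

lemma FinitePopulation.emean_mono {Q : FinitePopulation 𝒴 𝒳} {a b : Fin Q.N → ℝ≥0∞}
    (h : ∀ i, a i ≤ b i) : Q.emean a ≤ Q.emean b := by
  unfold emean
  gcongr
  exact h _

lemma FinitePopulation.hasFDerivWithinAt_mean {Q : FinitePopulation 𝒴 𝒳}
    {f : Fin Q.N → EuclideanSpace ℝ (Fin p) → EuclideanSpace ℝ (Fin p)}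
    {θ : EuclideanSpace ℝ (Fin p)} (hf : ∀ i, DifferentiableWithinAt ℝ (f i) Θ θ) :
    HasFDerivWithinAt (fun θ => Q.mean fun i => f i θ)
      (Q.mean fun i => fderivWithin ℝ (f i) Θ θ) Θ θ := by
  unfold mean
  exact (HasFDerivWithinAt.fun_sum fun i _ => (hf i).hasFDerivWithinAt).const_smul (Q.N : ℝ)⁻¹

lemma PsiDeriv_eq (hs : Smoothness P ψ Θ θ₀) (k : ℕ) {θ : EuclideanSpace ℝ (Fin p)}
    (hθ : Θ ∈ 𝓝 θ) :
    (P k).PsiDeriv ψ Θ θ =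
      (P k).r true • (P k).mean (fun i => fderivWithin ℝ ((P k).unitPsi ψ true i) Θ θ) +
      (P k).r false • (P k).mean (fun i => fderivWithin ℝ ((P k).unitPsi ψ false i) Θ θ) := by
  have hd : ∀ z i, DifferentiableWithinAt ℝ ((P k).unitPsi ψ z i) Θ θ := fun z i =>
    (hs.contDiff z _ _).differentiableOn one_ne_zero θ (mem_of_mem_nhds hθ)
  rw [PsiDeriv]
  have h := ((hasFDerivWithinAt_mean (hd true)).const_smul ((P k).r true)).add
    ((hasFDerivWithinAt_mean (hd false)).const_smul ((P k).r false))
  exact HasFDerivWithinAt.fderivWithin (f := (P k).Psi ψ) h (uniqueDiffWithinAt_of_mem_nhds hθ)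

/-- The population derivative is continuous at `θ₀ k`, uniformly in `k`. -/
lemma exists_norm_PsiDeriv_sub_le (hr : InteriorRoot P ψ Θ θ₀) (hs : Smoothness P ψ Θ θ₀)
    (hb : Boundedness P ψ Θ θ₀) {ε : ℝ} (hε : 0 < ε) :
    ∃ δ > 0, ∀ k θ, ‖θ - θ₀ k‖ < δ →
      ‖(P k).PsiDeriv ψ Θ θ - (P k).PsiDeriv ψ Θ (θ₀ k)‖ ≤ ε := by
  obtain ⟨ε₀, hε₀, hball⟩ := hr.ball_subset
  have hosc : ∀ z, ∃ δ > 0, ∀ k, ((P k).emean fun i =>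
      localModulus Θ (fderivWithin ℝ ((P k).unitPsi ψ z i) Θ) (θ₀ k) δ) ≤ ENNReal.ofReal ε := by
    intro z
    have h1 := (hs.deriv_oscillation z).eventually_le_const
      (ENNReal.ofReal_pos.2 hε : (0 : ℝ≥0∞) < ENNReal.ofReal ε)
    obtain ⟨δ, h2, h3⟩ := (h1.and self_mem_nhdsWithin).exists
    exact ⟨δ, h3, fun k => (le_iSup _ k).trans h2⟩
  choose δ hδ hδ' using hosc
  refine ⟨min ε₀ (min (δ true) (δ false)), by simp [hε₀, hδ], fun k θ hθ => ?_⟩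
  simp only [lt_min_iff] at hθ
  have hθΘ : Θ ∈ 𝓝 θ := mem_of_superset
    (Metric.isOpen_ball.mem_nhds (by simpa [dist_eq_norm] using hθ.1)) (hball k)
  have hθ₀Θ : Θ ∈ 𝓝 (θ₀ k) := mem_of_superset (Metric.ball_mem_nhds _ hε₀) (hball k)
  have hz : ∀ z, ‖(P k).mean (fun i => fderivWithin ℝ ((P k).unitPsi ψ z i) Θ θ) -
      (P k).mean (fun i => fderivWithin ℝ ((P k).unitPsi ψ z i) Θ (θ₀ k))‖ ≤ ε := by
    intro z
    have hθz : ‖θ - θ₀ k‖ ≤ δ z := by cases z <;> [exact hθ.2.2.le; exact hθ.2.1.le]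
    have h1 : (P k).mean (fun i => fderivWithin ℝ ((P k).unitPsi ψ z i) Θ θ) -
      (P k).mean (fun i => fderivWithin ℝ ((P k).unitPsi ψ z i) Θ (θ₀ k)) =
      (P k).mean fun i => fderivWithin ℝ ((P k).unitPsi ψ z i) Θ θ -
        fderivWithin ℝ ((P k).unitPsi ψ z i) Θ (θ₀ k) := by
      simp [mean, smul_sub]
    rw [h1, ← ENNReal.ofReal_le_ofReal_iff hε.le, ofReal_norm]
    refine (enorm_mean_le (hb.N_pos k) _).trans (le_trans (emean_mono fun i => ?_) (hδ' z k))
    exact le_iSup₂_of_le (f := fun θ (_ : θ ∈ {θ | θ ∈ Θ ∧ ‖θ - θ₀ k‖ ≤ δ z}) =>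
      ‖fderivWithin ℝ ((P k).unitPsi ψ z i) Θ θ -
        fderivWithin ℝ ((P k).unitPsi ψ z i) Θ (θ₀ k)‖ₑ) θ
      ⟨mem_of_mem_nhds hθΘ, hθz⟩ le_rfl
  have hsub : ∀ (c : ℝ) (A B : EuclideanSpace ℝ (Fin p) →L[ℝ] EuclideanSpace ℝ (Fin p)),
      c • A - c • B = c • (A - B) := fun c A B => (smul_sub c A B).symm
  rw [PsiDeriv_eq hs k hθΘ, PsiDeriv_eq hs k hθ₀Θ, add_sub_add_comm, hsub, hsub]
  refine (norm_add_le _ _).trans ?_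
  rw [norm_smul, norm_smul, Real.norm_of_nonneg (r_nonneg _ _), Real.norm_of_nonneg (r_nonneg _ _)]
  calc _ ≤ (P k).r true * ε + (P k).r false * ε := by
        gcongr
        · exact r_nonneg _ _
        · exact hz true
        · exact r_nonneg _ _
        · exact hz false
    _ = ε := by rw [← add_mul, r_add (hb.N_pos k), one_mul]

/-- Near `θ₀ k` the derivative of the empirical estimating equation is uniformly close to the
population derivative at `θ₀ k`. -/
lemma exists_norm_PsiHatDeriv_sub_le (hr : InteriorRoot P ψ Θ θ₀) (hs : Smoothness P ψ Θ θ₀)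
    (hb : Boundedness P ψ Θ θ₀) (hc : Consistency P ψ Θ θ₀ θHat) {ε : ℝ} (hε : 0 < ε) :
    ∃ δ > 0, (∀ k, Metric.ball (θ₀ k) δ ⊆ Θ) ∧
      ∀ᶠ ω in whp P atTop, ∀ θ ∈ Metric.ball (θ₀ ω.1) δ,
        ‖(P ω.1).PsiHatDeriv ψ Θ ω.2 θ - (P ω.1).PsiDeriv ψ Θ (θ₀ ω.1)‖ ≤ ε := by
  obtain ⟨δ, hδ, h1⟩ := exists_norm_PsiDeriv_sub_le hr hs hb (half_pos hε)
  obtain ⟨ε₀, hε₀, hball⟩ := hr.ball_subset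
  obtain ⟨ρ, hρ, h2⟩ := hc.deriv_uniform
  refine ⟨min ε₀ (min δ ρ), by simp [*], fun k =>
    (Metric.ball_subset_ball (min_le_left _ _)).trans (hball k), ?_⟩
  have h3 : ∀ᶠ ω in whp P atTop, (⨆ θ ∈ {θ | θ ∈ Θ ∧ ‖θ - θ₀ ω.1‖ ≤ ρ},
        ‖(P ω.1).PsiHatDeriv ψ Θ ω.2 θ - (P ω.1).PsiDeriv ψ Θ θ‖ₑ) ≤ ENNReal.ofReal (ε / 2) := by
    apply eventually_whp_of_pr_not
    simp only [not_le]
    exact h2 _ (half_pos hε)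
  filter_upwards [h3] with ω hω θ hθ
  rw [Metric.mem_ball, dist_eq_norm, lt_min_iff, lt_min_iff] at hθ
  have h4 : ‖(P ω.1).PsiHatDeriv ψ Θ ω.2 θ - (P ω.1).PsiDeriv ψ Θ θ‖ ≤ ε / 2 := by
    rw [← ENNReal.ofReal_le_ofReal_iff (half_pos hε).le, ofReal_norm]
    refine le_trans ?_ hω
    exact le_iSup₂_of_le (f := fun θ (_ : θ ∈ {θ | θ ∈ Θ ∧ ‖θ - θ₀ ω.1‖ ≤ ρ}) =>
      ‖(P ω.1).PsiHatDeriv ψ Θ ω.2 θ - (P ω.1).PsiDeriv ψ Θ θ‖ₑ) θ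
      ⟨hball _ (by simpa [dist_eq_norm] using hθ.1), hθ.2.2.le⟩ le_rfl
  have h5 := norm_add_le_of_le h4 (h1 ω.1 θ hθ.2.1)
  rwa [sub_add_sub_cancel, add_halves] at h5

lemma tendsto_theta_sub (hc : Consistency P ψ Θ θ₀ θHat) :
    Tendsto (fun ω : Σ k, (P k).Assignment => θHat ω.1 ω.2 - θ₀ ω.1) (whp P atTop) (𝓝 0) := by
  rw [Metric.nhds_basis_closedBall.tendsto_right_iff]
  intro ε hε
  apply eventually_whp_of_pr_not
  simpa using hc.consistent ε hε

lemma tendsto_PsiHatDeriv_sub (hr : InteriorRoot P ψ Θ θ₀) (hs : Smoothness P ψ Θ θ₀)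
    (hb : Boundedness P ψ Θ θ₀) (hc : Consistency P ψ Θ θ₀ θHat) :
    Tendsto (fun ω : Σ k, (P k).Assignment =>
      (P ω.1).PsiHatDeriv ψ Θ ω.2 (θHat ω.1 ω.2) - (P ω.1).PsiDeriv ψ Θ (θ₀ ω.1))
      (whp P atTop) (𝓝 0) := by
  rw [Metric.nhds_basis_closedBall.tendsto_right_iff]
  intro ε hε
  obtain ⟨δ, hδ, -, h⟩ := exists_norm_PsiHatDeriv_sub_le hr hs hb hc hε
  filter_upwards [h, (tendsto_theta_sub hc).eventually (Metric.ball_mem_nhds _ hδ)] with ω h1 h2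
  simpa using h1 _ (by simpa [dist_eq_norm] using h2)

/-- The remainder of the linearization at `θ₀` is negligible relative to the estimation error. -/
lemma eventually_norm_remainder_le (hr : InteriorRoot P ψ Θ θ₀) (hs : Smoothness P ψ Θ θ₀)
    (hb : Boundedness P ψ Θ θ₀) (hc : Consistency P ψ Θ θ₀ θHat) {ε : ℝ} (hε : 0 < ε) :
    ∀ᶠ ω in whp P atTop,
      ‖-(P ω.1).PsiHat ψ ω.2 (θ₀ ω.1) -
        (P ω.1).PsiDeriv ψ Θ (θ₀ ω.1) (θHat ω.1 ω.2 - θ₀ ω.1)‖ ≤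
        ε * ‖θHat ω.1 ω.2 - θ₀ ω.1‖ := by
  obtain ⟨δ, hδ, hball, h⟩ := exists_norm_PsiHatDeriv_sub_le hr hs hb hc hε
  filter_upwards [h, (tendsto_theta_sub hc).eventually (Metric.ball_mem_nhds _ hδ),
    eventually_whp_mem_design] with ω h1 h2 h3
  have hd : ∀ θ ∈ Metric.ball (θ₀ ω.1) δ, HasFDerivWithinAt ((P ω.1).PsiHat ψ ω.2)
      ((P ω.1).PsiHatDeriv ψ Θ ω.2 θ) (Metric.ball (θ₀ ω.1) δ) θ := by
    intro θ hθ
    have hdiff : ∀ i, DifferentiableWithinAt ℝ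
        (ψ (ω.2 i) ((P ω.1).observed ω.2 i) ((P ω.1).X i)) Θ θ := fun i =>
      (hs.contDiff _ _ _).differentiableOn one_ne_zero θ (hball _ hθ)
    exact (hasFDerivWithinAt_mean hdiff).differentiableWithinAt.hasFDerivWithinAt.mono (hball _)
  have h4 := Convex.norm_image_sub_le_of_norm_hasFDerivWithin_le' hd h1 (convex_ball _ _)
    (Metric.mem_ball_self hδ) (y := θHat ω.1 ω.2) (by simpa [dist_eq_norm] using h2)
  rwa [hc.root _ _ h3, zero_sub] at h4

/-- There is an exact linear equation for the estimation error, whose random slope is close to the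
population derivative: it is the population derivative plus the rank-one operator that sends the
estimation error to the remainder of the linearization. -/
lemma exists_slope (hr : InteriorRoot P ψ Θ θ₀) (hs : Smoothness P ψ Θ θ₀)
    (hb : Boundedness P ψ Θ θ₀) (hc : Consistency P ψ Θ θ₀ θHat) :
    ∃ D : (Σ k, (P k).Assignment) → EuclideanSpace ℝ (Fin p) →L[ℝ] EuclideanSpace ℝ (Fin p),
      Tendsto (fun ω => D ω - (P ω.1).PsiDeriv ψ Θ (θ₀ ω.1)) (whp P atTop) (𝓝 0) ∧
      ∀ᶠ ω in whp P atTop,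
        D ω (θHat ω.1 ω.2 - θ₀ ω.1) = -(P ω.1).PsiHat ψ ω.2 (θ₀ ω.1) := by
  set d : (Σ k, (P k).Assignment) → EuclideanSpace ℝ (Fin p) :=
    fun ω => θHat ω.1 ω.2 - θ₀ ω.1 with hd
  set ρ : (Σ k, (P k).Assignment) → EuclideanSpace ℝ (Fin p) := fun ω =>
    -(P ω.1).PsiHat ψ ω.2 (θ₀ ω.1) - (P ω.1).PsiDeriv ψ Θ (θ₀ ω.1) (d ω) with hρ
  have hρd : ∀ ε > 0, ∀ᶠ ω in whp P atTop, ‖ρ ω‖ ≤ ε * ‖d ω‖ := fun ε hε =>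
    eventually_norm_remainder_le hr hs hb hc hε
  refine ⟨fun ω => (P ω.1).PsiDeriv ψ Θ (θ₀ ω.1) +
    (‖d ω‖ ^ 2)⁻¹ • (innerSL ℝ (d ω)).smulRight (ρ ω), ?_, ?_⟩
  · simp only [add_sub_cancel_left]
    rw [Metric.nhds_basis_closedBall.tendsto_right_iff]
    intro ε hε
    filter_upwards [hρd ε hε] with ω hω
    rw [mem_closedBall_zero_iff, norm_smul, ContinuousLinearMap.norm_smulRight_apply,
      innerSL_apply_norm, norm_inv, norm_pow, norm_norm]
    rcases eq_or_ne ‖d ω‖ 0 with h0 | h0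
    · simp [h0, hε.le]
    · have : 0 < ‖d ω‖ := lt_of_le_of_ne (norm_nonneg _) h0.symm
      rw [inv_mul_le_iff₀ (by positivity)]
      nlinarith
  · filter_upwards [hρd 1 one_pos] with ω hω
    simp only [add_apply, smul_apply,
      ContinuousLinearMap.smulRight_apply, innerSL_apply_apply]
    rw [one_mul] at hω
    have h1 : (‖d ω‖ ^ 2)⁻¹ • ‖d ω‖ ^ 2 • ρ ω = ρ ω := by
      rcases eq_or_ne ‖d ω‖ 0 with h0 | h0
      · rw [h0] at hω
        simp [norm_le_zero_iff.1 hω]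
      · rw [smul_smul, inv_mul_cancel₀ (by positivity), one_smul]
    change _ + (‖d ω‖ ^ 2)⁻¹ • (inner ℝ (d ω) (d ω)) • ρ ω = _
    rw [real_inner_self_eq_norm_sq, h1, hρ]
    simp [hd]

end Linearization

/-! ### Consistency of the sample covariance matrices -/

section SampleCovariance

open FinitePopulation

variable {𝒴 𝒳 : Type*} {p : ℕ} {P : ℕ → FinitePopulation 𝒴 𝒳} {ψ : EstimatingFunction 𝒴 𝒳 p}
  {Θ : Set (EuclideanSpace ℝ (Fin p))} {θ₀ : ℕ → EuclideanSpace ℝ (Fin p)}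
  {θHat : (k : ℕ) → (P k).Assignment → EuclideanSpace ℝ (Fin p)}

lemma FinitePopulation.expect_armSum_sq_le {Q : FinitePopulation 𝒴 𝒳} {a : Fin Q.N → ℝ}
    (ha : ∑ i, a i = 0) (z : Bool) :
    Q.expect (fun Z => (∑ i with Z i = z, a i) ^ 2) ≤ ∑ i, a i ^ 2 := by
  refine le_trans (le_of_eq ?_) (expect_treatedSum_sq_le ha)
  cases z
  · congr 1
    ext Z
    have := sum_treated_add_sum_control a Z
    rw [ha, ← treatedSum] at this
    rw [eq_neg_of_add_eq_zero_left this, neg_sq]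
  · rfl

/-- The weak law of large numbers for simple random sampling without replacement. -/
lemma tendsto_armSum {b : (k : ℕ) → Fin (P k).N → ℝ} (h0 : ∀ k, ∑ i, b k i = 0)
    (h : Tendsto (fun k => ((P k).N : ℝ)⁻¹ ^ 2 * ∑ i, b k i ^ 2) atTop (𝓝 0)) (z : Bool) :
    Tendsto (fun ω : Σ k, (P k).Assignment =>
      ((P ω.1).N : ℝ)⁻¹ * ∑ i with ω.2 i = z, b ω.1 i) (whp P atTop) (𝓝 0) := by
  apply tendsto_whp_of_expect
  have h1 := h.sqrt
  rw [Real.sqrt_zero] at h1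
  refine squeeze_zero (fun k => (P k).expect_nonneg fun _ _ => norm_nonneg _) (fun k => ?_) h1
  refine ((P k).expect_le_sqrt _).trans (Real.sqrt_le_sqrt ?_)
  simp only [Real.norm_eq_abs, sq_abs, mul_pow]
  rw [expect_const_mul]
  gcongr
  exact expect_armSum_sq_le (h0 k) z

namespace FinitePopulation

variable (Q : FinitePopulation 𝒴 𝒳)

/-- The deviations from the finite population average. -/
def centered (a : Fin Q.N → EuclideanSpace ℝ (Fin p)) (i : Fin Q.N) : EuclideanSpace ℝ (Fin p) :=
  a i - Q.mean a

lemma mean_apply (a : Fin Q.N → EuclideanSpace ℝ (Fin p)) (s : Fin p) :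
    Q.mean a s = (∑ i, a i s) / Q.N := by
  simp [mean, Finset.sum_apply, div_eq_inv_mul]

lemma centered_apply (a : Fin Q.N → EuclideanSpace ℝ (Fin p)) (i : Fin Q.N) (s : Fin p) :
    Q.centered a i s = a i s - (∑ i, a i s) / Q.N := by
  rw [centered, PiLp.sub_apply, mean_apply]

lemma sum_centered_apply (a : Fin Q.N → EuclideanSpace ℝ (Fin p)) (s : Fin p) :
    ∑ i, Q.centered a i s = 0 := by
  simp only [centered_apply]
  exact sum_sub_mean _

lemma sum_centered_mul (a : Fin Q.N → EuclideanSpace ℝ (Fin p)) (hN : 1 < Q.N) (s t : Fin p) :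
    ∑ i, Q.centered a i s * Q.centered a i t = ((Q.N : ℝ) - 1) * Q.cov a s t := by
  have : (1 : ℝ) < Q.N := by exact_mod_cast hN
  rw [cov, Matrix.of_apply, mul_inv_cancel_left₀ (by linarith)]
  simp [centered]

variable {Q} in
/-- The sample covariance is unchanged by a translation of the population. -/
lemma sampleCov_apply_eq {Z : Q.Assignment} (hZ : Z ∈ Q.design) {z : Bool} (hn : 0 < Q.armSize z)
    (a : Fin Q.N → EuclideanSpace ℝ (Fin p)) (c : EuclideanSpace ℝ (Fin p)) (s t : Fin p) :
    Q.sampleCov Z z a s t = ((Q.armSize z : ℝ) - 1)⁻¹ *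
      (∑ i with Z i = z, (a i - c) s * (a i - c) t -
        (Q.armSize z : ℝ)⁻¹ * (∑ i with Z i = z, (a i - c) s) * ∑ i with Z i = z, (a i - c) t) := by
  have hn' : (Q.armSize z : ℝ) ≠ 0 := by exact_mod_cast hn.ne'
  have hm : ∀ s, Q.sampleMean Z z a s = (Q.armSize z : ℝ)⁻¹ * ∑ i with Z i = z, a i s := by
    intro s
    simp [sampleMean, Finset.sum_apply]
  rw [sampleCov, Matrix.of_apply, hm, hm]
  congr 1
  simp only [PiLp.sub_apply, mul_sub, sub_mul, Finset.sum_sub_distrib, Finset.sum_const,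
    Q.card_arm hZ, nsmul_eq_mul, ← Finset.mul_sum, ← Finset.sum_mul]
  field_simp
  ring

end FinitePopulation

/-- Cauchy–Schwarz for averages over a part of the population. -/
lemma abs_inv_mul_sum_filter_le {n : ℕ} (q : Fin n → Prop) [DecidablePred q] (x y : Fin n → ℝ) :
    |(n : ℝ)⁻¹ * ∑ i with q i, x i * y i| ≤
      √((n : ℝ)⁻¹ * ∑ i, x i ^ 2) * √((n : ℝ)⁻¹ * ∑ i, y i ^ 2) := by
  have h0 : (0 : ℝ) ≤ (n : ℝ)⁻¹ := by positivity
  rw [← Real.sqrt_mul (mul_nonneg h0 (Finset.sum_nonneg fun _ _ => sq_nonneg _))]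
  apply Real.abs_le_sqrt
  have h1 := Finset.sum_mul_sq_le_sq_mul_sq (Finset.univ.filter q) x y
  have h2 : ∀ x : Fin n → ℝ, ∑ i with q i, x i ^ 2 ≤ ∑ i, x i ^ 2 := fun x =>
    Finset.sum_le_sum_of_subset_of_nonneg (Finset.filter_subset _ _) fun _ _ _ => sq_nonneg _
  calc _ = (n : ℝ)⁻¹ ^ 2 * (∑ i with q i, x i * y i) ^ 2 := by ring
    _ ≤ (n : ℝ)⁻¹ ^ 2 * ((∑ i, x i ^ 2) * ∑ i, y i ^ 2) := by
      refine mul_le_mul_of_nonneg_left (h1.trans ?_) (by positivity)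
      exact mul_le_mul (h2 x) (h2 y) (Finset.sum_nonneg fun _ _ => sq_nonneg _)
        (Finset.sum_nonneg fun _ _ => sq_nonneg _)
    _ = _ := by ring

lemma Boundedness.exists_abs_cov_le (hb : Boundedness P ψ Θ θ₀) :
    ∃ c₀ > 0, ∀ k z s t, |(P k).cov (fun i => (P k).unitPsi ψ z i (θ₀ k)) s t| ≤ c₀ := by
  choose c hc h using hb.cov_le
  refine ⟨max (c true) (c false), by simp [hc], fun k z s t => ?_⟩
  refine (abs_apply_le_sigmaMax _ s t).trans ((h z k).trans ?_)
  cases z <;> simp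

/-- The centred values of the estimating function of arm `z` at `θ₀ k`. -/
def centeredPsi (P : ℕ → FinitePopulation 𝒴 𝒳) (ψ : EstimatingFunction 𝒴 𝒳 p)
    (θ₀ : ℕ → EuclideanSpace ℝ (Fin p)) (z : Bool) (k : ℕ) (i : Fin (P k).N) :
    EuclideanSpace ℝ (Fin p) :=
  (P k).centered (fun i => (P k).unitPsi ψ z i (θ₀ k)) i

lemma inv_mul_sum_centeredPsi_sq_le {c₀ : ℝ} {k : ℕ} (hN : 1 < (P k).N) {z : Bool} {s : Fin p}
    (hc : |(P k).cov (fun i => (P k).unitPsi ψ z i (θ₀ k)) s s| ≤ c₀) :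
    ((P k).N : ℝ)⁻¹ * ∑ i, centeredPsi P ψ θ₀ z k i s ^ 2 ≤ c₀ := by
  have hN' : (1 : ℝ) < (P k).N := by exact_mod_cast hN
  simp only [pow_two, centeredPsi, sum_centered_mul _ _ hN]
  rw [inv_mul_le_iff₀ (by linarith)]
  have := abs_nonneg ((P k).cov (fun i => (P k).unitPsi ψ z i (θ₀ k)) s s)
  have := le_abs_self ((P k).cov (fun i => (P k).unitPsi ψ z i (θ₀ k)) s s)
  nlinarith

lemma exists_norm_centeredPsi_le (hb : Boundedness P ψ Θ θ₀) :
    ∃ κ : ℕ → ℝ, Tendsto κ atTop (𝓝 0) ∧ (∀ k, 0 ≤ κ k) ∧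
      ∀ k z i, ‖centeredPsi P ψ θ₀ z k i‖ ≤ κ k * √((P k).N) := by
  set M : Bool → ℕ → ℝ := fun z k => ((P k).N : ℝ)⁻¹ * ⨆ j : Fin (P k).N,
      ‖(P k).unitPsi ψ z j (θ₀ k) - (P k).mean fun i => (P k).unitPsi ψ z i (θ₀ k)‖ ^ 2 with hM
  have h1 : ∀ z k i, ‖centeredPsi P ψ θ₀ z k i‖ ≤ √(M z k) * √((P k).N) := by
    intro z k i
    have hN : (0 : ℝ) < (P k).N := by exact_mod_cast hb.N_pos k
    rw [← Real.sqrt_mul' _ hN.le]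
    apply Real.le_sqrt_of_sq_le
    rw [hM]
    simp only
    rw [mul_comm, mul_inv_cancel_left₀ hN.ne']
    exact le_ciSup (f := fun j : Fin (P k).N => ‖(P k).unitPsi ψ z j (θ₀ k) -
      (P k).mean fun i => (P k).unitPsi ψ z i (θ₀ k)‖ ^ 2) (Set.finite_range _).bddAbove i
  refine ⟨fun k => √(M true k) + √(M false k), ?_, fun k => by positivity, fun k z i => ?_⟩
  · have := (hb.max_deviation true).sqrt.add (hb.max_deviation false).sqrt
    rw [Real.sqrt_zero, add_zero] at this
    exact this
  · refine (h1 z k i).trans ?_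
    gcongr
    have h2 := Real.sqrt_nonneg (M true k)
    have h3 := Real.sqrt_nonneg (M false k)
    cases z <;> linarith

lemma eventually_one_lt_N (hN : Tendsto (fun k => (P k).N) atTop atTop) :
    ∀ᶠ k in atTop, 1 < (P k).N := hN.eventually_gt_atTop 1

/-- The weak law of large numbers for the values of the estimating functions. -/
lemma tendsto_armSum_centeredPsi (hN : Tendsto (fun k => (P k).N) atTop atTop)
    (hb : Boundedness P ψ Θ θ₀) (z : Bool) (s : Fin p) :
    Tendsto (fun ω : Σ k, (P k).Assignment =>
      ((P ω.1).N : ℝ)⁻¹ * ∑ i with ω.2 i = z, centeredPsi P ψ θ₀ z ω.1 i s)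
      (whp P atTop) (𝓝 0) := by
  obtain ⟨c₀, hc₀, hc⟩ := hb.exists_abs_cov_le
  refine tendsto_armSum (b := fun k i => centeredPsi P ψ θ₀ z k i s)
    (fun k => sum_centered_apply _ _ _) ?_ z
  have hN' : Tendsto (fun k => ((P k).N : ℝ)⁻¹) atTop (𝓝 0) :=
    tendsto_inv_atTop_zero.comp (tendsto_natCast_atTop_atTop.comp hN)
  have h1 := hN'.mul_const c₀
  rw [zero_mul] at h1
  refine squeeze_zero' (.of_forall fun k => by positivity) ?_ h1
  filter_upwards [eventually_one_lt_N hN] with k hk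
  rw [pow_two, mul_assoc]
  gcongr
  exact inv_mul_sum_centeredPsi_sq_le hk (hc k z s s)

/-- The weak law of large numbers for products of values of the estimating functions. -/
lemma tendsto_armSum_centeredPsi_mul (hN : Tendsto (fun k => (P k).N) atTop atTop)
    (hb : Boundedness P ψ Θ θ₀) (z : Bool) (s t : Fin p) :
    Tendsto (fun ω : Σ k, (P k).Assignment =>
      ((P ω.1).N : ℝ)⁻¹ * ∑ i with ω.2 i = z,
        (centeredPsi P ψ θ₀ z ω.1 i s * centeredPsi P ψ θ₀ z ω.1 i t -
          (∑ i, centeredPsi P ψ θ₀ z ω.1 i s * centeredPsi P ψ θ₀ z ω.1 i t) / (P ω.1).N))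
      (whp P atTop) (𝓝 0) := by
  obtain ⟨c₀, hc₀, hc⟩ := hb.exists_abs_cov_le
  obtain ⟨κ, hκ, hκ0, hκ'⟩ := exists_norm_centeredPsi_le hb
  refine tendsto_armSum (b := fun k i =>
    centeredPsi P ψ θ₀ z k i s * centeredPsi P ψ θ₀ z k i t -
      (∑ i, centeredPsi P ψ θ₀ z k i s * centeredPsi P ψ θ₀ z k i t) / (P k).N)
    (fun k => sum_sub_mean _) ?_ z
  have h1 := (hκ.pow 2).mul_const c₀
  rw [zero_pow two_ne_zero, zero_mul] at h1
  refine squeeze_zero' (.of_forall fun k => by positivity) ?_ h1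
  filter_upwards [eventually_one_lt_N hN] with k hk
  have hNk : (0 : ℝ) < (P k).N := by exact_mod_cast hb.N_pos k
  calc _ ≤ ((P k).N : ℝ)⁻¹ ^ 2 * ∑ i, (centeredPsi P ψ θ₀ z k i s *
        centeredPsi P ψ θ₀ z k i t) ^ 2 := by
        exact mul_le_mul_of_nonneg_left (sum_sub_mean_sq_le _) (by positivity)
    _ ≤ ((P k).N : ℝ)⁻¹ ^ 2 * ∑ i, (κ k ^ 2 * (P k).N) * centeredPsi P ψ θ₀ z k i t ^ 2 := by
        gcongr with i
        rw [mul_pow]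
        gcongr
        have h2 := (PiLp.norm_apply_le (centeredPsi P ψ θ₀ z k i) s).trans (hκ' k z i)
        calc _ ≤ (κ k * √((P k).N)) ^ 2 := sq_le_sq' (abs_le.1 h2).1 (abs_le.1 h2).2
          _ = _ := by rw [mul_pow, Real.sq_sqrt hNk.le]
    _ = κ k ^ 2 * (((P k).N : ℝ)⁻¹ * ∑ i, centeredPsi P ψ θ₀ z k i t ^ 2) := by
        rw [← Finset.mul_sum]
        field_simp
    _ ≤ κ k ^ 2 * c₀ := by
        gcongr
        exact inv_mul_sum_centeredPsi_sq_le hk (hc k z t t)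

/-- Replacing `θ₀` by the estimator changes the estimating functions little in mean square. -/
lemma tendsto_mean_sq_unitPsi_sub (hs : Smoothness P ψ Θ θ₀)
    (hb : Boundedness P ψ Θ θ₀) (hc : Consistency P ψ Θ θ₀ θHat) (z : Bool) :
    Tendsto (fun ω : Σ k, (P k).Assignment => ((P ω.1).N : ℝ)⁻¹ * ∑ i,
      ‖(P ω.1).unitPsi ψ z i (θHat ω.1 ω.2) - (P ω.1).unitPsi ψ z i (θ₀ ω.1)‖ ^ 2)
      (whp P atTop) (𝓝 0) := by
  rw [Metric.nhds_basis_closedBall.tendsto_right_iff]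
  intro ε hε
  have h1 := (hs.oscillation_sq z).eventually_le_const
    (ENNReal.ofReal_pos.2 hε : (0 : ℝ≥0∞) < ENNReal.ofReal ε)
  obtain ⟨δ, h2, h3⟩ := (h1.and self_mem_nhdsWithin).exists
  filter_upwards [(tendsto_theta_sub hc).eventually (Metric.ball_mem_nhds _ h3),
    eventually_whp_mem_design] with ω h4 h5
  have hN : (0 : ℝ) < (P ω.1).N := by exact_mod_cast hb.N_pos ω.1
  rw [mem_closedBall_zero_iff, Real.norm_of_nonneg (by positivity),
    ← ENNReal.ofReal_le_ofReal_iff hε.le]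
  refine le_trans (le_trans (le_of_eq ?_) (emean_mono (Q := P ω.1) (a := fun i =>
    ‖(P ω.1).unitPsi ψ z i (θHat ω.1 ω.2) - (P ω.1).unitPsi ψ z i (θ₀ ω.1)‖ₑ ^ 2) fun i => ?_))
    ((le_iSup _ ω.1).trans h2)
  · rw [emean, ENNReal.ofReal_mul (by positivity), ENNReal.ofReal_inv_of_pos hN,
      ENNReal.ofReal_natCast, ENNReal.ofReal_sum_of_nonneg fun _ _ => by positivity]
    simp only [← ofReal_norm, ENNReal.ofReal_pow (norm_nonneg _)]
  · gcongr
    exact le_iSup₂_of_le (f := fun θ (_ : θ ∈ {θ | θ ∈ Θ ∧ ‖θ - θ₀ ω.1‖ ≤ δ}) =>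
      ‖(P ω.1).unitPsi ψ z i θ - (P ω.1).unitPsi ψ z i (θ₀ ω.1)‖ₑ) (θHat ω.1 ω.2)
      ⟨hc.mem _ _ h5, by simpa using (mem_ball_zero_iff.1 h4).le⟩ le_rfl

end SampleCovariance

section SampleCovarianceLimit

open FinitePopulation

variable {𝒴 𝒳 : Type*} {p : ℕ} {P : ℕ → FinitePopulation 𝒴 𝒳} {ψ : EstimatingFunction 𝒴 𝒳 p}
  {Θ : Set (EuclideanSpace ℝ (Fin p))} {θ₀ : ℕ → EuclideanSpace ℝ (Fin p)}
  {θHat : (k : ℕ) → (P k).Assignment → EuclideanSpace ℝ (Fin p)}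

lemma FinitePopulation.armSize_le (Q : FinitePopulation 𝒴 𝒳) (z : Bool) : Q.armSize z ≤ Q.N := by
  have := Q.armSize_add
  cases z <;> omega

lemma Boundedness.exists_mul_N_le_armSize (hb : Boundedness P ψ Θ θ₀) :
    ∃ c > (0 : ℝ), ∀ k z, c * (P k).N ≤ (P k).armSize z := by
  obtain ⟨c, hc, h⟩ := hb.proportions
  refine ⟨c, hc, fun k z => ?_⟩
  have hN : (0 : ℝ) < (P k).N := by exact_mod_cast hb.N_pos k
  exact (le_div_iff₀ hN).1 (h k z).1

/-- The deviation of a sample covariance from the population covariance, in terms of quantities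
that vanish asymptotically. -/
lemma sampleCov_decomposition {n N S C mx my q br : ℝ} (hn : 1 < n) (hN : 0 < N)
    (hS : S = (n - 1)⁻¹ * (N * (br + (q + N⁻¹ * (n * (((N - 1) * C) / N)))) -
      n⁻¹ * (N * mx) * (N * my))) :
    S - C = N / (n - 1) * (br + q) - N / (n - 1) * (N / n) * (mx * my) +
      (N - n) / (N * (n - 1)) * C := by
  have h1 : n - 1 ≠ 0 := by linarith
  have h2 : n ≠ 0 := by linarith
  rw [hS]
  field_simp
  ring

lemma tendsto_sampleCov_sub (hN : Tendsto (fun k => (P k).N) atTop atTop)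
    (hs : Smoothness P ψ Θ θ₀) (hb : Boundedness P ψ Θ θ₀) (hc : Consistency P ψ Θ θ₀ θHat)
    (z : Bool) :
    Tendsto (fun ω : Σ k, (P k).Assignment =>
      (P ω.1).sampleCov ω.2 z (fun i => (P ω.1).unitPsi ψ z i (θHat ω.1 ω.2)) -
        (P ω.1).cov (fun i => (P ω.1).unitPsi ψ z i (θ₀ ω.1))) (whp P atTop) (𝓝 0) := by
  obtain ⟨c, hc0, hcn⟩ := hb.exists_mul_N_le_armSize
  obtain ⟨c₀, hc₀, hcov⟩ := hb.exists_abs_cov_le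
  set d : (ω : Σ k, (P k).Assignment) → Fin (P ω.1).N → EuclideanSpace ℝ (Fin p) := fun ω i =>
    (P ω.1).unitPsi ψ z i (θHat ω.1 ω.2) - (P ω.1).unitPsi ψ z i (θ₀ ω.1) with hd
  set b : (ω : Σ k, (P k).Assignment) → Fin (P ω.1).N → EuclideanSpace ℝ (Fin p) := fun ω i =>
    centeredPsi P ψ θ₀ z ω.1 i with hbdef
  have hNr : Tendsto (fun k => ((P k).N : ℝ)) atTop atTop := tendsto_natCast_atTop_atTop.comp hN
  -- mean squares of the coordinates of `d` and of `b`
  have hD : Tendsto (fun ω => √(((P ω.1).N : ℝ)⁻¹ * ∑ i, ‖d ω i‖ ^ 2)) (whp P atTop) (𝓝 0) := by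
    have := (tendsto_mean_sq_unitPsi_sub hs hb hc z).sqrt
    rwa [Real.sqrt_zero] at this
  set D := fun ω : Σ k, (P k).Assignment => √(((P ω.1).N : ℝ)⁻¹ * ∑ i, ‖d ω i‖ ^ 2) with hDdef
  have hDs : ∀ ω s, √(((P ω.1).N : ℝ)⁻¹ * ∑ i, d ω i s ^ 2) ≤ D ω := by
    intro ω s
    apply Real.sqrt_le_sqrt
    refine mul_le_mul_of_nonneg_left (Finset.sum_le_sum fun i _ => ?_) (by positivity)
    have := PiLp.norm_apply_le (d ω i) s
    exact sq_le_sq' (abs_le.1 this).1 (abs_le.1 this).2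
  have hD0 : ∀ ω, 0 ≤ D ω := fun ω => Real.sqrt_nonneg _
  have hBs : ∀ᶠ ω in whp P atTop, ∀ s, √(((P ω.1).N : ℝ)⁻¹ * ∑ i, b ω i s ^ 2) ≤ √c₀ := by
    filter_upwards [tendsto_fst_whp.eventually (eventually_one_lt_N hN)] with ω hω s
    exact Real.sqrt_le_sqrt (inv_mul_sum_centeredPsi_sq_le hω (hcov _ _ _ _))
  -- sample means of the coordinates of `b + d`
  have hm : ∀ s, Tendsto (fun ω : Σ k, (P k).Assignment =>
      ((P ω.1).N : ℝ)⁻¹ * ∑ i with ω.2 i = z, (b ω i s + d ω i s)) (whp P atTop) (𝓝 0) := by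
    intro s
    have h1 : Tendsto (fun ω : Σ k, (P k).Assignment =>
      ((P ω.1).N : ℝ)⁻¹ * ∑ i with ω.2 i = z, d ω i s) (whp P atTop) (𝓝 0) := by
      refine squeeze_zero_norm (fun ω => ?_) hD
      have h2 := abs_inv_mul_sum_filter_le (fun i => ω.2 i = z) (fun i => d ω i s) (fun _ => 1)
      simp only [mul_one, one_pow, Finset.sum_const, Finset.card_univ, Fintype.card_fin,
        nsmul_eq_mul] at h2
      have hNk : ((P ω.1).N : ℝ) ≠ 0 := by exact_mod_cast (hb.N_pos ω.1).ne'
      rw [inv_mul_cancel₀ hNk, Real.sqrt_one, mul_one] at h2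
      exact h2.trans (hDs ω s)
    have h2 := (tendsto_armSum_centeredPsi hN hb z s).add h1
    rw [add_zero] at h2
    refine h2.congr fun ω => ?_
    rw [Finset.sum_add_distrib, mul_add]
  -- the change in the sample second moments caused by `d`
  have hbr : ∀ s t, Tendsto (fun ω : Σ k, (P k).Assignment =>
      ((P ω.1).N : ℝ)⁻¹ * ∑ i with ω.2 i = z,
        (b ω i s * d ω i t + d ω i s * b ω i t + d ω i s * d ω i t)) (whp P atTop) (𝓝 0) := by
    intro s t
    have h1 : Tendsto (fun ω => √c₀ * D ω + D ω * √c₀ + D ω * D ω) (whp P atTop) (𝓝 0) := by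
      simpa using ((hD.const_mul (√c₀)).add (hD.mul_const (√c₀))).add (hD.mul hD)
    refine squeeze_zero_norm' ?_ h1
    filter_upwards [hBs] with ω hω
    rw [Finset.sum_add_distrib, Finset.sum_add_distrib, mul_add, mul_add]
    refine (norm_add₃_le).trans ?_
    have key := fun x y => abs_inv_mul_sum_filter_le (n := (P ω.1).N) (fun i => ω.2 i = z) x y
    have hc0' := Real.sqrt_nonneg c₀
    refine add_le_add (add_le_add ?_ ?_) ?_
    · exact (key _ _).trans (mul_le_mul (hω s) (hDs ω t) (Real.sqrt_nonneg _) hc0')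
    · exact (key _ _).trans (mul_le_mul (hDs ω s) (hω t) (Real.sqrt_nonneg _) (hD0 ω))
    · exact (key _ _).trans (mul_le_mul (hDs ω s) (hDs ω t) (Real.sqrt_nonneg _) (hD0 ω))
  -- bounds for the deterministic coefficients
  have hcoef : ∀ᶠ k in atTop, 2 ≤ c * ((P k).N : ℝ) :=
    (hNr.const_mul_atTop hc0).eventually_ge_atTop 2
  have hn1 : ∀ k, 2 ≤ c * ((P k).N : ℝ) → c / 2 * (P k).N ≤ (P k).armSize z - 1 := by
    intro k hk
    have := hcn k z
    linarith
  refine tendsto_pi_nhds.2 fun s => tendsto_pi_nhds.2 fun t => ?_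
  have hq := tendsto_armSum_centeredPsi_mul hN hb z s t
  have hlim : Tendsto (fun ω : Σ k, (P k).Assignment =>
      ((P ω.1).N : ℝ) / ((P ω.1).armSize z - 1) *
        (((P ω.1).N : ℝ)⁻¹ * ∑ i with ω.2 i = z,
          (b ω i s * d ω i t + d ω i s * b ω i t + d ω i s * d ω i t) +
        ((P ω.1).N : ℝ)⁻¹ * ∑ i with ω.2 i = z, (b ω i s * b ω i t -
          (∑ i, b ω i s * b ω i t) / (P ω.1).N)) -
      ((P ω.1).N : ℝ) / ((P ω.1).armSize z - 1) * ((P ω.1).N / (P ω.1).armSize z) *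
        ((((P ω.1).N : ℝ)⁻¹ * ∑ i with ω.2 i = z, (b ω i s + d ω i s)) *
          (((P ω.1).N : ℝ)⁻¹ * ∑ i with ω.2 i = z, (b ω i t + d ω i t))) +
      (((P ω.1).N : ℝ) - (P ω.1).armSize z) / ((P ω.1).N * ((P ω.1).armSize z - 1)) *
        (P ω.1).cov (fun i => (P ω.1).unitPsi ψ z i (θ₀ ω.1)) s t) (whp P atTop) (𝓝 0) := by
    have hA : ∀ᶠ k in atTop, |((P k).N : ℝ) / ((P k).armSize z - 1)| ≤ 2 / c := by
      filter_upwards [hcoef] with k hk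
      have h1 := hn1 k hk
      have hNk : (0 : ℝ) < (P k).N := by exact_mod_cast hb.N_pos k
      have h2 : 0 < ((P k).armSize z : ℝ) - 1 := lt_of_lt_of_le (by positivity) h1
      rw [abs_of_nonneg (by positivity), div_le_div_iff₀ h2 hc0]
      linarith
    have hB : ∀ k, |((P k).N : ℝ) / (P k).armSize z| ≤ 1 / c := by
      intro k
      have hNk : (0 : ℝ) < (P k).N := by exact_mod_cast hb.N_pos k
      have h2 : 0 < ((P k).armSize z : ℝ) := lt_of_lt_of_le (by positivity) (hcn k z)
      rw [abs_of_nonneg (by positivity), div_le_div_iff₀ h2 hc0]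
      linarith [hcn k z]
    have h1 := bdd_le_mul_tendsto_zero' (2 / c) (tendsto_fst_whp.eventually hA)
      (by simpa using (hbr s t).add hq)
    have h2 := bdd_le_mul_tendsto_zero' (2 / c * (1 / c))
      (f := fun ω : Σ k, (P k).Assignment =>
        ((P ω.1).N : ℝ) / ((P ω.1).armSize z - 1) * ((P ω.1).N / (P ω.1).armSize z))
      (by
        filter_upwards [tendsto_fst_whp.eventually hA] with ω hω
        rw [abs_mul]
        exact mul_le_mul hω (hB _) (abs_nonneg _) (by positivity))
      (by simpa using (hm s).mul (hm t))
    have h3 : Tendsto (fun k => (((P k).N : ℝ) - (P k).armSize z) /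
        ((P k).N * ((P k).armSize z - 1)) *
        (P k).cov (fun i => (P k).unitPsi ψ z i (θ₀ k)) s t) atTop (𝓝 0) := by
      have h4 : Tendsto (fun k => ((P k).N : ℝ)⁻¹ * (2 / c * c₀)) atTop (𝓝 0) := by
        simpa using (tendsto_inv_atTop_zero.comp hNr).mul_const (2 / c * c₀)
      refine squeeze_zero_norm' ?_ h4
      filter_upwards [hcoef, hA] with k hk hAk
      have hNk : (0 : ℝ) < (P k).N := by exact_mod_cast hb.N_pos k
      have h5 : ((P k).armSize z : ℝ) ≤ (P k).N := by exact_mod_cast (P k).armSize_le z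
      have h6 : 0 < ((P k).armSize z : ℝ) - 1 := lt_of_lt_of_le (by positivity) (hn1 k hk)
      rw [Real.norm_eq_abs, abs_mul, ← mul_assoc]
      refine mul_le_mul ?_ (hcov k z s t) (abs_nonneg _) (by positivity)
      rw [abs_of_nonneg (div_nonneg (by linarith) (by positivity))]
      rw [abs_of_nonneg (by positivity)] at hAk
      calc _ ≤ ((P k).N : ℝ) / ((P k).N * ((P k).armSize z - 1)) := by
            gcongr
            linarith [(Nat.cast_nonneg ((P k).armSize z) : (0 : ℝ) ≤ _)]
        _ = ((P k).N : ℝ)⁻¹ * ((P k).N / ((P k).armSize z - 1)) := by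
            field_simp
        _ ≤ _ := by gcongr
    have := (h1.sub h2).add (h3.comp tendsto_fst_whp)
    simpa using this
  refine hlim.congr' ?_
  filter_upwards [tendsto_fst_whp.eventually (eventually_one_lt_N hN),
    tendsto_fst_whp.eventually hcoef, eventually_whp_mem_design] with ω h1 h2 h3
  have hNk : (0 : ℝ) < (P ω.1).N := by exact_mod_cast hb.N_pos ω.1
  have h6 : 0 < ((P ω.1).armSize z : ℝ) - 1 := lt_of_lt_of_le (by positivity) (hn1 ω.1 h2)
  have h7 : 0 < (P ω.1).armSize z := by
    have : (0 : ℝ) < (P ω.1).armSize z := by linarith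
    exact_mod_cast this
  rw [Matrix.sub_apply]
  refine (sampleCov_decomposition (by linarith) hNk ?_).symm
  rw [sampleCov_apply_eq h3 h7 _ ((P ω.1).mean fun i => (P ω.1).unitPsi ψ z i (θ₀ ω.1))]
  have hx : ∀ i s, ((P ω.1).unitPsi ψ z i (θHat ω.1 ω.2) -
      (P ω.1).mean fun i => (P ω.1).unitPsi ψ z i (θ₀ ω.1)) s = b ω i s + d ω i s := by
    intro i s
    simp [hbdef, hd, centeredPsi, centered]
  simp only [hx]
  rw [← sum_centered_mul _ _ h1]
  change _ = (((P ω.1).armSize z : ℝ) - 1)⁻¹ * (((P ω.1).N : ℝ) * (_ + (_ + ((P ω.1).N : ℝ)⁻¹ *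
    (_ * ((∑ i, b ω i s * b ω i t) / (P ω.1).N)))) - _)
  rw [mul_inv_cancel_left₀ hNk.ne', mul_inv_cancel_left₀ hNk.ne']
  congr 2
  rw [Finset.sum_sub_distrib, Finset.sum_const, (P ω.1).card_arm h3, nsmul_eq_mul, ← mul_add,
    sub_add_cancel, ← mul_add, mul_inv_cancel_left₀ hNk.ne', ← Finset.sum_add_distrib]
  exact Finset.sum_congr rfl fun i _ => by ring

end SampleCovarianceLimit

/-! ### The central limit theorem for the estimating equation -/

section Law

variable {𝒴 𝒳 : Type*} {E : Type*} [MeasurableSpace E]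

/-- The law of a random variable under complete randomization. -/
def FinitePopulation.law (Q : FinitePopulation 𝒴 𝒳) (X : Q.Assignment → E) : Measure E :=
  (Q.design.card : ℝ≥0∞)⁻¹ • ∑ Z ∈ Q.design, Measure.dirac (X Z)

lemma FinitePopulation.law_apply (Q : FinitePopulation 𝒴 𝒳) (X : Q.Assignment → E) {s : Set E}
    (hs : MeasurableSet s) : Q.law X s = ENNReal.ofReal (Q.pr fun Z => X Z ∈ s) := by
  classical
  rw [law, Measure.smul_apply, Measure.finsetSum_apply, pr,
    ENNReal.ofReal_div_of_pos Q.card_design_pos, ENNReal.ofReal_natCast, ENNReal.ofReal_natCast,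
    ENNReal.div_eq_inv_mul, smul_eq_mul, Finset.card_filter]
  push_cast
  congr 1
  refine Finset.sum_congr rfl fun Z _ => ?_
  rw [Measure.dirac_apply' _ hs, Set.indicator_apply]
  rfl

instance (Q : FinitePopulation 𝒴 𝒳) (X : Q.Assignment → E) : IsProbabilityMeasure (Q.law X) :=
  ⟨by rw [Q.law_apply X MeasurableSet.univ, Q.pr_eq_one fun _ _ => Set.mem_univ _,
    ENNReal.ofReal_one]⟩

/-- The law of a random variable under complete randomization, as a bundled probability
measure. -/
def FinitePopulation.probLaw (Q : FinitePopulation 𝒴 𝒳) (X : Q.Assignment → E) :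
    ProbabilityMeasure E := ⟨Q.law X, inferInstance⟩

lemma FinitePopulation.charFun_law [NormedAddCommGroup E] [InnerProductSpace ℝ E] [BorelSpace E]
    [SecondCountableTopology E] (Q : FinitePopulation 𝒴 𝒳) (X : Q.Assignment → E) (w : E) :
    charFun (Q.law X) w = Q.expect fun Z => Complex.exp (inner ℝ (X Z) w * Complex.I) := by
  have hm : StronglyMeasurable fun x : E => Complex.exp (inner ℝ x w * Complex.I) := by
    apply Continuous.stronglyMeasurable
    fun_prop
  rw [charFun_apply, law, integral_smul_measure, integral_finsetSum_measure, expect,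
    ENNReal.toReal_inv, ENNReal.toReal_natCast]
  · simp only [integral_dirac' _ _ hm]
  · intro Z _
    refine Integrable.of_bound (C := 1) hm.aestronglyMeasurable (.of_forall fun x => ?_)
    rw [Complex.norm_exp_ofReal_mul_I]

/-- Slutsky's theorem in the form of a lower bound for the probability of an event `A`: if `U`
converges in distribution to `G` and `Y` converges in probability to `y₀`, then the limit inferior
of the probability of `A` is at least the `G`-measure of the points `u` such that `A` is implied by
`(U, Y)` being near `(u, y₀)`. -/
lemma eventually_lt_pr_of_tendsto [NormedAddCommGroup E] [BorelSpace E]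
    [SecondCountableTopology E] [CompleteSpace E] [LocallyCompactSpace E]
    {P : ℕ → FinitePopulation 𝒴 𝒳} {ι : ℕ → ℕ}
    {U : (k : ℕ) → (P k).Assignment → E} {G : ProbabilityMeasure E}
    (hU : Tendsto (fun j => (P (ι j)).probLaw (U (ι j))) atTop (𝓝 G))
    {T : Type*} [TopologicalSpace T] {Y : (Σ k, (P k).Assignment) → T} {y₀ : T}
    (hY : Tendsto Y (whp P (map ι atTop)) (𝓝 y₀)) {O : Set (E × T)}
    {A : (Σ k, (P k).Assignment) → Prop}
    (hA : ∀ᶠ ω in whp P (map ι atTop), (U ω.1 ω.2, Y ω) ∈ O → A ω) {c : ℝ} (hc0 : 0 ≤ c)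
    (hc : ENNReal.ofReal c < (G : Measure E) {u | O ∈ 𝓝 (u, y₀)}) :
    ∀ᶠ j in atTop, c < (P (ι j)).pr fun Z => A ⟨ι j, Z⟩ := by
  have hopen : IsOpen {u | O ∈ 𝓝 (u, y₀)} := by
    have : {u | O ∈ 𝓝 (u, y₀)} = (fun u => (u, y₀)) ⁻¹' interior O := by
      ext u; exact mem_interior_iff_mem_nhds.symm
    rw [this]
    exact isOpen_interior.preimage (by fun_prop)
  obtain ⟨K, hKsub, hK, hcK⟩ := hopen.exists_lt_isCompact hc
  obtain ⟨u, v, hu, hv, hKu, hyv, huv⟩ := generalized_tube_lemma hK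
    (isCompact_singleton (x := y₀)) (isOpen_interior (s := O)) (by
      rintro ⟨a, b⟩ ⟨ha, hb⟩
      rw [Set.mem_singleton_iff] at hb
      rw [mem_interior_iff_mem_nhds]
      change b = y₀ at hb
      subst hb
      exact hKsub ha)
  have hcu := hcK.trans_le (measure_mono hKu)
  obtain ⟨c₂, hc₂, h1, h2⟩ := ENNReal.lt_iff_exists_real_btwn.1 hcu
  rw [ENNReal.ofReal_lt_ofReal_iff_of_nonneg hc0] at h1
  have h3 : ∀ᶠ j in atTop, c₂ < (P (ι j)).pr fun Z => U (ι j) Z ∈ u := by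
    have h4 := ProbabilityMeasure.le_liminf_measure_open_of_tendsto hU hu
    filter_upwards [eventually_lt_of_lt_liminf (h2.trans_le h4)] with j hj
    change _ < (P (ι j)).law (U (ι j)) u at hj
    rwa [FinitePopulation.law_apply _ _ hu.measurableSet,
      ENNReal.ofReal_lt_ofReal_iff_of_nonneg hc₂] at hj
  have h5 : ∀ᶠ ω in whp P (map ι atTop), Y ω ∈ v ∧ ((U ω.1 ω.2, Y ω) ∈ O → A ω) :=
    (hY.eventually (hv.mem_nhds (hyv rfl))).and hA
  rw [eventually_whp, tendsto_map'_iff] at h5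
  filter_upwards [h3, h5.eventually_const_lt (show 1 - (c₂ - c) < 1 by linarith)] with j h6 h7
  have h8 := (P (ι j)).pr_add_pr_le (fun Z => U (ι j) Z ∈ u)
    (fun Z => Y ⟨ι j, Z⟩ ∈ v ∧ ((U (ι j) Z, Y ⟨ι j, Z⟩) ∈ O → A ⟨ι j, Z⟩))
  have h9 := (P (ι j)).pr_mono (A := fun Z => U (ι j) Z ∈ u ∧ Y ⟨ι j, Z⟩ ∈ v ∧
    ((U (ι j) Z, Y ⟨ι j, Z⟩) ∈ O → A ⟨ι j, Z⟩)) (B := fun Z => A ⟨ι j, Z⟩)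
    fun Z _ hZ => hZ.2.2 (interior_subset (huv ⟨hZ.1, hZ.2.1⟩))
  simp only [Function.comp_apply] at h7
  linarith

end Law

section CentralLimit

open FinitePopulation

variable {𝒴 𝒳 : Type*} {p : ℕ} {P : ℕ → FinitePopulation 𝒴 𝒳} {ψ : EstimatingFunction 𝒴 𝒳 p}
  {Θ : Set (EuclideanSpace ℝ (Fin p))} {θ₀ : ℕ → EuclideanSpace ℝ (Fin p)}

/-- The difference between the centred values of the two estimating functions at a unit. -/
def effectPsi (P : ℕ → FinitePopulation 𝒴 𝒳) (ψ : EstimatingFunction 𝒴 𝒳 p)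
    (θ₀ : ℕ → EuclideanSpace ℝ (Fin p)) (k : ℕ) (i : Fin (P k).N) : EuclideanSpace ℝ (Fin p) :=
  centeredPsi P ψ θ₀ true k i - centeredPsi P ψ θ₀ false k i

/-- The covariance matrix of the scaled estimating equation at `θ₀`, up to the factor
`1 - 1 / N`. -/
def scoreCov (P : ℕ → FinitePopulation 𝒴 𝒳) (ψ : EstimatingFunction 𝒴 𝒳 p)
    (θ₀ : ℕ → EuclideanSpace ℝ (Fin p)) (k : ℕ) : Matrix (Fin p) (Fin p) ℝ :=
  Matrix.of fun s t => (P k).r true * (P k).r false *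
    (((P k).N : ℝ)⁻¹ * ∑ i, effectPsi P ψ θ₀ k i s * effectPsi P ψ θ₀ k i t)

/-- The limit of the middle factor of the sandwich estimator. It dominates `scoreCov`. -/
def meatCov (P : ℕ → FinitePopulation 𝒴 𝒳) (ψ : EstimatingFunction 𝒴 𝒳 p)
    (θ₀ : ℕ → EuclideanSpace ℝ (Fin p)) (k : ℕ) : Matrix (Fin p) (Fin p) ℝ :=
  (P k).r false • (P k).cov (fun i => (P k).unitPsi ψ true i (θ₀ k)) +
    (P k).r true • (P k).cov (fun i => (P k).unitPsi ψ false i (θ₀ k))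

lemma dotProduct_gram_mulVec {n : ℕ} (g : Fin n → EuclideanSpace ℝ (Fin p)) (w : Fin p → ℝ) :
    w ⬝ᵥ (Matrix.of fun s t => ∑ i, g i s * g i t) *ᵥ w = ∑ i, ((g i).ofLp ⬝ᵥ w) ^ 2 := by
  simp only [dotProduct, Matrix.mulVec, Matrix.of_apply, pow_two, Finset.mul_sum, Finset.sum_mul]
  have : ∀ x x_1, ∑ i, w x * (g i x * g i x_1 * w x_1) =
      ∑ i, g i x_1 * w x_1 * (g i x * w x) := fun x x_1 =>
    Finset.sum_congr rfl fun i _ => by ring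
  simp only [this]
  rw [Finset.sum_congr rfl fun x _ => Finset.sum_comm, Finset.sum_comm]

lemma dotProduct_scoreCov_mulVec (k : ℕ) (w : Fin p → ℝ) :
    w ⬝ᵥ scoreCov P ψ θ₀ k *ᵥ w = (P k).r true * (P k).r false *
      (((P k).N : ℝ)⁻¹ * ∑ i, ((effectPsi P ψ θ₀ k i).ofLp ⬝ᵥ w) ^ 2) := by
  have : scoreCov P ψ θ₀ k = ((P k).r true * (P k).r false * ((P k).N : ℝ)⁻¹) •
      Matrix.of fun s t => ∑ i, effectPsi P ψ θ₀ k i s * effectPsi P ψ θ₀ k i t := by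
    ext s t
    simp [scoreCov, mul_assoc]
  rw [this, Matrix.smul_mulVec, dotProduct_smul, dotProduct_gram_mulVec, smul_eq_mul]
  ring

lemma dotProduct_cov_mulVec (k : ℕ) (z : Bool) (w : Fin p → ℝ) :
    w ⬝ᵥ (P k).cov (fun i => (P k).unitPsi ψ z i (θ₀ k)) *ᵥ w =
      (((P k).N : ℝ) - 1)⁻¹ * ∑ i, ((centeredPsi P ψ θ₀ z k i).ofLp ⬝ᵥ w) ^ 2 := by
  have : (P k).cov (fun i => (P k).unitPsi ψ z i (θ₀ k)) = (((P k).N : ℝ) - 1)⁻¹ •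
      Matrix.of fun s t => ∑ i, centeredPsi P ψ θ₀ z k i s * centeredPsi P ψ θ₀ z k i t := by
    ext s t
    simp [cov, centeredPsi, centered]
  rw [this, Matrix.smul_mulVec, dotProduct_smul, dotProduct_gram_mulVec, smul_eq_mul]

/-- The sandwich estimator is conservative: with the divisor `N` instead of `N - 1` in the
covariance matrices on the right, the difference of the two sides would be the variance of
`r₀ ψ₁ + r₁ ψ₀` in the direction `w`. -/
lemma dotProduct_scoreCov_le_meatCov {k : ℕ} (hN : 1 < (P k).N) (w : Fin p → ℝ) :
    w ⬝ᵥ scoreCov P ψ θ₀ k *ᵥ w ≤ w ⬝ᵥ meatCov P ψ θ₀ k *ᵥ w := by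
  have hN' : (1 : ℝ) < (P k).N := by exact_mod_cast hN
  have hr := r_add (Q := P k) (by omega)
  rw [dotProduct_scoreCov_mulVec, meatCov, Matrix.add_mulVec, Matrix.smul_mulVec,
    Matrix.smul_mulVec, dotProduct_add, dotProduct_smul, dotProduct_smul,
    dotProduct_cov_mulVec, dotProduct_cov_mulVec, smul_eq_mul, smul_eq_mul]
  set r₁ := (P k).r true
  set r₀ := (P k).r false
  have h1 : ((P k).N : ℝ)⁻¹ ≤ (((P k).N : ℝ) - 1)⁻¹ := inv_anti₀ (by linarith) (by linarith)
  have h2 : r₁ * r₀ * ∑ i, ((effectPsi P ψ θ₀ k i).ofLp ⬝ᵥ w) ^ 2 ≤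
      r₀ * ∑ i, ((centeredPsi P ψ θ₀ true k i).ofLp ⬝ᵥ w) ^ 2 +
      r₁ * ∑ i, ((centeredPsi P ψ θ₀ false k i).ofLp ⬝ᵥ w) ^ 2 := by
    rw [Finset.mul_sum, Finset.mul_sum, Finset.mul_sum, ← Finset.sum_add_distrib]
    refine Finset.sum_le_sum fun i _ => ?_
    rw [effectPsi, WithLp.ofLp_sub, sub_dotProduct]
    set x := (centeredPsi P ψ θ₀ true k i).ofLp ⬝ᵥ w
    set y := (centeredPsi P ψ θ₀ false k i).ofLp ⬝ᵥ w
    have h3 : r₁ = 1 - r₀ := by linarith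
    have h4 : r₀ * x ^ 2 + r₁ * y ^ 2 - r₁ * r₀ * (x - y) ^ 2 = (r₀ * x + r₁ * y) ^ 2 := by
      rw [h3]; ring
    nlinarith [sq_nonneg (r₀ * x + r₁ * y)]
  have h0 : 0 ≤ r₁ * r₀ * ∑ i, ((effectPsi P ψ θ₀ k i).ofLp ⬝ᵥ w) ^ 2 :=
    mul_nonneg (mul_nonneg (r_nonneg _ _) (r_nonneg _ _)) (Finset.sum_nonneg fun _ _ => sq_nonneg _)
  calc _ = ((P k).N : ℝ)⁻¹ * (r₁ * r₀ * ∑ i, ((effectPsi P ψ θ₀ k i).ofLp ⬝ᵥ w) ^ 2) := by ring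
    _ ≤ (((P k).N : ℝ) - 1)⁻¹ * (r₀ * ∑ i, ((centeredPsi P ψ θ₀ true k i).ofLp ⬝ᵥ w) ^ 2 +
      r₁ * ∑ i, ((centeredPsi P ψ θ₀ false k i).ofLp ⬝ᵥ w) ^ 2) :=
        mul_le_mul h1 h2 h0 (by simpa using hN'.le)
    _ = _ := by ring

/-- The empirical estimating equation at `θ₀` is a centred sample total. -/
lemma PsiHat_eq (hr : InteriorRoot P ψ Θ θ₀) (hb : Boundedness P ψ Θ θ₀) {k : ℕ}
    {Z : (P k).Assignment} (hZ : Z ∈ (P k).design) :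
    (P k).PsiHat ψ Z (θ₀ k) = ((P k).N : ℝ)⁻¹ • (P k).treatedSum (effectPsi P ψ θ₀ k) Z := by
  have hN : ((P k).N : ℝ) ≠ 0 := by exact_mod_cast (hb.N_pos k).ne'
  set m : Bool → EuclideanSpace ℝ (Fin p) :=
    fun z => (P k).mean fun i => (P k).unitPsi ψ z i (θ₀ k) with hm
  have hsum : ∀ z, ∑ i with Z i = z, (P k).unitPsi ψ z i (θ₀ k) =
      ∑ i with Z i = z, centeredPsi P ψ θ₀ z k i + ((P k).armSize z : ℝ) • m z := by
    intro z
    simp only [centeredPsi, centered, Finset.sum_sub_distrib, Finset.sum_const,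
      (P k).card_arm hZ, Nat.cast_smul_eq_nsmul, hm, sub_add_cancel]
  have h0 : ∑ i, centeredPsi P ψ θ₀ false k i = 0 := by
    ext s
    simpa [centeredPsi] using sum_centered_apply (P k) (fun i => (P k).unitPsi ψ false i (θ₀ k)) s
  have h1 : ∑ i with Z i = false, centeredPsi P ψ θ₀ false k i =
      - ∑ i with Z i = true, centeredPsi P ψ θ₀ false k i := by
    have := sum_treated_add_sum_control (centeredPsi P ψ θ₀ false k) Z
    rw [h0] at this
    exact eq_neg_of_add_eq_zero_right this
  have h2 : ((P k).armSize true : ℝ) • m true + ((P k).armSize false : ℝ) • m false = 0 := by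
    have := congrArg (fun x => ((P k).N : ℝ) • x) (hr.root k)
    simp only [Psi, r, smul_add, smul_smul, smul_zero, mul_div_cancel₀ _ hN] at this
    exact this
  have h3 : ∑ i, ψ (Z i) ((P k).observed Z i) ((P k).X i) (θ₀ k) =
      ∑ i with Z i = true, (P k).unitPsi ψ true i (θ₀ k) +
      ∑ i with Z i = false, (P k).unitPsi ψ false i (θ₀ k) := by
    rw [← sum_treated_add_sum_control _ Z]
    congr 1
    · refine Finset.sum_congr rfl fun i hi => ?_
      have : Z i = true := by simpa using hi
      simp [unitPsi, observed, this]
    · refine Finset.sum_congr rfl fun i hi => ?_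
      have : Z i = false := by simpa using hi
      simp [unitPsi, observed, this]
  rw [PsiHat, mean, h3, hsum, hsum, h1, add_add_add_comm, h2, add_zero, ← sub_eq_add_neg,
    treatedSum, ← Finset.sum_sub_distrib]
  rfl

lemma inv_mul_sum_effectPsi_sq_le {c₀ : ℝ} {k : ℕ} (hN : 1 < (P k).N) {s : Fin p}
    (hc : ∀ z, |(P k).cov (fun i => (P k).unitPsi ψ z i (θ₀ k)) s s| ≤ c₀) :
    ((P k).N : ℝ)⁻¹ * ∑ i, effectPsi P ψ θ₀ k i s ^ 2 ≤ 4 * c₀ := by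
  have h1 := inv_mul_sum_centeredPsi_sq_le hN (hc true)
  have h2 := inv_mul_sum_centeredPsi_sq_le hN (hc false)
  calc _ ≤ ((P k).N : ℝ)⁻¹ * ∑ i, (2 * centeredPsi P ψ θ₀ true k i s ^ 2 +
        2 * centeredPsi P ψ θ₀ false k i s ^ 2) := by
        refine mul_le_mul_of_nonneg_left (Finset.sum_le_sum fun i _ => ?_) (by positivity)
        rw [effectPsi, PiLp.sub_apply]
        nlinarith [sq_nonneg (centeredPsi P ψ θ₀ true k i s + centeredPsi P ψ θ₀ false k i s)]
    _ = 2 * (((P k).N : ℝ)⁻¹ * ∑ i, centeredPsi P ψ θ₀ true k i s ^ 2) +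
        2 * (((P k).N : ℝ)⁻¹ * ∑ i, centeredPsi P ψ θ₀ false k i s ^ 2) := by
        rw [Finset.sum_add_distrib, ← Finset.mul_sum, ← Finset.mul_sum]; ring
    _ ≤ _ := by linarith

/-- The characteristic function of the scaled estimating equation at `θ₀` is asymptotically that
of a centred Gaussian vector with covariance matrix `scoreCov`. -/
lemma tendsto_charFun_law_sub (hN : Tendsto (fun k => (P k).N) atTop atTop)
    (hr : InteriorRoot P ψ Θ θ₀) (hb : Boundedness P ψ Θ θ₀) (w : EuclideanSpace ℝ (Fin p)) :
    Tendsto (fun k => charFun ((P k).law fun Z => √((P k).N) • (P k).PsiHat ψ Z (θ₀ k)) w -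
      Real.exp (-(w.ofLp ⬝ᵥ scoreCov P ψ θ₀ k *ᵥ w.ofLp / 2))) atTop (𝓝 0) := by
  obtain ⟨c₀, hc₀, hcov⟩ := hb.exists_abs_cov_le
  obtain ⟨κ, hκ, hκ0, hκ'⟩ := exists_norm_centeredPsi_le hb
  set K : ℝ := (p * (4 * c₀)) * ‖w‖ ^ 2 with hK
  have hNr : Tendsto (fun k => ((P k).N : ℝ)⁻¹) atTop (𝓝 0) :=
    tendsto_inv_atTop_zero.comp (tendsto_natCast_atTop_atTop.comp hN)
  have hlim : Tendsto (fun k => 4 * (2 * κ k * ‖w‖) * K + (2 * κ k * ‖w‖) * √K + K / (P k).N)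
      atTop (𝓝 0) := by
    have h1 : Tendsto (fun k => 2 * κ k * ‖w‖) atTop (𝓝 0) := by
      simpa using (hκ.const_mul 2).mul_const ‖w‖
    simpa [div_eq_mul_inv] using
      (((h1.const_mul 4).mul_const K).add (h1.mul_const √K)).add (hNr.const_mul K)
  refine squeeze_zero_norm' ?_ hlim
  filter_upwards [eventually_one_lt_N hN] with k hk
  have hNk : (0 : ℝ) < (P k).N := by exact_mod_cast hb.N_pos k
  set a : Fin (P k).N → ℝ := fun i => (effectPsi P ψ θ₀ k i).ofLp ⬝ᵥ w.ofLp with ha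
  have hinner : ∀ x : EuclideanSpace ℝ (Fin p), inner ℝ x w = x.ofLp ⬝ᵥ w.ofLp := by
    intro x
    rw [EuclideanSpace.inner_eq_star_dotProduct, star_trivial, dotProduct_comm]
  have ha0 : ∑ i, a i = 0 := by
    have h1 : ∑ i, effectPsi P ψ θ₀ k i = 0 := by
      ext s
      have h2 := sum_centered_apply (P k) (fun i => (P k).unitPsi ψ true i (θ₀ k)) s
      have h3 := sum_centered_apply (P k) (fun i => (P k).unitPsi ψ false i (θ₀ k)) s
      simp only [WithLp.ofLp_sum, Finset.sum_apply, effectPsi, PiLp.sub_apply,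
        Finset.sum_sub_distrib, centeredPsi, h2, h3]
      simp
    simp only [ha, ← hinner]
    rw [← sum_inner, h1, inner_zero_left]
  have hag : ∀ i, |a i| ≤ ‖effectPsi P ψ θ₀ k i‖ * ‖w‖ := fun i => by
    simp only [ha, ← hinner]
    exact abs_real_inner_le_norm _ _
  have hκa : ∀ i, |a i| ≤ (2 * κ k * ‖w‖) * √((P k).N) := by
    intro i
    refine (hag i).trans ?_
    have h1 : ‖effectPsi P ψ θ₀ k i‖ ≤ 2 * κ k * √((P k).N) := by
      refine (norm_sub_le _ _).trans ?_
      linarith [hκ' k true i, hκ' k false i]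
    calc _ ≤ 2 * κ k * √((P k).N) * ‖w‖ := by gcongr
      _ = _ := by ring
  have hKa : ∑ i, a i ^ 2 ≤ K * (P k).N := by
    rw [← inv_mul_le_iff₀' hNk]
    calc _ ≤ ((P k).N : ℝ)⁻¹ * ∑ i, (∑ s, effectPsi P ψ θ₀ k i s ^ 2) * ‖w‖ ^ 2 := by
          refine mul_le_mul_of_nonneg_left (Finset.sum_le_sum fun i _ => ?_) (by positivity)
          rw [← EuclideanSpace.real_norm_sq_eq, ← mul_pow]
          exact sq_le_sq' (abs_le.1 (hag i)).1 (abs_le.1 (hag i)).2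
      _ = (∑ s, ((P k).N : ℝ)⁻¹ * ∑ i, effectPsi P ψ θ₀ k i s ^ 2) * ‖w‖ ^ 2 := by
          rw [← Finset.sum_mul, Finset.sum_comm, ← Finset.mul_sum, mul_assoc]
      _ ≤ (∑ s : Fin p, 4 * c₀) * ‖w‖ ^ 2 := by
          refine mul_le_mul_of_nonneg_right (Finset.sum_le_sum fun s _ => ?_) (sq_nonneg _)
          exact inv_mul_sum_effectPsi_sq_le hk fun z => hcov k z s s
      _ = K := by simp [hK]
  have h := norm_expect_exp_treatedSum_sub_le (hb.N_pos k) ha0 hκa hKa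
  refine le_trans (le_of_eq ?_) h
  rw [charFun_law, dotProduct_scoreCov_mulVec]
  congr 2
  · refine (P k).expect_congr fun Z hZ => ?_
    have hs : √((P k).N : ℝ) * ((P k).N : ℝ)⁻¹ = (√((P k).N : ℝ))⁻¹ := by
      rw [← div_eq_mul_inv, Real.sqrt_div_self', one_div]
    rw [PsiHat_eq hr hb hZ, smul_smul, hs, real_inner_smul_left, treatedSum, sum_inner]
    simp only [hinner, treatedSum, ha]
    congr 1
    push_cast
    ring
  · congr 3
    ring

/-- The centred Gaussian measure with covariance matrix `V`, as a bundled probability measure. -/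
def centredGaussian (V : Matrix (Fin p) (Fin p) ℝ) :
    ProbabilityMeasure (EuclideanSpace ℝ (Fin p)) := ⟨multivariateGaussian 0 V, inferInstance⟩

/-- Along a subsequence of populations along which the covariance matrices converge, the scaled
estimating equation at `θ₀` converges in distribution to a Gaussian vector. -/
lemma tendsto_law (hN : Tendsto (fun k => (P k).N) atTop atTop)
    (hr : InteriorRoot P ψ Θ θ₀) (hb : Boundedness P ψ Θ θ₀) {ι : ℕ → ℕ}
    (hι : Tendsto ι atTop atTop) {V : Matrix (Fin p) (Fin p) ℝ} (hV : V.PosSemidef)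
    (hlim : Tendsto (fun j => scoreCov P ψ θ₀ (ι j)) atTop (𝓝 V)) :
    Tendsto (fun j => (P (ι j)).probLaw fun Z => √((P (ι j)).N) • (P (ι j)).PsiHat ψ Z (θ₀ (ι j)))
      atTop (𝓝 (centredGaussian V)) := by
  rw [ProbabilityMeasure.tendsto_iff_tendsto_charFun]
  intro w
  have h1 := (tendsto_charFun_law_sub hN hr hb w).comp hι
  have h2 : Tendsto (fun j => (Real.exp (-(w.ofLp ⬝ᵥ scoreCov P ψ θ₀ (ι j) *ᵥ w.ofLp / 2)) : ℂ))
      atTop (𝓝 (Real.exp (-(w.ofLp ⬝ᵥ V *ᵥ w.ofLp / 2)) : ℂ)) := by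
    have hcont : Continuous fun A : Matrix (Fin p) (Fin p) ℝ =>
        (Real.exp (-(w.ofLp ⬝ᵥ A *ᵥ w.ofLp / 2)) : ℂ) := by fun_prop
    exact (hcont.tendsto V).comp hlim
  have h3 := h1.add h2
  rw [zero_add] at h3
  change Tendsto (fun j => charFun ((P (ι j)).law _) w) atTop
    (𝓝 (charFun (multivariateGaussian 0 V) w))
  rw [charFun_multivariateGaussian hV]
  convert h3 using 2
  · simp
  · simp

end CentralLimit

/-! ### Asymptotic coverage of the Wald set -/

section Matrices

/-- If the covariance matrix `V` of a Gaussian vector `u` is at most `B`, then the Wald statistic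
of `R u` standardized with `B` is stochastically dominated by a chi-squared variable. -/
lemma le_multivariateGaussian_wald {p m : ℕ} (hm : 0 < m) {V B : Matrix (Fin p) (Fin p) ℝ}
    (hV : V.PosSemidef) (hVB : ∀ w : Fin p → ℝ, w ⬝ᵥ V *ᵥ w ≤ w ⬝ᵥ B *ᵥ w)
    {R : Matrix (Fin m) (Fin p) ℝ} (hS : (R * B * Rᵀ).PosDef) {q : ℝ} (hq : q < 1) :
    ENNReal.ofReal q ≤ multivariateGaussian 0 V
      {u | (R *ᵥ u.ofLp) ⬝ᵥ ((R * B * Rᵀ)⁻¹ *ᵥ (R *ᵥ u.ofLp)) < quantile (chiSquared m) q} := by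
  set S := R * B * Rᵀ with hSdef
  -- a square root of the inverse: `Lᵀ L = S⁻¹`, hence `L S Lᵀ = 1`
  obtain ⟨L, hL⟩ : ∃ L : Matrix (Fin m) (Fin m) ℝ, S⁻¹ = Lᵀ * L := by
    open scoped MatrixOrder in
    obtain ⟨L, hL⟩ := CStarAlgebra.nonneg_iff_eq_star_mul_self.mp hS.inv.posSemidef.nonneg
    exact ⟨L, by simpa [Matrix.star_eq_conjTranspose] using hL⟩
  have hSu : IsUnit S.det := (Matrix.isUnit_iff_isUnit_det S).1 hS.isUnit
  have hLS : L * S * Lᵀ = 1 := by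
    have h1 : Lᵀ * (L * S) = 1 := by
      rw [← Matrix.mul_assoc, ← hL, Matrix.nonsing_inv_mul _ hSu]
    exact mul_eq_one_comm.1 h1
  have hmap := multivariateGaussian_map_mulVec hV (L * R)
  have hH : (L * R * V * (L * R)ᵀ).PosSemidef := by
    simpa using hV.mul_mul_conjTranspose_same (L * R)
  have hH1 : ∀ x : Fin m → ℝ, x ⬝ᵥ (L * R * V * (L * R)ᵀ) *ᵥ x ≤ x ⬝ᵥ x := by
    intro x
    have key : ∀ A : Matrix (Fin p) (Fin p) ℝ, x ⬝ᵥ (L * R * A * (L * R)ᵀ) *ᵥ x =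
        ((L * R)ᵀ *ᵥ x) ⬝ᵥ A *ᵥ ((L * R)ᵀ *ᵥ x) := by
      intro A
      rw [Matrix.mulVec_transpose, ← Matrix.dotProduct_mulVec, Matrix.mulVec_mulVec,
        ← Matrix.mulVec_transpose, Matrix.mulVec_mulVec, Matrix.mul_assoc (L * R)]
    have h1 : L * R * B * (L * R)ᵀ = 1 := by
      rw [← hLS, hSdef, Matrix.transpose_mul]
      simp only [Matrix.mul_assoc]
    calc _ ≤ x ⬝ᵥ (L * R * B * (L * R)ᵀ) *ᵥ x := by rw [key, key]; exact hVB _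
      _ = x ⬝ᵥ x := by rw [h1, Matrix.one_mulVec]
  refine (le_stdGaussian_norm_sq_lt_quantile hm hq).trans
    ((stdGaussian_le_multivariateGaussian hH hH1 _).trans ?_)
  rw [← hmap, Measure.map_apply (by fun_prop)
    (measurableSet_lt measurable_norm_sq measurable_const)]
  refine measure_mono fun u hu => ?_
  simp only [Set.mem_preimage, Set.mem_ofPred_eq] at hu ⊢
  refine lt_of_le_of_lt (le_of_eq ?_) hu
  rw [EuclideanSpace.real_norm_sq_eq, hL, ← Matrix.mulVec_mulVec, Matrix.dotProduct_mulVec,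
    Matrix.vecMul_transpose, Matrix.mulVec_mulVec]
  simp [dotProduct, pow_two]

lemma continuousAt_inv_matrix {n : ℕ} {A : Matrix (Fin n) (Fin n) ℝ} (hA : IsUnit A) :
    ContinuousAt (fun B : Matrix (Fin n) (Fin n) ℝ => B⁻¹) A := by
  refine continuousAt_matrix_inv A ?_
  have h := ((Matrix.isUnit_iff_isUnit_det A).1 hA).ne_zero
  rw [Ring.inverse_eq_inv']
  exact continuousAt_inv₀ h

lemma isOpen_isUnit_matrix {n : ℕ} : IsOpen {A : Matrix (Fin n) (Fin n) ℝ | IsUnit A} := by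
  simp only [Matrix.isUnit_iff_isUnit_det, isUnit_iff_ne_zero]
  exact isOpen_ne_fun (by fun_prop) continuous_const

lemma posSemidef_of_tendsto {n : ℕ} {u : ℕ → Matrix (Fin n) (Fin n) ℝ}
    {A : Matrix (Fin n) (Fin n) ℝ} (hu : ∀ᶠ k in atTop, (u k).PosSemidef)
    (hA : Tendsto u atTop (𝓝 A)) : A.PosSemidef := by
  refine Matrix.PosSemidef.of_dotProduct_mulVec_nonneg ?_ fun x => ?_
  · have h1 : Tendsto (fun k => (u k)ᴴ) atTop (𝓝 Aᴴ) :=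
      ((continuous_id.matrix_conjTranspose).tendsto A).comp hA
    exact tendsto_nhds_unique (h1.congr' (hu.mono fun k hk => hk.1)) hA
  · have hcont : Continuous fun B : Matrix (Fin n) (Fin n) ℝ => star x ⬝ᵥ B *ᵥ x := by fun_prop
    exact ge_of_tendsto ((hcont.tendsto A).comp hA)
      (hu.mono fun k hk => hk.dotProduct_mulVec_nonneg x)

/-- The sandwich product `J⁻¹ B J⁻ᵀ`. -/
def sandwich {p : ℕ} (J B : Matrix (Fin p) (Fin p) ℝ) : Matrix (Fin p) (Fin p) ℝ :=
  J⁻¹ * B * (Jᵀ)⁻¹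

lemma continuousAt_sandwich {p : ℕ} {J B : Matrix (Fin p) (Fin p) ℝ} (hJ : IsUnit J) :
    ContinuousAt (fun x : Matrix (Fin p) (Fin p) ℝ × Matrix (Fin p) (Fin p) ℝ =>
      sandwich x.1 x.2) (J, B) := by
  have h1 : ContinuousAt (fun x : Matrix (Fin p) (Fin p) ℝ × Matrix (Fin p) (Fin p) ℝ => x.1⁻¹)
      (J, B) := (continuousAt_inv_matrix hJ).comp continuousAt_fst
  have h2 : ContinuousAt (fun x : Matrix (Fin p) (Fin p) ℝ × Matrix (Fin p) (Fin p) ℝ => x.1⁻¹ᵀ)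
      (J, B) := (continuous_id.matrix_transpose.tendsto _).comp h1
  simp only [sandwich, ← Matrix.transpose_nonsing_inv]
  exact (h1.mul continuousAt_snd).mul h2

lemma mulVec_injective_of_rank {p m : ℕ} {v : Matrix (Fin p) (Fin m) ℝ} (hv : v.rank = m) :
    Function.Injective v.mulVec := by
  rw [Matrix.rank] at hv
  have h := v.mulVecLin.finrank_range_add_finrank_ker
  rw [hv, Module.finrank_fin_fun, Nat.add_eq_left, Submodule.finrank_eq_zero] at h
  exact LinearMap.ker_eq_bot.1 h

end Matrices

section Limit

open FinitePopulation

variable {𝒴 𝒳 : Type*} {p : ℕ} {P : ℕ → FinitePopulation 𝒴 𝒳} {ψ : EstimatingFunction 𝒴 𝒳 p}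
  {Θ : Set (EuclideanSpace ℝ (Fin p))} {θ₀ : ℕ → EuclideanSpace ℝ (Fin p)}
  {θHat : (k : ℕ) → (P k).Assignment → EuclideanSpace ℝ (Fin p)}

/-- The middle factor of the sandwich estimator. -/
def meatHat (P : ℕ → FinitePopulation 𝒴 𝒳) (ψ : EstimatingFunction 𝒴 𝒳 p)
    (θHat : (k : ℕ) → (P k).Assignment → EuclideanSpace ℝ (Fin p))
    (ω : Σ k, (P k).Assignment) : Matrix (Fin p) (Fin p) ℝ :=
  (P ω.1).r false •
      (P ω.1).sampleCov ω.2 true (fun i => (P ω.1).unitPsi ψ true i (θHat ω.1 ω.2)) +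
    (P ω.1).r true •
      (P ω.1).sampleCov ω.2 false (fun i => (P ω.1).unitPsi ψ false i (θHat ω.1 ω.2))

lemma FinitePopulation.r_le_one (Q : FinitePopulation 𝒴 𝒳) (z : Bool) : Q.r z ≤ 1 := by
  rw [r]
  exact div_le_one_of_le₀ (by exact_mod_cast Q.armSize_le z) (by positivity)

lemma tendsto_meatHat_sub (hN : Tendsto (fun k => (P k).N) atTop atTop)
    (hs : Smoothness P ψ Θ θ₀) (hb : Boundedness P ψ Θ θ₀) (hc : Consistency P ψ Θ θ₀ θHat) :
    Tendsto (fun ω => meatHat P ψ θHat ω - meatCov P ψ θ₀ ω.1) (whp P atTop) (𝓝 0) := by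
  have h := fun z => tendsto_sampleCov_sub hN hs hb hc z
  refine tendsto_pi_nhds.2 fun s => tendsto_pi_nhds.2 fun t => ?_
  have hst := fun z => tendsto_pi_nhds.1 (tendsto_pi_nhds.1 (h z) s) t
  have hr : ∀ z, ∀ᶠ ω in whp P atTop, |(P ω.1).r z| ≤ 1 := fun z => .of_forall fun ω => by
    rw [abs_of_nonneg (r_nonneg _ _)]; exact r_le_one _ _
  have h1 := (bdd_le_mul_tendsto_zero' 1 (hr false) (hst true)).add
    (bdd_le_mul_tendsto_zero' 1 (hr true) (hst false))
  refine Tendsto.congr (fun ω => ?_) (h1.trans (le_of_eq (congrArg 𝓝 (add_zero (0 : ℝ)))))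
  simp [meatHat, meatCov]
  ring

lemma sigmaTilde_eq_sandwich (hb : Boundedness P ψ Θ θ₀) (k : ℕ) :
    (P k).sigmaTilde ψ Θ (θ₀ k) =
      sandwich (jacobianMatrix ((P k).PsiDeriv ψ Θ (θ₀ k))) (meatCov P ψ θ₀ k) := by
  obtain ⟨c, hc, h⟩ := hb.proportions
  have h1 : (P k).r true ≠ 0 := (hc.trans_le (h k true).1).ne'
  have h0 : (P k).r false ≠ 0 := (hc.trans_le (h k false).1).ne'
  rw [sigmaTilde, sandwich, meatCov, ← Matrix.smul_mul, ← Matrix.mul_smul, smul_add, smul_smul,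
    smul_smul, mul_inv_cancel_right₀ h0, mul_comm ((P k).r true), mul_inv_cancel_right₀ h1]

lemma posSemidef_cov (k : ℕ) (z : Bool) :
    ((P k).cov fun i => (P k).unitPsi ψ z i (θ₀ k)).PosSemidef := by
  refine Matrix.PosSemidef.of_dotProduct_mulVec_nonneg ?_ fun x => ?_
  · ext s t
    simp [cov, mul_comm]
  · rw [star_trivial, dotProduct_cov_mulVec]
    rcases Nat.eq_zero_or_pos (P k).N with h | h
    · have : IsEmpty (Fin (P k).N) := by rw [h]; infer_instance
      simp
    · have : (1 : ℝ) ≤ (P k).N := by exact_mod_cast h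
      exact mul_nonneg (inv_nonneg.2 (by linarith)) (Finset.sum_nonneg fun _ _ => sq_nonneg _)

lemma posSemidef_meatCov (k : ℕ) : (meatCov P ψ θ₀ k).PosSemidef :=
  ((posSemidef_cov k true).smul (r_nonneg _ _)).add ((posSemidef_cov k false).smul (r_nonneg _ _))

lemma posSemidef_scoreCov (k : ℕ) : (scoreCov P ψ θ₀ k).PosSemidef := by
  refine Matrix.PosSemidef.of_dotProduct_mulVec_nonneg ?_ fun x => ?_
  · ext s t
    simp [scoreCov, mul_comm]
  · rw [star_trivial, dotProduct_scoreCov_mulVec]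
    exact mul_nonneg (mul_nonneg (r_nonneg _ _) (r_nonneg _ _))
      (mul_nonneg (by positivity) (Finset.sum_nonneg fun _ _ => sq_nonneg _))

lemma abs_scoreCov_le {c₀ : ℝ} {k : ℕ} (hN : 1 < (P k).N)
    (hc : ∀ z s t, |(P k).cov (fun i => (P k).unitPsi ψ z i (θ₀ k)) s t| ≤ c₀) (s t : Fin p) :
    |scoreCov P ψ θ₀ k s t| ≤ 4 * c₀ := by
  have h0 : 0 ≤ c₀ := (abs_nonneg _).trans (hc true s s)
  have key := abs_inv_mul_sum_filter_le (fun _ => True) (fun i => effectPsi P ψ θ₀ k i s)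
    (fun i => effectPsi P ψ θ₀ k i t)
  simp only [Finset.filter_true] at key
  have h1 := inv_mul_sum_effectPsi_sq_le hN (s := s) fun z => hc z s s
  have h2 := inv_mul_sum_effectPsi_sq_le hN (s := t) fun z => hc z t t
  have h3 : |((P k).N : ℝ)⁻¹ * ∑ i, effectPsi P ψ θ₀ k i s * effectPsi P ψ θ₀ k i t| ≤ 4 * c₀ := by
    refine key.trans ?_
    rw [← Real.mul_self_sqrt (by positivity : 0 ≤ 4 * c₀)]
    exact mul_le_mul (Real.sqrt_le_sqrt h1) (Real.sqrt_le_sqrt h2) (Real.sqrt_nonneg _)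
      (Real.sqrt_nonneg _)
  rw [scoreCov, Matrix.of_apply, abs_mul,
    abs_of_nonneg (mul_nonneg (r_nonneg _ _) (r_nonneg _ _))]
  calc _ ≤ 1 * 1 * (4 * c₀) := by
        gcongr
        · exact r_nonneg _ _
        · exact r_le_one _ _
        · exact r_le_one _ _
    _ = _ := by ring

lemma abs_meatCov_le {c₀ : ℝ} {k : ℕ} (hN : 0 < (P k).N)
    (hc : ∀ z s t, |(P k).cov (fun i => (P k).unitPsi ψ z i (θ₀ k)) s t| ≤ c₀) (s t : Fin p) :
    |meatCov P ψ θ₀ k s t| ≤ c₀ := by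
  simp only [meatCov, Matrix.add_apply, Matrix.smul_apply, smul_eq_mul]
  refine (abs_add_le _ _).trans ?_
  rw [abs_mul, abs_mul, abs_of_nonneg (r_nonneg _ _), abs_of_nonneg (r_nonneg _ _)]
  calc _ ≤ (P k).r false * c₀ + (P k).r true * c₀ := by
        gcongr
        · exact r_nonneg _ _
        · exact hc _ _ _
        · exact r_nonneg _ _
        · exact hc _ _ _
    _ = c₀ := by rw [← add_mul, add_comm, r_add hN, one_mul]

/-- Every sequence of populations has a subsequence along which the deterministic matrices
converge. -/
lemma exists_subseq_tendsto (hN : Tendsto (fun k => (P k).N) atTop atTop)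
    (hb : Boundedness P ψ Θ θ₀) {ι : ℕ → ℕ} (hι : Tendsto ι atTop atTop) :
    ∃ φ : ℕ → ℕ, StrictMono φ ∧ ∃ J B V : Matrix (Fin p) (Fin p) ℝ,
      Tendsto (fun j => jacobianMatrix ((P (ι (φ j))).PsiDeriv ψ Θ (θ₀ (ι (φ j))))) atTop (𝓝 J) ∧
      Tendsto (fun j => meatCov P ψ θ₀ (ι (φ j))) atTop (𝓝 B) ∧
      Tendsto (fun j => scoreCov P ψ θ₀ (ι (φ j))) atTop (𝓝 V) := by
  obtain ⟨c₀, hc₀, hcov⟩ := hb.exists_abs_cov_le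
  obtain ⟨c₁, hc₁, c₂, hc₂, hJ⟩ := hb.deriv_bounds
  set C := max c₂ (4 * c₀) with hC
  have hC0 : 0 ≤ C := le_max_of_le_right (by positivity)
  let K : Set (Fin p → Fin p → ℝ) := Metric.closedBall 0 C
  have hK : IsCompact K := isCompact_closedBall _ _
  have hmem : ∀ A : Matrix (Fin p) (Fin p) ℝ, (∀ s t, |A s t| ≤ C) → 
      (fun s t => A s t) ∈ K := by
    intro A hA
    rw [mem_closedBall_zero_iff]
    exact (pi_norm_le_iff_of_nonneg hC0).2 fun s => (pi_norm_le_iff_of_nonneg hC0).2 fun t => hA s t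
  let x : ℕ → (Fin p → Fin p → ℝ) × (Fin p → Fin p → ℝ) × (Fin p → Fin p → ℝ) := fun j =>
    (fun s t => jacobianMatrix ((P (ι j)).PsiDeriv ψ Θ (θ₀ (ι j))) s t,
      fun s t => meatCov P ψ θ₀ (ι j) s t, fun s t => scoreCov P ψ θ₀ (ι j) s t)
  have hx : ∀ᶠ j in atTop, x j ∈ K ×ˢ K ×ˢ K := by
    filter_upwards [hι.eventually (eventually_one_lt_N hN)] with j hj
    refine ⟨hmem _ fun s t => ?_, hmem _ fun s t => ?_, hmem _ fun s t => ?_⟩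
    · exact (abs_apply_le_sigmaMax _ s t).trans ((hJ _).2.trans (le_max_left _ _))
    · refine (abs_meatCov_le (by omega) (hcov (ι j)) s t).trans (le_max_of_le_right ?_)
      linarith
    · exact (abs_scoreCov_le hj (hcov (ι j)) s t).trans (le_max_right _ _)
  obtain ⟨⟨J, B, V⟩, -, φ, hφ, hlim⟩ := (hK.prod (hK.prod hK)).tendsto_subseq' hx.frequently
  rw [nhds_prod_eq, nhds_prod_eq] at hlim
  exact ⟨φ, hφ, J, B, V, (tendsto_prod_iff'.1 hlim).1,
    (tendsto_prod_iff'.1 (tendsto_prod_iff'.1 hlim).2).1,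
    (tendsto_prod_iff'.1 (tendsto_prod_iff'.1 hlim).2).2⟩

lemma tendsto_whp_of_sub {E : Type*} [AddCommGroup E] [TopologicalSpace E] [IsTopologicalAddGroup E]
    {ι : ℕ → ℕ} (hι : Tendsto ι atTop atTop) {X : (Σ k, (P k).Assignment) → E} {a : ℕ → E} {b : E}
    (hX : Tendsto (fun ω => X ω - a ω.1) (whp P atTop) (𝓝 0))
    (ha : Tendsto (fun j => a (ι j)) atTop (𝓝 b)) : Tendsto X (whp P (map ι atTop)) (𝓝 b) := by
  have h1 := (hX.mono_left (whp_mono hι)).add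
    ((tendsto_map'_iff.2 ha).comp (tendsto_fst_whp (P := P)))
  rw [zero_add] at h1
  refine h1.congr fun ω => ?_
  simp

end Limit

section Coverage

open FinitePopulation

variable {𝒴 𝒳 : Type*} {p : ℕ} {P : ℕ → FinitePopulation 𝒴 𝒳} {ψ : EstimatingFunction 𝒴 𝒳 p}
  {Θ : Set (EuclideanSpace ℝ (Fin p))} {θ₀ : ℕ → EuclideanSpace ℝ (Fin p)}
  {θHat : (k : ℕ) → (P k).Assignment → EuclideanSpace ℝ (Fin p)}

/-- The limits of the derivative and of the sandwich matrix are nondegenerate. -/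
lemma isUnit_and_posDef_of_tendsto (hb : Boundedness P ψ Θ θ₀)
    (hσ : ∃ c > 0, ∀ k, c ≤ sigmaMin ((P k).sigmaTilde ψ Θ (θ₀ k)))
    {m : ℕ} {v : Matrix (Fin p) (Fin m) ℝ} (hv : v.rank = m) {ι : ℕ → ℕ}
    {J B : Matrix (Fin p) (Fin p) ℝ}
    (hJ : Tendsto (fun j => jacobianMatrix ((P (ι j)).PsiDeriv ψ Θ (θ₀ (ι j)))) atTop (𝓝 J))
    (hB : Tendsto (fun j => meatCov P ψ θ₀ (ι j)) atTop (𝓝 B)) :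
    IsUnit J ∧ (vᵀ * sandwich J B * v).PosDef := by
  obtain ⟨c₁, hc₁, c₂, hc₂, hJb⟩ := hb.deriv_bounds
  obtain ⟨c, hc, hσ⟩ := hσ
  have hJu : IsUnit J := isUnit_of_tendsto_of_le_sigmaMin J hc₁ (fun j => (hJb (ι j)).1) hJ
  have hlim : Tendsto (fun j => (P (ι j)).sigmaTilde ψ Θ (θ₀ (ι j))) atTop
      (𝓝 (sandwich J B)) := by
    have h := (continuousAt_sandwich (B := B) hJu).tendsto.comp (hJ.prodMk_nhds hB)
    exact h.congr fun j => (sigmaTilde_eq_sandwich hb (ι j)).symm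
  have hSu : IsUnit (sandwich J B) :=
    isUnit_of_tendsto_of_le_sigmaMin _ hc (fun j => hσ (ι j)) hlim
  have hBp : B.PosSemidef := posSemidef_of_tendsto (.of_forall fun j => posSemidef_meatCov _) hB
  have hSp : (sandwich J B).PosSemidef := by
    have := hBp.mul_mul_conjTranspose_same J⁻¹
    rw [Matrix.conjTranspose_eq_transpose_of_trivial, Matrix.transpose_nonsing_inv] at this
    exact this
  refine ⟨hJu, ?_⟩
  have := (hSp.posDef_iff_isUnit.2 hSu).conjTranspose_mul_mul_same (mulVec_injective_of_rank hv)
  rwa [Matrix.conjTranspose_eq_transpose_of_trivial] at this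

lemma tendsto_PsiHatDeriv_meatHat (hN : Tendsto (fun k => (P k).N) atTop atTop)
    (hr : InteriorRoot P ψ Θ θ₀) (hs : Smoothness P ψ Θ θ₀)
    (hb : Boundedness P ψ Θ θ₀) (hc : Consistency P ψ Θ θ₀ θHat) {ι : ℕ → ℕ}
    (hι : Tendsto ι atTop atTop) {J B : Matrix (Fin p) (Fin p) ℝ}
    (hJ : Tendsto (fun j => jacobianMatrix ((P (ι j)).PsiDeriv ψ Θ (θ₀ (ι j)))) atTop (𝓝 J))
    (hB : Tendsto (fun j => meatCov P ψ θ₀ (ι j)) atTop (𝓝 B)) :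
    Tendsto (fun ω : Σ k, (P k).Assignment =>
      (jacobianMatrix ((P ω.1).PsiHatDeriv ψ Θ ω.2 (θHat ω.1 ω.2)), meatHat P ψ θHat ω))
      (whp P (map ι atTop)) (𝓝 (J, B)) :=
  (tendsto_whp_of_sub hι (a := fun k => jacobianMatrix ((P k).PsiDeriv ψ Θ (θ₀ k)))
    (tendsto_jacobianMatrix_sub (tendsto_PsiHatDeriv_sub hr hs hb hc)) hJ).prodMk_nhds
    (tendsto_whp_of_sub hι (a := meatCov P ψ θ₀) (tendsto_meatHat_sub hN hs hb hc) hB)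

lemma eventually_isUnit (hN : Tendsto (fun k => (P k).N) atTop atTop)
    (hr : InteriorRoot P ψ Θ θ₀) (hs : Smoothness P ψ Θ θ₀)
    (hb : Boundedness P ψ Θ θ₀) (hc : Consistency P ψ Θ θ₀ θHat)
    (hσ : ∃ c > 0, ∀ k, c ≤ sigmaMin ((P k).sigmaTilde ψ Θ (θ₀ k)))
    {m : ℕ} {v : Matrix (Fin p) (Fin m) ℝ} (hv : v.rank = m) {ι : ℕ → ℕ}
    (hι : Tendsto ι atTop atTop) {J B : Matrix (Fin p) (Fin p) ℝ}
    (hJ : Tendsto (fun j => jacobianMatrix ((P (ι j)).PsiDeriv ψ Θ (θ₀ (ι j)))) atTop (𝓝 J))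
    (hB : Tendsto (fun j => meatCov P ψ θ₀ (ι j)) atTop (𝓝 B)) :
    ∀ᶠ ω in whp P (map ι atTop),
      IsUnit (jacobianMatrix ((P ω.1).PsiHatDeriv ψ Θ ω.2 (θHat ω.1 ω.2))) ∧
        IsUnit (vᵀ * (P ω.1).sigmaHat ψ Θ ω.2 (θHat ω.1 ω.2) * v) := by
  obtain ⟨hJu, hS⟩ := isUnit_and_posDef_of_tendsto hb hσ hv hJ hB
  have hlim := tendsto_PsiHatDeriv_meatHat hN hr hs hb hc hι hJ hB
  have hcont : ContinuousAt (fun x : Matrix (Fin p) (Fin p) ℝ × Matrix (Fin p) (Fin p) ℝ =>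
      vᵀ * sandwich x.1 x.2 * v) (J, B) :=
    ContinuousAt.comp (g := fun M => vᵀ * M * v)
      (Continuous.continuousAt (by fun_prop)) (continuousAt_sandwich hJu)
  have h1 := (continuousAt_fst.tendsto.comp hlim).eventually
    (isOpen_isUnit_matrix.mem_nhds (show IsUnit J from hJu))
  have h2 := (hcont.tendsto.comp hlim).eventually (isOpen_isUnit_matrix.mem_nhds hS.isUnit)
  exact h1.and h2

/-- The Wald statistic as a function of the scaled score `u`, of the slope `D` of the linear
equation for the estimation error, and of the two factors of the sandwich estimator. -/
def waldStat {p m : ℕ} (v : Matrix (Fin p) (Fin m) ℝ)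
    (z : EuclideanSpace ℝ (Fin p) × Matrix (Fin p) (Fin p) ℝ × Matrix (Fin p) (Fin p) ℝ ×
      Matrix (Fin p) (Fin p) ℝ) : ℝ :=
  (vᵀ *ᵥ (z.2.1⁻¹ *ᵥ z.1.ofLp)) ⬝ᵥ
    ((vᵀ * sandwich z.2.2.1 z.2.2.2 * v)⁻¹ *ᵥ (vᵀ *ᵥ (z.2.1⁻¹ *ᵥ z.1.ofLp)))

lemma continuousAt_waldStat {p m : ℕ} {v : Matrix (Fin p) (Fin m) ℝ}
    {J B : Matrix (Fin p) (Fin p) ℝ} (hJ : IsUnit J) (hS : IsUnit (vᵀ * sandwich J B * v))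
    (u : EuclideanSpace ℝ (Fin p)) : ContinuousAt (waldStat v) (u, (J, (J, B))) := by
  have h1 : Tendsto (fun z : EuclideanSpace ℝ (Fin p) × Matrix (Fin p) (Fin p) ℝ ×
      Matrix (Fin p) (Fin p) ℝ × Matrix (Fin p) (Fin p) ℝ => z.2.1⁻¹) (𝓝 (u, (J, (J, B))))
      (𝓝 J⁻¹) :=
    (continuousAt_inv_matrix hJ).tendsto.comp
      ((continuous_fst.comp continuous_snd).tendsto (u, (J, (J, B))))
  have h2 : Tendsto (fun z : EuclideanSpace ℝ (Fin p) × Matrix (Fin p) (Fin p) ℝ ×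
      Matrix (Fin p) (Fin p) ℝ × Matrix (Fin p) (Fin p) ℝ => sandwich z.2.2.1 z.2.2.2)
      (𝓝 (u, (J, (J, B)))) (𝓝 (sandwich J B)) :=
    (continuousAt_sandwich (B := B) hJ).tendsto.comp
      ((continuous_snd.comp continuous_snd).tendsto (u, (J, (J, B))))
  have h3 : Tendsto (fun z : EuclideanSpace ℝ (Fin p) × Matrix (Fin p) (Fin p) ℝ ×
      Matrix (Fin p) (Fin p) ℝ × Matrix (Fin p) (Fin p) ℝ =>
      (vᵀ * sandwich z.2.2.1 z.2.2.2 * v)⁻¹) (𝓝 (u, (J, (J, B))))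
      (𝓝 (vᵀ * sandwich J B * v)⁻¹) := by
    have hv : Continuous fun M : Matrix (Fin p) (Fin p) ℝ => vᵀ * M * v := by fun_prop
    exact (continuousAt_inv_matrix hS).tendsto.comp ((hv.tendsto _).comp h2)
  have h4 : Continuous fun y : EuclideanSpace ℝ (Fin p) × Matrix (Fin p) (Fin p) ℝ ×
      Matrix (Fin m) (Fin m) ℝ => (vᵀ *ᵥ (y.2.1 *ᵥ y.1.ofLp)) ⬝ᵥ
        (y.2.2 *ᵥ (vᵀ *ᵥ (y.2.1 *ᵥ y.1.ofLp))) := by fun_prop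
  have h5 : Tendsto (fun z : EuclideanSpace ℝ (Fin p) × Matrix (Fin p) (Fin p) ℝ ×
      Matrix (Fin p) (Fin p) ℝ × Matrix (Fin p) (Fin p) ℝ => z.1) (𝓝 (u, (J, (J, B)))) (𝓝 u) :=
    continuous_fst.tendsto (u, (J, (J, B)))
  have h6 := h5.prodMk_nhds (h1.prodMk_nhds h3)
  have h7 := (h4.tendsto (u, (J⁻¹, (vᵀ * sandwich J B * v)⁻¹))).comp h6
  exact h7

/-- The Wald statistic of the confidence set is `waldStat` at the scaled score. -/
lemma waldStat_eq {m : ℕ} (v : Matrix (Fin p) (Fin m) ℝ) (k : ℕ) (Z : (P k).Assignment)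
    {D : EuclideanSpace ℝ (Fin p) →L[ℝ] EuclideanSpace ℝ (Fin p)}
    (hD : D (θHat k Z - θ₀ k) = -(P k).PsiHat ψ Z (θ₀ k)) (hu : IsUnit (jacobianMatrix D))
    (J B : Matrix (Fin p) (Fin p) ℝ) :
    waldStat v (√((P k).N) • (P k).PsiHat ψ Z (θ₀ k), (jacobianMatrix D, (J, B))) =
      ((P k).N : ℝ) * ((vᵀ *ᵥ (θHat k Z).ofLp - vᵀ *ᵥ (θ₀ k).ofLp) ⬝ᵥ
        ((vᵀ * sandwich J B * v)⁻¹ *ᵥ (vᵀ *ᵥ (θHat k Z).ofLp - vᵀ *ᵥ (θ₀ k).ofLp))) := by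
  have hNk : (0 : ℝ) ≤ (P k).N := by positivity
  have h1 : (jacobianMatrix D)⁻¹ *ᵥ ((P k).PsiHat ψ Z (θ₀ k)).ofLp =
      -(θHat k Z - θ₀ k).ofLp := by
    have h2 := jacobianMatrix_mulVec D (θHat k Z - θ₀ k)
    rw [hD] at h2
    rw [← neg_inj, neg_neg, ← Matrix.mulVec_neg, ← WithLp.ofLp_neg, ← h2, Matrix.mulVec_mulVec,
      Matrix.nonsing_inv_mul _ ((Matrix.isUnit_iff_isUnit_det _).1 hu), Matrix.one_mulVec]
  have hx : vᵀ *ᵥ ((jacobianMatrix D)⁻¹ *ᵥ (√((P k).N) • (P k).PsiHat ψ Z (θ₀ k)).ofLp) =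
      (-√((P k).N)) • (vᵀ *ᵥ (θHat k Z).ofLp - vᵀ *ᵥ (θ₀ k).ofLp) := by
    simp only [WithLp.ofLp_smul, Matrix.mulVec_smul, h1, WithLp.ofLp_sub, Matrix.mulVec_neg,
      Matrix.mulVec_sub, smul_neg, neg_smul]
  simp only [waldStat, hx, Matrix.mulVec_smul, dotProduct_smul, smul_dotProduct, smul_eq_mul,
    ← mul_assoc, neg_mul_neg, Real.mul_self_sqrt hNk]

/-- Asymptotic coverage along a subsequence of populations along which the deterministic matrices
converge. -/
lemma eventually_lt_pr_waldSet (hN : Tendsto (fun k => (P k).N) atTop atTop)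
    (hr : InteriorRoot P ψ Θ θ₀) (hs : Smoothness P ψ Θ θ₀)
    (hb : Boundedness P ψ Θ θ₀) (hc : Consistency P ψ Θ θ₀ θHat)
    (hσ : ∃ c > 0, ∀ k, c ≤ sigmaMin ((P k).sigmaTilde ψ Θ (θ₀ k)))
    {m : ℕ} (hm : 0 < m) {v : Matrix (Fin p) (Fin m) ℝ} (hv : v.rank = m) {ι : ℕ → ℕ}
    (hι : Tendsto ι atTop atTop) {J B V : Matrix (Fin p) (Fin p) ℝ}
    (hJ : Tendsto (fun j => jacobianMatrix ((P (ι j)).PsiDeriv ψ Θ (θ₀ (ι j)))) atTop (𝓝 J))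
    (hB : Tendsto (fun j => meatCov P ψ θ₀ (ι j)) atTop (𝓝 B))
    (hV : Tendsto (fun j => scoreCov P ψ θ₀ (ι j)) atTop (𝓝 V))
    {q : ℝ} (hq : q < 1) {c : ℝ} (hc0 : 0 ≤ c) (hcq : c < q) :
    ∀ᶠ j in atTop, c < (P (ι j)).pr fun Z => vᵀ *ᵥ (θ₀ (ι j)).ofLp ∈
      waldSet (P (ι j)).N v (θHat (ι j) Z) ((P (ι j)).sigmaHat ψ Θ Z (θHat (ι j) Z))
        (quantile (chiSquared m) q) := by
  obtain ⟨hJu, hS⟩ := isUnit_and_posDef_of_tendsto hb hσ hv hJ hB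
  obtain ⟨D, hD, hDeq⟩ := exists_slope hr hs hb hc
  have hVp : V.PosSemidef := posSemidef_of_tendsto (.of_forall fun j => posSemidef_scoreCov _) hV
  have hVB : ∀ w : Fin p → ℝ, w ⬝ᵥ V *ᵥ w ≤ w ⬝ᵥ B *ᵥ w := by
    intro w
    have hcont : Continuous fun A : Matrix (Fin p) (Fin p) ℝ => w ⬝ᵥ A *ᵥ w := by fun_prop
    refine le_of_tendsto_of_tendsto ((hcont.tendsto V).comp hV) ((hcont.tendsto B).comp hB) ?_
    filter_upwards [hι.eventually (eventually_one_lt_N hN)] with j hj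
    exact dotProduct_scoreCov_le_meatCov hj w
  have hYlim : Tendsto (fun ω : Σ k, (P k).Assignment => (jacobianMatrix (D ω),
      (jacobianMatrix ((P ω.1).PsiHatDeriv ψ Θ ω.2 (θHat ω.1 ω.2)), meatHat P ψ θHat ω)))
      (whp P (map ι atTop)) (𝓝 (J, (J, B))) :=
    (tendsto_whp_of_sub hι (a := fun k => jacobianMatrix ((P k).PsiDeriv ψ Θ (θ₀ k)))
      (tendsto_jacobianMatrix_sub hD) hJ).prodMk_nhds
      (tendsto_PsiHatDeriv_meatHat hN hr hs hb hc hι hJ hB)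
  refine eventually_lt_pr_of_tendsto (U := fun k Z => √((P k).N) • (P k).PsiHat ψ Z (θ₀ k))
    (tendsto_law hN hr hb hι hVp hV) hYlim
    (A := fun ω => vᵀ *ᵥ (θ₀ ω.1).ofLp ∈
      waldSet (P ω.1).N v (θHat ω.1 ω.2) ((P ω.1).sigmaHat ψ Θ ω.2 (θHat ω.1 ω.2))
        (quantile (chiSquared m) q))
    (O := {z | IsUnit z.2.1 ∧ waldStat v z < quantile (chiSquared m) q}) ?_ hc0 ?_
  · filter_upwards [hDeq.filter_mono (whp_mono hι)] with ω hω hO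
    obtain ⟨hu, hlt⟩ := hO
    rw [waldStat_eq v ω.1 ω.2 hω hu] at hlt
    exact hlt.le
  · have hT : vᵀ * sandwich J B * v = (vᵀ * J⁻¹) * B * (vᵀ * J⁻¹)ᵀ := by
      rw [sandwich, Matrix.transpose_mul, Matrix.transpose_transpose, Matrix.transpose_nonsing_inv]
      simp only [Matrix.mul_assoc]
    have hcov := le_multivariateGaussian_wald hm hVp hVB (R := vᵀ * J⁻¹) (hT ▸ hS) hq
    refine lt_of_lt_of_le ((ENNReal.ofReal_lt_ofReal_iff (hc0.trans_lt hcq)).2 hcq)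
      (hcov.trans (measure_mono fun u hu => ?_))
    have hfu : waldStat v (u, (J, (J, B))) < quantile (chiSquared m) q := by
      simpa only [waldStat, hT, Matrix.mulVec_mulVec, Set.mem_ofPred_eq] using hu
    have hev1 : ∀ᶠ z : EuclideanSpace ℝ (Fin p) × Matrix (Fin p) (Fin p) ℝ ×
        Matrix (Fin p) (Fin p) ℝ × Matrix (Fin p) (Fin p) ℝ in 𝓝 (u, (J, (J, B))), IsUnit z.2.1 :=
      (isOpen_isUnit_matrix.preimage (by fun_prop)).mem_nhds (show IsUnit J from hJu)
    exact hev1.and ((continuousAt_waldStat hJu hS.isUnit u).eventually_lt_const hfu)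

end Coverage

end

theorem corollary1 {𝒴 𝒳 : Type*} {p : ℕ}
    (P : ℕ → FinitePopulation 𝒴 𝒳)
    (hN : Tendsto (fun k => (P k).N) atTop atTop)
    (ψ : EstimatingFunction 𝒴 𝒳 p)
    (Θ : Set (EuclideanSpace ℝ (Fin p)))
    (θ₀ : ℕ → EuclideanSpace ℝ (Fin p))
    (θHat : (k : ℕ) → (P k).Assignment → EuclideanSpace ℝ (Fin p))
    (hroot : InteriorRoot P ψ Θ θ₀)
    (hsmooth : Smoothness P ψ Θ θ₀)
    (hbdd : Boundedness P ψ Θ θ₀)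
    (hcons : Consistency P ψ Θ θ₀ θHat)
    (hσ : ∃ c > 0, ∀ k, c ≤ sigmaMin ((P k).sigmaTilde ψ Θ (θ₀ k)))
    {m : ℕ} (v : Matrix (Fin p) (Fin m) ℝ) (hv : v.rank = m)
    (α : ℝ) (hα : α ∈ Set.Ioo (0 : ℝ) 1) :
    -- the inverses in the confidence set exist with probability tending to one
    Tendsto (fun k => (P k).pr fun Z =>
      IsUnit (jacobianMatrix ((P k).PsiHatDeriv ψ Θ Z (θHat k Z))) ∧
        IsUnit (vᵀ * (P k).sigmaHat ψ Θ Z (θHat k Z) * v)) atTop (𝓝 1) ∧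
    -- asymptotic coverage
    1 - α ≤ liminf (fun k => (P k).pr fun Z =>
      vᵀ *ᵥ (θ₀ k).ofLp ∈ waldSet (P k).N v (θHat k Z) ((P k).sigmaHat ψ Θ Z (θHat k Z))
        (quantile (chiSquared m) (1 - α))) atTop := by
  have hq : 0 < 1 - α := by linarith [hα.2]
  refine ⟨?_, ?_⟩
  · refine tendsto_of_subseq_tendsto fun ι hι => ?_
    obtain ⟨φ, hφ, J, B, V, hJ, hB, -⟩ := exists_subseq_tendsto hN hbdd hι
    have h := eventually_isUnit (ι := ι ∘ φ) hN hroot hsmooth hbdd hcons hσ hv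
      (hι.comp hφ.tendsto_atTop) hJ hB
    exact ⟨φ, tendsto_map'_iff.1 (eventually_whp.1 h)⟩
  · have hcobdd : IsCoboundedUnder (· ≥ ·) atTop fun k => (P k).pr fun Z =>
        vᵀ *ᵥ (θ₀ k).ofLp ∈ waldSet (P k).N v (θHat k Z) ((P k).sigmaHat ψ Θ Z (θHat k Z))
          (quantile (chiSquared m) (1 - α)) :=
      (isBoundedUnder_of ⟨1, fun k => (P k).pr_le_one _⟩).isCoboundedUnder_ge
    rcases Nat.eq_zero_or_pos m with rfl | hm
    · -- in dimension zero the confidence set is the whole space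
      refine le_liminf_of_le hcobdd (.of_forall fun k => ?_)
      rw [(P k).pr_eq_one fun Z _ => ?_]
      · linarith [hα.1]
      · simpa [waldSet] using quantile_chiSquared_nonneg 0 hq
    refine le_of_forall_lt_imp_le_of_dense fun c hc => ?_
    refine le_liminf_of_le hcobdd ?_
    by_contra hcon
    rw [not_eventually] at hcon
    obtain ⟨ι, hι, hbad⟩ := extraction_of_frequently_atTop hcon
    obtain ⟨φ, hφ, J, B, V, hJ, hB, hV⟩ := exists_subseq_tendsto hN hbdd hι.tendsto_atTop
    have h := eventually_lt_pr_waldSet (ι := ι ∘ φ) (c := max c 0) hN hroot hsmooth hbdd hcons hσ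
      hm hv (hι.tendsto_atTop.comp hφ.tendsto_atTop) hJ hB hV (by linarith [hα.1])
      (le_max_right _ _) (max_lt hc hq)
    obtain ⟨j, hj⟩ := h.exists
    exact hbad (φ j) ((le_max_left _ _).trans hj.le)
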